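/- Let $n\ge 0$, let $\mathcal H=L^2(\mathbb R^n;\mathbb C)$ carry the position and momentum operators $Q^j,P^j$, put $\hat{\mathbf R}=(Q^1,P^1,\dots,Q^n,P^n)^T$ and $\Delta=\bigoplus_{j=1}^n\begin{pmatrix}0&1\\-1&0\end{pmatrix}$, so that $[\hat R^i,\hat R^j]=i\Delta^{ij}$. For a row vector $\mathbf k\in\mathbb R^{2n}$ let $e^{i\mathbf k\hat{\mathbf R}}$ be the Weyl operator. Let $\mathfrak H$ be the space of Hilbert–Schmidt operators on $\mathcal H$ with the Hilbert–Schmidt norm. The characteristic function of $X\in\mathfrak H$ is $\chi_X(\mathbf k)=\mathrm{Tr}(Xe^{i\mathbf k\hat{\mathbf R}})$, an element of $L^2(\mathbb R^{2n})$ (for general $X$ the trace series $\sum_j\langle e_j,Xe^{i\mathbf k\hat{\mathbf R}}e_j\rangle$ over an orthonormal basis is taken to converge in $L^2(\mathbb R^{2n})$; for a density operator it converges for every $\mathbf k$). For a real symmetric $2n\times2n$ matrix $\sigma$ with $\sigma\ge\pm i\Delta$ (both signs) and $\mathbf x\in\mathbb R^{2n}$, the Gaussian state $\rho_G(\sigma,\mathbf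 x)$ is the density operator with characteristic function $e^{-\frac14\mathbf k\sigma\mathbf k^T+i\mathbf k\mathbf x}$. For a density operator $\rho$ with finite second moments, the first moment is $x^i=\langle\hat R^i\rangle$ and the covariance matrix is $\sigma^{ij}=\langle\{\hat R^i-x^i,\hat R^j-x^j\}\rangle$; equivalently, for each $\mathbf k$, the distribution of $\mathbf k\hat{\mathbf R}$, i.e. the probability measure on $\mathbb R$ with Fourier transform $t\mapsto\chi_\rho(t\mathbf k)$, has mean $\mathbf k\mathbf x$ and variance $\frac12\mathbf k\sigma\mathbf k^T$. In this second form the definition also applies to an operator $X\in\mathfrak H$ for which $\chi_X$ has a continuous representative and such probability measures exist. **Theorem.** (1) Let $\Phi:\mathfrak H\to\mathfrak H$ be a bounded linear map that sends Gaussian states to Gaussian states. Then there are real $2n\times 2n$ matrices $K,\alpha$, with $\alpha$ symmetric and $K$ invertible, and $\mathbf y_0\in\mathbb R^{2n}$ such that: (a) for every $X\in\mathfrak H$, $\chi_{\Phi(X)}(\mathbf k)=\chi_X(\mathbf kK)\,e^{-\frac14\mathbf k\alpha\mathbf k^T+i\mathbf k\mathbf y_0}$ in $L^2(\mathbb R^{2n})$;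 (b) $\Phi(\rho_G(\sigma,\mathbf x))=\rho_G(K\sigma K^T+\alpha,\,K\mathbf x+\mathbf y_0)$ for every Gaussian state; more generally, if a density operator $\rho$ has finite second moments, with first moment $\mathbf x$ and covariance matrix $\sigma$, then $\Phi(\rho)$ (whether or not it is a density operator) has first moment $K\mathbf x+\mathbf y_0$ and covariance matrix $K\sigma K^T+\alpha$; (c) $K\sigma K^T+\alpha\ge\pm i\Delta$ for every real symmetric $\sigma$ with $\sigma\ge\pm i\Delta$. (2) Let $\Phi$ be a bounded linear map of the Banach space of finite signed Borel measures on $\mathbb R^n$ (total variation norm) with the Feller property: for every bounded continuous $f:\mathbb R^n\to\mathbb R$ there is a bounded continuous $g$ with $\int f\,d\Phi(\mu)=\int g\,d\mu$ for all $\mu$. If $\Phi$ sends Gaussian probability measures (degenerate ones, such as Dirac measures, included) to Gaussian probability measures, then $\Phi$ is a Markov operator (positive and preserving total mass), and there are real $n\times n$ matrices $K,\alpha$, with $\alpha$ symmetric and $\alpha\ge0$, and $\mathbf y_0\in\mathbb R^n$ such that, for every finite signed measure $\mu$ and every $\mathbf k\in\mathbb R^n$, with $\chi_\mu(\mathbf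 k)=\int e^{i\mathbf k\mathbf x}\,d\mu(\mathbf x)$, $$\chi_{\Phi(\mu)}(\mathbf k)=\chi_\mu(\mathbf kK)\,e^{-\frac14\mathbf k\alpha\mathbf k^T+i\mathbf k\mathbf y_0}.$$ Moreover, if $\mu$ is a probability measure with finite second moments, mean $\mathbf x$ and covariance matrix $\sigma^{ij}=2\int(z^i-x^i)(z^j-x^j)\,d\mu(\mathbf z)$, then $\Phi(\mu)$ has mean $K\mathbf x+\mathbf y_0$ and covariance matrix $K\sigma K^T+\alpha$. -/

import Mathlib

open MeasureTheory ProbabilityTheory Filter Topology VectorMeasure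
open scoped ENNReal Matrix Kronecker ComplexOrder

noncomputable section

namespace GaussianMaps

/-! ### The Hilbert space of `n` modes and its Weyl operators -/

/-- The Hilbert space of `n` harmonic oscillators, `L²(ℝⁿ; ℂ)` (Schrödinger representation). -/
abbrev Modes (n : ℕ) : Type :=
  Lp ℂ 2 (volume : Measure (EuclideanSpace ℝ (Fin n)))

/-- Bounded operators on the Hilbert space of `n` modes. -/
abbrev Op (n : ℕ) : Type := Modes n →L[ℂ] Modes n

/-- Index set of the `2n` quadratures in the order `Q¹, P¹, …, Qⁿ, Pⁿ`:
`(j, 0)` stands for `Qʲ` (multiplication by `xⱼ`) and `(j, 1)` for `Pʲ = -i ∂/∂xⱼ`. -/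
abbrev Quad (n : ℕ) : Type := Fin n × Fin 2

/-- The symplectic form `Δ = ⨁ₖ (0 1; -1 0)`. -/
def symp (n : ℕ) : Matrix (Quad n) (Quad n) ℝ :=
  (1 : Matrix (Fin n) (Fin n) ℝ) ⊗ₖ !![0, 1; -1, 0]

/-- The translation vector of the Weyl operator, i.e. the `P`-components of `k`. -/
def shift {n : ℕ} (k : Quad n → ℝ) : EuclideanSpace ℝ (Fin n) :=
  WithLp.toLp 2 fun j => k (j, 1)

/-- The phase `exp (i ∑ⱼ (aⱼ xⱼ + aⱼ bⱼ / 2))`, where `aⱼ = k (j, 0)` and `bⱼ = k (j, 1)`. -/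
def phase {n : ℕ} (k : Quad n → ℝ) (x : EuclideanSpace ℝ (Fin n)) : ℂ :=
  Complex.exp (((∑ j, (k (j, 0) * x j + k (j, 0) * k (j, 1) / 2) : ℝ) : ℂ) * Complex.I)

lemma norm_phase {n : ℕ} (k : Quad n → ℝ) (x : EuclideanSpace ℝ (Fin n)) : ‖phase k x‖ = 1 :=
  Complex.norm_exp_ofReal_mul_I _

lemma continuous_phase {n : ℕ} (k : Quad n → ℝ) : Continuous (phase k) := by
  unfold phase
  fun_prop

lemma memLp_weyl {n : ℕ} (k : Quad n → ℝ) (ψ : Modes n) :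
    MemLp (fun x => phase k x * ψ (x + shift k)) 2 volume := by
  have h : MemLp (fun x => ψ (x + shift k)) 2 volume :=
    (Lp.memLp ψ).comp_measurePreserving (measurePreserving_add_right volume (shift k))
  refine (memLp_congr_norm ((continuous_phase k).aestronglyMeasurable.mul h.1) h.1 ?_).2 h
  exact Eventually.of_forall fun x => by simp [norm_phase]

lemma ae_shift {n : ℕ} (k : Quad n → ℝ) {p : EuclideanSpace ℝ (Fin n) → Prop}
    (h : ∀ᵐ x, p x) : ∀ᵐ x, p (x + shift k) :=
  (measurePreserving_add_right volume (shift k)).quasiMeasurePreserving.ae h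

/-- The Weyl operator `e^{i k R̂} = e^{i ∑ⱼ (aⱼ Qʲ + bⱼ Pʲ)}` with `aⱼ = k (j, 0)`, `bⱼ = k (j, 1)`:
`(e^{i k R̂} ψ)(x) = e^{i (a·x + a·b/2)} ψ(x + b)`. -/
def weyl {n : ℕ} (k : Quad n → ℝ) : Op n :=
  LinearMap.mkContinuous
    { toFun := fun ψ => (memLp_weyl k ψ).toLp
      map_add' := fun ψ φ => by
        rw [← MemLp.toLp_add, MemLp.toLp_eq_toLp_iff]
        filter_upwards [ae_shift k (Lp.coeFn_add ψ φ)] with x hx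
        rw [AddSubgroup.coe_add] at hx
        simp only [Pi.add_apply, AddSubgroup.coe_add, hx, mul_add]
      map_smul' := fun c ψ => by
        rw [RingHom.id_apply, ← MemLp.toLp_const_smul, MemLp.toLp_eq_toLp_iff]
        filter_upwards [ae_shift k (Lp.coeFn_smul c ψ)] with x hx
        simp [hx, mul_left_comm] } 1
    (fun ψ => by
      have h : eLpNorm (fun x => phase k x * ψ (x + shift k)) 2 volume
          = eLpNorm (fun x => ψ (x + shift k)) 2 volume :=
        eLpNorm_congr_norm_ae (Eventually.of_forall fun x => by simp [norm_phase])
      have h2 : eLpNorm (fun x => ψ (x + shift k)) 2 volume = eLpNorm ψ 2 volume :=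
        eLpNorm_comp_measurePreserving (Lp.aestronglyMeasurable ψ)
          (measurePreserving_add_right volume (shift k))
      rw [one_mul, LinearMap.coe_mk, AddHom.coe_mk, Lp.norm_toLp, h, h2, ← Lp.norm_def])

/-! ### Trace and Hilbert–Schmidt operators -/

/-- An orthonormal basis of the Hilbert space of `n` modes. The notions below that are expressed
through it (Hilbert–Schmidt norm, trace) do not depend on it. -/
def basisSet (n : ℕ) : Set (Modes n) := (exists_hilbertBasis ℂ (Modes n)).choose

/-- See `basisSet`. -/
def onb (n : ℕ) : HilbertBasis (basisSet n) ℂ (Modes n) :=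
  (exists_hilbertBasis ℂ (Modes n)).choose_spec.choose

/-- The summand `⟨eᵢ, T eᵢ⟩` of the trace. -/
def diagEntry {n : ℕ} (T : Op n) (i : basisSet n) : ℂ := inner ℂ (onb n i) (T (onb n i))

/-- The trace `Tr T = ∑ᵢ ⟨eᵢ, T eᵢ⟩` (used for trace-class `T` only). -/
def trace {n : ℕ} (T : Op n) : ℂ := ∑' i, diagEntry T i

/-- The space of Hilbert–Schmidt operators: `Tr (T† T) = ∑ᵢ ‖T eᵢ‖² < ∞`. -/
def HS (n : ℕ) : Submodule ℂ (Op n) where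
  carrier := {T | Summable fun i => ‖T (onb n i)‖ ^ 2}
  zero_mem' := by simp
  add_mem' := by
    intro S T hS hT
    refine Summable.of_nonneg_of_le (fun i => by positivity) (fun i => ?_)
      ((Summable.add hS hT).mul_left 2)
    have h := norm_add_le (S (onb n i)) (T (onb n i))
    rw [add_apply]
    nlinarith [sq_nonneg (‖S (onb n i)‖ - ‖T (onb n i)‖), norm_nonneg (S (onb n i) + T (onb n i))]
  smul_mem' := by
    intro c T hT
    have : (fun i => ‖(c • T) (onb n i)‖ ^ 2) = fun i => ‖c‖ ^ 2 * ‖T (onb n i)‖ ^ 2 := by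
      funext i
      rw [smul_apply, norm_smul, mul_pow]
    change Summable fun i => ‖(c • T) (onb n i)‖ ^ 2
    rw [this]
    exact Summable.mul_left _ hT

/-- The Hilbert–Schmidt norm `‖T‖₂ = (Tr (T† T))^{1/2}`. -/
def hsNorm {n : ℕ} (T : HS n) : ℝ := √(∑' i, ‖(T : Op n) (onb n i)‖ ^ 2)

/-- `f` is (a representative of) the characteristic function `χ_X(k) = Tr (X e^{i k R̂})` of the
Hilbert–Schmidt operator `X`, as an element of `L²(ℝ²ⁿ)`. For general Hilbert–Schmidt `X` the
operator `X e^{i k R̂}` is not trace class, and the series `∑ᵢ ⟨eᵢ, X e^{i k R̂} eᵢ⟩` that defines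
its trace converges in the norm of `L²(ℝ²ⁿ, dk)`. -/
def HasCharFun {n : ℕ} (X : HS n) (f : (Quad n → ℝ) → ℂ) : Prop :=
  MemLp f 2 volume ∧
    Tendsto (fun s : Finset (basisSet n) =>
      eLpNorm (fun k => (∑ i ∈ s, diagEntry ((X : Op n) ∘L weyl k) i) - f k) 2 volume)
      atTop (𝓝 0)

/-! ### States, Gaussian states and moments -/

/-- Density operators: positive operators of trace one. -/
def IsDensity {n : ℕ} (ρ : Op n) : Prop :=
  ρ.IsPositive ∧ HasSum (diagEntry ρ) 1

/-- The matrix inequalities `σ ≥ ± i Δ` (they force the real matrix `σ` to be symmetric). -/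
def IsQuantumCov {n : ℕ} (σ : Matrix (Quad n) (Quad n) ℝ) : Prop :=
  (σ.map Complex.ofReal - Complex.I • (symp n).map Complex.ofReal).PosSemidef ∧
    (σ.map Complex.ofReal + Complex.I • (symp n).map Complex.ofReal).PosSemidef

/-- The factor `exp (- k α kᵀ / 4 + i k y)`. -/
def gaussFactor {ι : Type*} [Fintype ι] (α : Matrix ι ι ℝ) (y : ι → ℝ) (k : ι → ℝ) : ℂ :=
  Complex.exp (((-(k ⬝ᵥ (α *ᵥ k)) / 4 : ℝ) : ℂ) + ((k ⬝ᵥ y : ℝ) : ℂ) * Complex.I)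

/-- The characteristic function `χ_ρ(k) = Tr (ρ e^{i k R̂})` of a density operator `ρ`; here the
trace converges for every `k`. -/
def stateChar {n : ℕ} (ρ : Op n) (k : Quad n → ℝ) : ℂ := trace (ρ ∘L weyl k)

/-- `ρ` is the Gaussian state with covariance matrix `σ ≥ ± i Δ` and first moment `r`: the density
operator with characteristic function `χ_ρ(k) = exp (- k σ kᵀ / 4 + i k r)`. -/
def IsGaussianStateWith {n : ℕ} (ρ : Op n) (σ : Matrix (Quad n) (Quad n) ℝ)
    (r : Quad n → ℝ) : Prop :=
  IsDensity ρ ∧ IsQuantumCov σ ∧ ∀ k, stateChar ρ k = gaussFactor σ r k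

/-- The set of Gaussian states. -/
def IsGaussianState {n : ℕ} (ρ : Op n) : Prop :=
  ∃ σ r, IsGaussianStateWith ρ σ r

/-- Moments of an operator with characteristic function `χ`. The distribution of the observable
`k R̂ = ∑ᵢ kᵢ R̂ⁱ` in a state `ρ` is the probability measure `μ` on `ℝ` with
`∫ e^{i t x} dμ(x) = Tr (ρ e^{i t k R̂}) = χ(t k)` for all real `t`. The first moment
`rⁱ = ⟨R̂ⁱ⟩` and the covariance matrix `σⁱʲ = ⟨{R̂ⁱ - rⁱ, R̂ʲ - rʲ}⟩` (anticommutator, no factor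
`1/2`) are, by linearity and polarization, determined by the requirement that every `k R̂` has
finite second moment, expectation `k r` and variance `k σ kᵀ / 2`. -/
def HasMoments {n : ℕ} (χ : (Quad n → ℝ) → ℂ) (r : Quad n → ℝ)
    (σ : Matrix (Quad n) (Quad n) ℝ) : Prop :=
  σ.IsSymm ∧ ∀ k : Quad n → ℝ, ∃ μ : Measure ℝ, IsProbabilityMeasure μ ∧
    (∀ t : ℝ, charFun μ t = χ (t • k)) ∧ MemLp (fun x : ℝ => x) 2 μ ∧
    ∫ x, x ∂μ = k ⬝ᵥ r ∧ 2 * Var[fun x : ℝ => x; μ] = k ⬝ᵥ (σ *ᵥ k)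

/-! ### Finite signed measures on `ℝⁿ` -/

/-- Boundedness of a linear map of finite signed measures in the total variation norm. -/
def IsTVBounded {n : ℕ}
    (Φ : SignedMeasure (Fin n → ℝ) →ₗ[ℝ] SignedMeasure (Fin n → ℝ)) : Prop :=
  ∃ C : ℝ, ∀ μ, (Φ μ).totalVariation.real Set.univ ≤ C * μ.totalVariation.real Set.univ

/-- The Feller property: the dual map sends bounded continuous functions (acting on signed measures
by integration) to bounded continuous functions. -/
def IsFeller {n : ℕ}
    (Φ : SignedMeasure (Fin n → ℝ) →ₗ[ℝ] SignedMeasure (Fin n → ℝ)) : Prop :=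
  ∀ f : BoundedContinuousFunction (Fin n → ℝ) ℝ,
    ∃ g : BoundedContinuousFunction (Fin n → ℝ) ℝ,
      ∀ μ : SignedMeasure (Fin n → ℝ), ∫ᵛ x, f x ∂<•(Φ μ) = ∫ᵛ x, g x ∂<•μ

/-- Markov operators on signed measures: positive and mass preserving. -/
def IsMarkov {n : ℕ}
    (Φ : SignedMeasure (Fin n → ℝ) →ₗ[ℝ] SignedMeasure (Fin n → ℝ)) : Prop :=
  (∀ μ, 0 ≤ μ → 0 ≤ Φ μ) ∧ ∀ μ, Φ μ Set.univ = μ Set.univ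

/-- The characteristic function `∫ e^{i k x} dμ(x)` of a finite signed measure. -/
def signedCharFun {n : ℕ} (μ : SignedMeasure (Fin n → ℝ)) (k : Fin n → ℝ) : ℂ :=
  ∫ᵛ x, Complex.exp (((k ⬝ᵥ x : ℝ) : ℂ) * Complex.I) ∂<•μ

/-- The measure `μ` has finite second moments, mean `r` and covariance matrix
`σⁱʲ = 2 ∫ (xⁱ - rⁱ) (xʲ - rʲ) dμ` (with the same factor `2` as for quantum states). -/
def HasClassicalMoments {n : ℕ} (μ : Measure (Fin n → ℝ)) (r : Fin n → ℝ)
    (σ : Matrix (Fin n) (Fin n) ℝ) : Prop :=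
  (∀ i, MemLp (fun x : Fin n → ℝ => x i) 2 μ) ∧ (∀ i, ∫ x, x i ∂μ = r i) ∧
    ∀ i j, 2 * ∫ x, (x i - r i) * (x j - r j) ∂μ = σ i j

end GaussianMaps

end

open GaussianMaps

/-!
Both parts rest on one rigidity phenomenon for Gaussian families under the heat flow. Suppose that
a linear map sends the Gaussian with first moment `x + ξ u` and covariance `σ + 2 s u uᵀ` to a
Gaussian, and test the image against a fixed `k`: this gives a normal law with mean `l s ξ` and
variance `q s ξ`. Averaging `ξ` over `N(ξ, h)` replaces `s` by `s + h` before the map is applied,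
and, since the map is linear and continuous, also after it. Hence the mixture of the laws
`N(l s z, q s z)` over `z ~ N(ξ, h)` is `N(l (s + h) ξ, q (s + h) ξ)`.

A Gaussian mixture of normal laws has at least the variance of each component
(`ae_le_of_mixture`), and letting `h → 0` shows that `q s` is constant. Then `l s` itself has a
normal law under `N(ξ, h)`, with a variance independent of `ξ`. A function with normal laws under
all `N(ξ, h)` is Lipschitz (`sq_sub_le_of_map_gaussianReal`), so the heat flow makes it
differentiable, and as `h → 0` the constant variance yields a constant squared derivative.
Therefore `l s` is affine (`rigidity_of_heat_flow`). Polarization over all lines and all `k` shows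
that means transform by `x ↦ K x + y₀` and covariances by `σ ↦ K σ Kᵀ + α`
(`exists_affine_of_gaussian_mixture`).

In the quantum case the Moyal identity (`lintegral_enorm_inner_weyl_sq`) makes `X ↦ χ_X` a multiple
of an isometry from the Hilbert-Schmidt operators into `L²(ℝ²ⁿ)`. Gaussian states with every
admissible covariance exist (`exists_isGaussianStateWith`), and their characteristic functions span
a dense subspace, so `Φ` becomes a bounded operator on `L²(ℝ²ⁿ)`, to which the rigidity applies
(`exists_affine_of_operator`). By density the operator is the substitution `k ↦ k K` followed by
multiplication with a Gaussian (`operator_ae_eq`), and boundedness forces `K` to be invertible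
(`det_ne_zero_of_operator`). That `K σ Kᵀ + α` is again admissible follows from the same fact for
Gaussian states, and the moments follow because the distribution of `k R̂` is convolved with a
normal law. The latter requires `α` to be positive semidefinite, which holds because quantum
covariance matrices can be squeezed in any direction (`posSemidef_of_isQuantumCov`).

In the classical case the Feller property represents the Fourier transform of `Φ μ` at `k` as the
integral of a bounded continuous function against `μ`. Heat averages of that function are again
Gaussian in `k`, so the rigidity applies (`exists_affine_of_isFeller`). The resulting formula says
that the law of `X` is sent to the law of `K X + Z` with an independent Gaussian `Z`
(`map_toSignedMeasure_eq_of_signedCharFun`), from which positivity, mass and moments are read off.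
-/

noncomputable section

namespace GaussianMaps

open scoped NNReal

/-! ### Gaussian mixtures of Gaussian laws on the line -/

/-- A mixture of the normal laws `N(l z, q z)` with the characteristic function of `N(L, Q)` is
`N(L, Q)`. -/
lemma map_mixture_eq_gaussianReal {Ω : Type*} [MeasurableSpace Ω] (γ : Measure Ω)
    [IsProbabilityMeasure γ] {l q : Ω → ℝ} (hl : Measurable l) (hq : Measurable q)
    (hq0 : ∀ z, 0 ≤ q z) {L Q : ℝ} (hQ : 0 ≤ Q)
    (h : ∀ t : ℝ, ∫ z, Complex.exp (t * l z * Complex.I - q z * t ^ 2 / 2) ∂γ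
      = Complex.exp (t * L * Complex.I - Q * t ^ 2 / 2)) :
    (γ.prod (gaussianReal 0 1)).map (fun p : Ω × ℝ => l p.1 + √(q p.1) * p.2)
      = gaussianReal L Q.toNNReal := by
  have hm : Measurable fun p : Ω × ℝ => l p.1 + √(q p.1) * p.2 := by fun_prop
  have : IsProbabilityMeasure ((γ.prod (gaussianReal 0 1)).map
      (fun p : Ω × ℝ => l p.1 + √(q p.1) * p.2)) :=
    Measure.isProbabilityMeasure_map hm.aemeasurable
  refine Measure.ext_of_charFun (funext fun t => ?_)
  rw [charFun_gaussianReal, charFun_apply_real, integral_map hm.aemeasurable (by fun_prop)]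
  rw [Real.coe_toNNReal Q hQ, ← h t, integral_prod]
  · refine integral_congr_ae (Eventually.of_forall fun z => ?_)
    have h1 := charFun_gaussianReal (μ := 0) (v := 1) (t * √(q z))
    rw [charFun_apply_real] at h1
    have h2 : ∀ y : ℝ, Complex.exp (t * ((l z + √(q z) * y : ℝ) : ℂ) * Complex.I)
        = Complex.exp (t * l z * Complex.I) *
          Complex.exp (((t * √(q z) : ℝ) : ℂ) * y * Complex.I) := by
      intro y
      rw [← Complex.exp_add]
      push_cast
      ring_nf
    simp only [h2]
    rw [integral_const_mul, h1, ← Complex.exp_add]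
    congr 1
    have h3 : ((√(q z) : ℝ) : ℂ) ^ 2 = q z := by
      rw [← Complex.ofReal_pow, Real.sq_sqrt (hq0 z)]
    push_cast
    rw [mul_pow, h3]
    ring
  · refine Integrable.of_bound (C := 1) (by fun_prop) (Eventually.of_forall fun p => ?_)
    have := Complex.norm_exp_ofReal_mul_I (t * (l p.1 + √(q p.1) * p.2))
    push_cast at this ⊢
    exact this.le

/-- The moment generating function of a Gaussian mixture that is itself Gaussian. It is
stated with `∫⁻`, which avoids an integrability hypothesis. -/
lemma lintegral_exp_mixture {Ω : Type*} [MeasurableSpace Ω] (γ : Measure Ω)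
    [IsProbabilityMeasure γ] {l q : Ω → ℝ} (hl : Measurable l) (hq : Measurable q)
    (hq0 : ∀ z, 0 ≤ q z) {L Q : ℝ} (hQ : 0 ≤ Q)
    (h : ∀ t : ℝ, ∫ z, Complex.exp (t * l z * Complex.I - q z * t ^ 2 / 2) ∂γ
      = Complex.exp (t * L * Complex.I - Q * t ^ 2 / 2)) (t : ℝ) :
    ∫⁻ z, ENNReal.ofReal (Real.exp (t * l z + q z * t ^ 2 / 2)) ∂γ
      = ENNReal.ofReal (Real.exp (t * L + Q * t ^ 2 / 2)) := by
  have key : ∀ (m : ℝ) (v : ℝ≥0) (t : ℝ),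
      ∫⁻ x, ENNReal.ofReal (Real.exp (t * x)) ∂(gaussianReal m v)
        = ENNReal.ofReal (Real.exp (t * m + v * t ^ 2 / 2)) := by
    intro m v t
    rw [← ofReal_integral_eq_lintegral_ofReal (integrable_exp_mul_gaussianReal t)
      (Eventually.of_forall fun x => (Real.exp_pos _).le)]
    have := mgf_gaussianReal (p := gaussianReal m v) (X := id) Measure.map_id t
    rw [mgf] at this
    simp only [id] at this
    rw [this, mul_comm m t]
  have hm : Measurable fun p : Ω × ℝ => l p.1 + √(q p.1) * p.2 := by fun_prop
  have h1 := key L Q.toNNReal t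
  rw [← map_mixture_eq_gaussianReal γ hl hq hq0 hQ h, Real.coe_toNNReal Q hQ,
    lintegral_map (by fun_prop) hm, lintegral_prod _ (by fun_prop)] at h1
  rw [← h1]
  refine lintegral_congr fun z => ?_
  have h2 : ∀ y : ℝ, ENNReal.ofReal (Real.exp (t * (l z + √(q z) * y)))
      = ENNReal.ofReal (Real.exp (t * l z)) *
        ENNReal.ofReal (Real.exp ((t * √(q z)) * y)) := by
    intro y
    rw [← ENNReal.ofReal_mul (Real.exp_pos _).le, ← Real.exp_add]
    ring_nf
  simp only [h2]
  rw [lintegral_const_mul _ (by fun_prop), key, ← ENNReal.ofReal_mul (Real.exp_pos _).le,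
    ← Real.exp_add, mul_pow, Real.sq_sqrt (hq0 z)]
  simp
  ring_nf

/-- The components of a Gaussian mixture that is itself Gaussian have smaller variance: compare the
growth of the moment generating functions `exp (t² q / 2 + …)` as `t → ∞`. -/
lemma ae_le_of_mixture {Ω : Type*} [MeasurableSpace Ω] (γ : Measure Ω)
    [IsProbabilityMeasure γ] {l q : Ω → ℝ} (hl : Measurable l) (hq : Measurable q)
    (hq0 : ∀ z, 0 ≤ q z) {L Q : ℝ} (hQ : 0 ≤ Q)
    (h : ∀ t : ℝ, ∫ z, Complex.exp (t * l z * Complex.I - q z * t ^ 2 / 2) ∂γ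
      = Complex.exp (t * L * Complex.I - Q * t ^ 2 / 2)) :
    ∀ᵐ z ∂γ, q z ≤ Q := by
  have hmgf := lintegral_exp_mixture γ hl hq hq0 hQ h
  -- adding the identities for `t` and `-t` removes the unknown factor `exp (t l)`
  have h1 : ∀ t : ℝ, 0 ≤ t → ∫⁻ z, ENNReal.ofReal (Real.exp (q z * t ^ 2 / 2)) ∂γ
      ≤ ENNReal.ofReal (2 * Real.exp (t * |L| + Q * t ^ 2 / 2)) := by
    intro t ht
    calc ∫⁻ z, ENNReal.ofReal (Real.exp (q z * t ^ 2 / 2)) ∂γ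
        ≤ ∫⁻ z, (ENNReal.ofReal (Real.exp (t * l z + q z * t ^ 2 / 2))
          + ENNReal.ofReal (Real.exp (-t * l z + q z * (-t) ^ 2 / 2))) ∂γ := by
          refine lintegral_mono fun z => ?_
          rw [← ENNReal.ofReal_add (Real.exp_pos _).le (Real.exp_pos _).le]
          refine ENNReal.ofReal_le_ofReal ?_
          rcases le_total 0 (t * l z) with h0 | h0
          · have : Real.exp (q z * t ^ 2 / 2) ≤ Real.exp (t * l z + q z * t ^ 2 / 2) :=
              Real.exp_le_exp.2 (by linarith)
            linarith [Real.exp_pos (-t * l z + q z * (-t) ^ 2 / 2)]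
          · have : Real.exp (q z * t ^ 2 / 2) ≤ Real.exp (-t * l z + q z * (-t) ^ 2 / 2) :=
              Real.exp_le_exp.2 (by nlinarith)
            linarith [Real.exp_pos (t * l z + q z * t ^ 2 / 2)]
      _ = ENNReal.ofReal (Real.exp (t * L + Q * t ^ 2 / 2))
          + ENNReal.ofReal (Real.exp (-t * L + Q * (-t) ^ 2 / 2)) := by
          rw [lintegral_add_left (by fun_prop), hmgf, hmgf]
      _ ≤ _ := by
          rw [← ENNReal.ofReal_add (Real.exp_pos _).le (Real.exp_pos _).le]
          refine ENNReal.ofReal_le_ofReal ?_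
          have a1 : Real.exp (t * L + Q * t ^ 2 / 2) ≤ Real.exp (t * |L| + Q * t ^ 2 / 2) :=
            Real.exp_le_exp.2 (by nlinarith [le_abs_self L])
          have a2 : Real.exp (-t * L + Q * (-t) ^ 2 / 2) ≤ Real.exp (t * |L| + Q * t ^ 2 / 2) :=
            Real.exp_le_exp.2 (by nlinarith [neg_le_abs L])
          linarith
  have h2 : ∀ ε : ℝ, 0 < ε → γ {z | Q + ε ≤ q z} = 0 := by
    intro ε hε
    have hlim : Tendsto (fun t : ℝ => ENNReal.ofReal (2 * Real.exp (t * (|L| - ε / 2 * t))))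
        atTop (𝓝 (ENNReal.ofReal (2 * 0))) := by
      refine ENNReal.tendsto_ofReal (Tendsto.const_mul 2 (Real.tendsto_exp_atBot.comp ?_))
      refine Tendsto.atTop_mul_atBot₀ tendsto_id ?_
      refine tendsto_atBot_add_const_left _ |L| (f := fun t : ℝ => -(ε / 2 * t)) ?_ |>.congr
        fun t => by ring
      exact tendsto_neg_atTop_atBot.comp (tendsto_id.const_mul_atTop (by positivity))
    rw [mul_zero, ENNReal.ofReal_zero] at hlim
    refine le_antisymm (ge_of_tendsto hlim ?_) zero_le
    filter_upwards [eventually_ge_atTop 0] with t ht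
    have hmarkov := mul_meas_ge_le_lintegral₀ (μ := γ)
      (f := fun z => ENNReal.ofReal (Real.exp (q z * t ^ 2 / 2))) (by fun_prop)
      (ENNReal.ofReal (Real.exp ((Q + ε) * t ^ 2 / 2)))
    have hsub : γ {z | Q + ε ≤ q z} ≤ γ {z | ENNReal.ofReal (Real.exp ((Q + ε) * t ^ 2 / 2))
        ≤ ENNReal.ofReal (Real.exp (q z * t ^ 2 / 2))} := by
      refine measure_mono fun z hz => ?_
      refine ENNReal.ofReal_le_ofReal (Real.exp_le_exp.2 ?_)
      have : Q + ε ≤ q z := hz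
      nlinarith [sq_nonneg t]
    have h3 := (mul_le_mul_right hsub _).trans (hmarkov.trans (h1 t ht))
    have hpos : ENNReal.ofReal (Real.exp ((Q + ε) * t ^ 2 / 2)) ≠ 0 := by
      simp [Real.exp_pos]
    rw [mul_comm, ← ENNReal.le_div_iff_mul_le (Or.inl hpos) (Or.inl ENNReal.ofReal_ne_top),
      ← ENNReal.ofReal_div_of_pos (Real.exp_pos _), mul_div_assoc, ← Real.exp_sub] at h3
    refine h3.trans (le_of_eq ?_)
    congr 3
    ring
  have h3 : ∀ᵐ z ∂γ, ∀ n : ℕ, ¬ (Q + 1 / ((n : ℝ) + 1) ≤ q z) := by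
    rw [ae_all_iff]
    intro n
    exact measure_eq_zero_iff_ae_notMem.1 (h2 _ (by positivity))
  filter_upwards [h3] with z hz
  by_contra! hlt
  obtain ⟨n, hn⟩ := exists_nat_one_div_lt (sub_pos.2 hlt)
  exact hz n (by linarith)

/-! ### Functions with Gaussian laws under the heat flow -/

lemma integral_exp_of_map_eq_gaussianReal {γ : Measure ℝ} {l : ℝ → ℝ}
    (hl : Measurable l) {m : ℝ} {v : ℝ≥0} (h : γ.map l = gaussianReal m v) (t : ℝ) :
    Integrable (fun z => Real.exp (t * l z)) γ ∧
      ∫ z, Real.exp (t * l z) ∂γ = Real.exp (m * t + v * t ^ 2 / 2) := by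
  refine ⟨?_, mgf_gaussianReal h t⟩
  have h1 : Integrable (fun x => Real.exp (t * x)) (γ.map l) := by
    rw [h]; exact integrable_exp_mul_gaussianReal t
  exact h1.comp_measurable hl

/-- If `l` has a Gaussian law of fixed variance `v` under every `N(ξ, h)`, then its mean is a
Lipschitz function of `ξ`. The density of `N(ξ', h)` is dominated by an average of those of
`N(ξ, h)` and `N(2 ξ' - ξ, h)`, which compares the moment generating functions at `ξ'` and `ξ`. -/
lemma sq_sub_le_of_map_gaussianReal {l m : ℝ → ℝ} (hl : Measurable l) {h v : ℝ≥0} (hh : h ≠ 0)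
    (hmap : ∀ ξ, (gaussianReal ξ h).map l = gaussianReal (m ξ) v) (ξ ξ' : ℝ) :
    (m ξ' - m ξ) ^ 2 ≤ v / h * (ξ' - ξ) ^ 2 := by
  have hh' : (0 : ℝ) < h := by positivity
  have key : ∀ t : ℝ, t * (m ξ' - m ξ) ≤ v * t ^ 2 / 2 + (ξ' - ξ) ^ 2 / (2 * h) := by
    intro t
    -- `w` balances the two terms of the inequality of arithmetic and geometric means below
    set w : ℝ := (ξ' - ξ) ^ 2 / (2 * h) - t * m ξ - t ^ 2 * v with hw
    obtain ⟨i1, e1⟩ := integral_exp_of_map_eq_gaussianReal hl (hmap ξ') t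
    obtain ⟨i2, e2⟩ := integral_exp_of_map_eq_gaussianReal hl (hmap ξ) (2 * t)
    have d : ∀ ζ : ℝ, ∀ f : ℝ → ℝ, Integrable f (gaussianReal ζ h) →
        Integrable (fun z => gaussianPDFReal ζ h z * f z) := by
      intro ζ f hf
      rw [gaussianReal_of_var_ne_zero _ hh, integrable_withDensity_iff_integrable_smul'
        (measurable_gaussianPDF _ _) (Eventually.of_forall fun _ => gaussianPDF_lt_top)] at hf
      refine hf.congr (Eventually.of_forall fun z => ?_)
      simp [toReal_gaussianPDF]
    have j1 := d _ _ i1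
    have j2 := d _ _ i2
    rw [integral_gaussianReal_eq_integral_smul hh] at e1 e2
    simp only [smul_eq_mul] at e1 e2
    have j3 : Integrable (gaussianPDFReal (2 * ξ' - ξ) h) := integrable_gaussianPDFReal _ _
    have hle : ∫ z, gaussianPDFReal ξ' h z * Real.exp (t * l z) ≤
        ∫ z, (1 / 2 * Real.exp w * (gaussianPDFReal ξ h z * Real.exp (2 * t * l z))
          + 1 / 2 * Real.exp ((ξ' - ξ) ^ 2 / h - w) * gaussianPDFReal (2 * ξ' - ξ) h z) := by
      refine integral_mono j1 ((j2.const_mul _).add (j3.const_mul _)) fun z => ?_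
      simp only [gaussianPDFReal]
      set c := (√(2 * Real.pi * h))⁻¹
      have hc : 0 ≤ c := by positivity
      have hamgm : ∀ p r : ℝ, Real.exp ((p + r) / 2)
          ≤ 1 / 2 * Real.exp p + 1 / 2 * Real.exp r := by
        intro p r
        have e1 : Real.exp ((p + r) / 2) = Real.exp (p / 2) * Real.exp (r / 2) := by
          rw [← Real.exp_add]; ring_nf
        have e2 : Real.exp p = Real.exp (p / 2) ^ 2 := by
          rw [← Real.exp_nat_mul]; ring_nf
        have e3 : Real.exp r = Real.exp (r / 2) ^ 2 := by
          rw [← Real.exp_nat_mul]; ring_nf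
        rw [e1, e2, e3]
        nlinarith [sq_nonneg (Real.exp (p / 2) - Real.exp (r / 2))]
      have h1 := mul_le_mul_of_nonneg_left (hamgm (w + (-(z - ξ) ^ 2 / (2 * h) + 2 * t * l z))
        ((ξ' - ξ) ^ 2 / h - w + (-(z - (2 * ξ' - ξ)) ^ 2 / (2 * h)))) hc
      have h2 : (w + (-(z - ξ) ^ 2 / (2 * h) + 2 * t * l z)
          + ((ξ' - ξ) ^ 2 / h - w + (-(z - (2 * ξ' - ξ)) ^ 2 / (2 * h)))) / 2
          = -(z - ξ') ^ 2 / (2 * h) + t * l z := by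
        field_simp
        ring
      rw [h2] at h1
      simp only [Real.exp_add] at h1
      linarith
    rw [integral_add (j2.const_mul _) (j3.const_mul _), integral_const_mul, integral_const_mul,
      e1, e2, integral_gaussianPDFReal_eq_one _ hh, mul_one, mul_assoc,
      ← Real.exp_add] at hle
    have e3 : w + (m ξ * (2 * t) + v * (2 * t) ^ 2 / 2) =
        m ξ * t + v * t ^ 2 + (ξ' - ξ) ^ 2 / (2 * h) := by
      rw [hw]; ring
    have e4 : (ξ' - ξ) ^ 2 / h - w = m ξ * t + v * t ^ 2 + (ξ' - ξ) ^ 2 / (2 * h) := by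
      rw [hw]; field_simp; ring
    rw [e3, e4] at hle
    have h5 := Real.exp_le_exp.1 (hle.trans_eq (by ring))
    linarith
  have hd := discrim_le_zero (a := (v : ℝ) / 2) (b := -(m ξ' - m ξ))
    (c := (ξ' - ξ) ^ 2 / (2 * h)) (fun t => by linarith [key t])
  rw [discrim] at hd
  have e : (v : ℝ) / h * (ξ' - ξ) ^ 2 = 4 * (v / 2) * ((ξ' - ξ) ^ 2 / (2 * h)) := by
    field_simp
    ring
  rw [e]
  linarith

lemma integral_gaussianReal_eq_integral_add_mul (f : ℝ → ℝ) (ξ c : ℝ) {h : ℝ≥0}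
    (hc : (h : ℝ) = c ^ 2) (hf : AEStronglyMeasurable f (gaussianReal ξ h)) :
    ∫ z, f z ∂(gaussianReal ξ h) = ∫ y, f (ξ + c * y) ∂(gaussianReal 0 1) := by
  have h1 : gaussianReal ξ h = (gaussianReal 0 1).map (fun y => ξ + c * y) := by
    have : (fun y : ℝ => ξ + c * y) = (fun x => ξ + x) ∘ (fun y => c * y) := rfl
    rw [this, ← Measure.map_map (by fun_prop) (by fun_prop), gaussianReal_map_const_mul,
      gaussianReal_map_const_add]
    congr 1
    · simp
    · ext; simp [hc]
  rw [h1] at hf ⊢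
  rw [integral_map (by fun_prop) hf]

/-- The heat flow turns a Lipschitz function into a differentiable one. -/
lemma differentiable_integral_gaussianReal_of_lipschitz {l : ℝ → ℝ} {C : ℝ≥0}
    (hl : LipschitzWith C l) {h : ℝ≥0} (hh : h ≠ 0) :
    Differentiable ℝ fun ξ => ∫ z, l z ∂(gaussianReal ξ h) := by
  intro ξ
  have hc : (h : ℝ) = (√(h : ℝ)) ^ 2 := (Real.sq_sqrt h.coe_nonneg).symm
  have hc0 : √(h : ℝ) ≠ 0 := by
    rw [Real.sqrt_ne_zero']; positivity
  set c := √(h : ℝ)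
  have heq : (fun ξ => ∫ z, l z ∂(gaussianReal ξ h))
      = fun ξ => ∫ y, l (ξ + c * y) ∂(gaussianReal 0 1) := by
    funext ζ
    exact integral_gaussianReal_eq_integral_add_mul l ζ c hc
      hl.continuous.aestronglyMeasurable
  rw [heq]
  have hint : Integrable (fun y : ℝ => l (ξ + c * y)) (gaussianReal 0 1) := by
    have hid : Integrable (fun y : ℝ => |l ξ| + C * (|c| * |y|)) (gaussianReal 0 1) := by
      refine (integrable_const _).add ((Integrable.const_mul ?_ _).const_mul _)
      exact ((memLp_id_gaussianReal (μ := 0) (v := 1) 1).integrable le_rfl).abs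
    refine hid.mono' ?_ (Eventually.of_forall fun y => ?_)
    · exact (hl.continuous.comp (by fun_prop)).aestronglyMeasurable
    · have := hl.dist_le_mul (ξ + c * y) ξ
      rw [Real.dist_eq, Real.dist_eq, add_sub_cancel_left, abs_mul] at this
      rw [Real.norm_eq_abs]
      have h2 := abs_add_le (l (ξ + c * y) - l ξ) (l ξ)
      rw [sub_add_cancel] at h2
      linarith
  have hdiff : ∀ᵐ y ∂(gaussianReal 0 1), DifferentiableAt ℝ l (ξ + c * y) := by
    have h1 : ∀ᵐ x : ℝ, DifferentiableAt ℝ l x := hl.ae_differentiableAt_real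
    have h2 : ∀ᵐ y : ℝ, DifferentiableAt ℝ l (ξ + c * y) := by
      have q : Measure.QuasiMeasurePreserving (fun y : ℝ => ξ + c * y) volume volume := by
        refine ⟨by fun_prop, ?_⟩
        have : (fun y : ℝ => ξ + c * y) = (fun x => ξ + x) ∘ (fun y => c * y) := rfl
        rw [this, ← Measure.map_map (by fun_prop) (by fun_prop), Real.map_volume_mul_left hc0,
          Measure.map_smul, map_add_left_eq_self]
        exact Measure.smul_absolutelyContinuous
      exact q.ae h1
    exact (gaussianReal_absolutelyContinuous 0 one_ne_zero).ae_le h2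
  have hmain := hasDerivAt_integral_of_dominated_loc_of_lip (μ := gaussianReal 0 1) (𝕜 := ℝ)
    (F := fun ξ y => l (ξ + c * y)) (F' := fun y => deriv l (ξ + c * y)) (x₀ := ξ)
    (s := Set.univ) (bound := fun _ => (C : ℝ)) univ_mem
    (Eventually.of_forall fun ζ => (hl.continuous.comp (by fun_prop)).aestronglyMeasurable)
    hint ((measurable_deriv l).comp (by fun_prop)).aestronglyMeasurable
    (Eventually.of_forall fun y => by
      rw [lipschitzOnWith_univ]
      have : Real.nnabs (C : ℝ) = C := by ext; simp
      rw [this]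
      refine LipschitzWith.of_dist_le_mul fun a b => ?_
      have := hl.dist_le_mul (a + c * y) (b + c * y)
      rwa [dist_add_right] at this)
    (integrable_const _)
    (by
      filter_upwards [hdiff] with y hy
      exact (hy.hasDerivAt).comp_add_const ξ (c * y))
  exact hmain.2.differentiableAt

/-- For Lipschitz `l`, the variance of `l` under `N(ξ, ε²)` is `ε² l'(ξ)²` to leading order. -/
lemma tendsto_variance_gaussianReal_of_lipschitz {l : ℝ → ℝ} {C : ℝ≥0}
    (hl : LipschitzWith C l) {ξ d : ℝ} (hd : HasDerivAt l d ξ) :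
    Tendsto (fun n : ℕ => ((n : ℝ) + 1) ^ 2 *
      Var[l; gaussianReal ξ ((1 / ((n : ℝ≥0) + 1)) ^ 2)]) atTop (𝓝 (d ^ 2)) := by
  set X : ℕ → ℝ → ℝ := fun n y => ((n : ℝ) + 1) * (l (ξ + 1 / ((n : ℝ) + 1) * y) - l ξ)
  have hXc : ∀ n, Continuous (X n) := fun n =>
    continuous_const.mul ((hl.continuous.comp (by fun_prop)).sub continuous_const)
  have hXb : ∀ n y, |X n y| ≤ C * |y| := by
    intro n y
    have h1 := hl.dist_le_mul (ξ + 1 / ((n : ℝ) + 1) * y) ξ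
    have hn : (0 : ℝ) < n + 1 := by positivity
    rw [Real.dist_eq, Real.dist_eq, add_sub_cancel_left, abs_mul,
      abs_of_pos (show 0 < 1 / ((n : ℝ) + 1) by positivity)] at h1
    simp only [X, abs_mul, abs_of_pos hn]
    calc ((n : ℝ) + 1) * |l (ξ + 1 / ((n : ℝ) + 1) * y) - l ξ|
        ≤ ((n : ℝ) + 1) * (C * (1 / ((n : ℝ) + 1) * |y|)) := by gcongr
      _ = C * |y| := by field_simp
  have hXlim : ∀ y, Tendsto (fun n => X n y) atTop (𝓝 (d * y)) := by
    intro y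
    rcases eq_or_ne y 0 with rfl | hy
    · simp [X]
    have hs := hasDerivAt_iff_tendsto_slope_zero.1 hd
    have hu : Tendsto (fun n : ℕ => 1 / ((n : ℝ) + 1) * y) atTop (𝓝[≠] 0) := by
      rw [tendsto_nhdsWithin_iff]
      constructor
      · simpa using (tendsto_one_div_add_atTop_nhds_zero_nat (𝕜 := ℝ)).mul_const y
      · refine Eventually.of_forall fun n => ?_
        have hn : (0 : ℝ) < n + 1 := by positivity
        exact mul_ne_zero (by positivity) hy
    have h2 := (hs.comp hu).mul_const y
    refine h2.congr fun n => ?_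
    have hn : (0 : ℝ) < n + 1 := by positivity
    simp only [X, Function.comp, smul_eq_mul]
    field_simp
  have hid2 : Integrable (fun y : ℝ => (C * |y|) ^ 2) (gaussianReal 0 1) := by
    have := ((memLp_id_gaussianReal (μ := 0) (v := 1) 2).integrable_sq).const_mul ((C : ℝ) ^ 2)
    refine this.congr (Eventually.of_forall fun y => ?_)
    simp [mul_pow]
  have hid1 : Integrable (fun y : ℝ => C * |y|) (gaussianReal 0 1) :=
    (((memLp_id_gaussianReal (μ := 0) (v := 1) 1).integrable le_rfl).abs).const_mul _
  have lim1 : Tendsto (fun n => ∫ y, X n y ∂(gaussianReal 0 1)) atTop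
      (𝓝 (∫ y, d * y ∂(gaussianReal 0 1))) :=
    tendsto_integral_of_dominated_convergence _ (fun n => (hXc n).aestronglyMeasurable) hid1
      (fun n => Eventually.of_forall fun y => hXb n y) (Eventually.of_forall hXlim)
  have lim2 : Tendsto (fun n => ∫ y, X n y ^ 2 ∂(gaussianReal 0 1)) atTop
      (𝓝 (∫ y, (d * y) ^ 2 ∂(gaussianReal 0 1))) :=
    tendsto_integral_of_dominated_convergence _
      (fun n => ((hXc n).pow 2).aestronglyMeasurable) hid2
      (fun n => Eventually.of_forall fun y => by
        rw [Real.norm_eq_abs, abs_pow]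
        exact pow_le_pow_left₀ (abs_nonneg _) (hXb n y) 2)
      (Eventually.of_forall fun y => (hXlim y).pow 2)
  have e1 : ∫ y, d * y ∂(gaussianReal 0 1) = 0 := by
    rw [integral_const_mul, integral_id_gaussianReal, mul_zero]
  have e2 : ∫ y, (d * y) ^ 2 ∂(gaussianReal 0 1) = d ^ 2 := by
    have hv := variance_fun_id_gaussianReal (μ := 0) (v := 1)
    rw [variance_of_integral_eq_zero (by fun_prop) integral_id_gaussianReal] at hv
    simp only [mul_pow]
    rw [integral_const_mul]
    rw [hv]
    simp
  rw [e1] at lim1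
  rw [e2] at lim2
  have lim := lim2.sub (lim1.pow 2)
  simp only [ne_eq, OfNat.ofNat_ne_zero, not_false_eq_true, zero_pow, sub_zero] at lim
  refine lim.congr fun n => ?_
  have hn : (0 : ℝ) < n + 1 := by positivity
  have hX2 : MemLp (X n) 2 (gaussianReal 0 1) := by
    refine (memLp_two_iff_integrable_sq (hXc n).aestronglyMeasurable).2 ?_
    refine hid2.mono' ((hXc n).pow 2).aestronglyMeasurable (Eventually.of_forall fun y => ?_)
    rw [Real.norm_eq_abs, abs_pow]
    exact pow_le_pow_left₀ (abs_nonneg _) (hXb n y) 2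
  have hv := variance_eq_sub hX2
  simp only [Pi.pow_apply] at hv
  rw [← hv]
  simp only [X]
  rw [variance_const_mul, variance_sub_const (X := fun y => l (ξ + 1 / ((n : ℝ) + 1) * y))
    (hl.continuous.comp (by fun_prop)).aestronglyMeasurable]
  congr 1
  have h1 : gaussianReal ξ ((1 / ((n : ℝ≥0) + 1)) ^ 2)
      = (gaussianReal 0 1).map (fun y => ξ + 1 / ((n : ℝ) + 1) * y) := by
    have : (fun y : ℝ => ξ + 1 / ((n : ℝ) + 1) * y)
      = (fun x => ξ + x) ∘ (fun y => 1 / ((n : ℝ) + 1) * y) := rfl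
    rw [this, ← Measure.map_map (by fun_prop) (by fun_prop), gaussianReal_map_const_mul,
      gaussianReal_map_const_add]
    congr 1
    · simp
    · ext; simp
  rw [h1, variance_map hl.continuous.aemeasurable (by fun_prop)]
  rfl

lemma eq_zero_of_forall_exp_eq_one {x : ℝ}
    (h : ∀ t : ℝ, Complex.exp (t * x * Complex.I) = 1) : x = 0 := by
  by_contra hx
  have h1 := h (Real.pi / x)
  have h2 : ((Real.pi / x : ℝ) : ℂ) * x = Real.pi := by
    rw [← Complex.ofReal_mul, div_mul_cancel₀ _ hx]
  rw [h2, Complex.exp_pi_mul_I] at h1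
  norm_num at h1

/-- The characteristic function at `t` of the normal law with mean `l` and variance `q`. -/
def normalChar (l q t : ℝ) : ℂ := Complex.exp (t * l * Complex.I - q * t ^ 2 / 2)

lemma norm_normalChar (l q t : ℝ) : ‖normalChar l q t‖ = Real.exp (-(q * t ^ 2 / 2)) := by
  have h : (t * l * Complex.I - q * t ^ 2 / 2 : ℂ)
      = ((-(q * t ^ 2 / 2) : ℝ) : ℂ) + ((t * l : ℝ) : ℂ) * Complex.I := by
    push_cast; ring
  rw [normalChar, h, Complex.exp_add, norm_mul, Complex.norm_exp_ofReal_mul_I, mul_one,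
    ← Complex.ofReal_exp, Complex.norm_real, Real.norm_eq_abs, abs_of_pos (Real.exp_pos _)]

/-- The variance of a normal law can be read off from the modulus of its characteristic function. -/
lemma variance_eq_neg_two_mul_log (l q : ℝ) : q = -2 * Real.log ‖normalChar l q 1‖ := by
  rw [norm_normalChar, Real.log_exp]; ring

/-- The mean of a normal law is the derivative at `0` of its characteristic function, up to the
factor `i`. Hence it is measurable wherever the characteristic function is. -/
lemma measurable_mean_of_normalChar {Ω : Type*} [MeasurableSpace Ω] {l q : Ω → ℝ}
    (h : ∀ t, Measurable fun z => normalChar (l z) (q z) t) : Measurable l := by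
  have hlim : ∀ z, Tendsto (fun n : ℕ => ((n : ℝ) + 1) *
      (normalChar (l z) (q z) (1 / ((n : ℝ) + 1))).im) atTop (𝓝 (l z)) := by
    intro z
    have hd : HasDerivAt (fun t : ℝ => normalChar (l z) (q z) t) (l z * Complex.I) 0 := by
      have h1 : HasDerivAt (fun t : ℝ => (t : ℂ)) 1 0 := by
        exact Complex.ofRealCLM.hasDerivAt (x := (0 : ℝ))
      have h2 := (((h1.mul_const (l z : ℂ)).mul_const Complex.I).sub
        (((h1.pow 2).const_mul (q z : ℂ)).div_const 2)).cexp
      simpa [normalChar] using h2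
    have hd2 : HasDerivAt (fun t : ℝ => (normalChar (l z) (q z) t).im) (l z) 0 := by
      have h1 := Complex.imCLM.hasFDerivAt.comp_hasDerivAt (0 : ℝ) hd
      have h2 : Complex.imCLM (l z * Complex.I) = l z := by simp
      rw [h2] at h1
      exact h1
    have hs := hasDerivAt_iff_tendsto_slope_zero.1 hd2
    have hu : Tendsto (fun n : ℕ => 1 / ((n : ℝ) + 1)) atTop (𝓝[≠] 0) := by
      rw [tendsto_nhdsWithin_iff]
      refine ⟨tendsto_one_div_add_atTop_nhds_zero_nat, Eventually.of_forall fun n => ?_⟩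
      have hn : (0 : ℝ) < n + 1 := by positivity
      exact (one_div_pos.2 hn).ne'
    refine (hs.comp hu).congr fun n => ?_
    simp [normalChar]
  refine measurable_of_tendsto_metrizable (fun n => ?_) (tendsto_pi_nhds.2 hlim)
  exact (Complex.measurable_im.comp (h _)).const_mul _

/-- A differentiable function whose derivative has constant square is affine, since derivatives
have the intermediate value property. -/
lemma exists_affine_of_deriv_sq_const {l : ℝ → ℝ} (hl : Differentiable ℝ l) {c : ℝ}
    (hc : ∀ x, deriv l x ^ 2 = c) : ∃ a b : ℝ, ∀ x, l x = a + b * x := by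
  have hconst : ∀ x y, deriv l x = deriv l y := by
    intro x y
    have hconv := convex_univ.image_deriv (f := l) (fun x _ => hl x)
    obtain ⟨z, -, hz⟩ := hconv ⟨x, trivial, rfl⟩ ⟨y, trivial, rfl⟩
      (show (0 : ℝ) ≤ 1 / 2 by norm_num) (show (0 : ℝ) ≤ 1 / 2 by norm_num) (by norm_num)
    have h1 := hc x
    have h2 := hc y
    have h3 := hc z
    rw [hz] at h3
    simp only [smul_eq_mul] at h3
    have h4 : (deriv l x - deriv l y) ^ 2 = 0 := by nlinarith
    exact sub_eq_zero.1 (pow_eq_zero_iff two_ne_zero |>.1 h4)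
  refine ⟨l 0, deriv l 0, fun x => ?_⟩
  have hg : Differentiable ℝ fun x => l x - deriv l 0 * x :=
    hl.sub (differentiable_id.const_mul _)
  have := is_const_of_deriv_eq_zero hg (fun y => by
    have : HasDerivAt (fun x => l x - deriv l 0 * x) (deriv l y - deriv l 0 * 1) y :=
      (hl y).hasDerivAt.sub ((hasDerivAt_id y).const_mul _)
    rw [this.deriv, hconst y 0]; ring) x 0
  simp only [mul_zero, sub_zero] at this
  linarith

/-- Rigidity of Gaussian families on the line. Suppose that the normal laws with means `l s ξ` and
variances `q s ξ` are mapped to each other by the heat flow in `(s, ξ)`. Then the mean is affine in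
`ξ` and independent of `s`, and the variance is affine in `s` and independent of `ξ`. -/
theorem rigidity_of_heat_flow {l q : ℝ≥0 → ℝ → ℝ} (hq0 : ∀ s ξ, 0 ≤ q s ξ)
    (hmix : ∀ s h ξ t, ∫ z, normalChar (l s z) (q s z) t ∂(gaussianReal ξ h)
      = normalChar (l (s + h) ξ) (q (s + h) ξ) t)
    (hcont : ∀ s t, Continuous fun ξ => normalChar (l s ξ) (q s ξ) t)
    (hlim : ∀ s ξ t, Tendsto (fun n : ℕ => normalChar (l (s + 1 / ((n : ℝ≥0) + 1)) ξ)
      (q (s + 1 / ((n : ℝ≥0) + 1)) ξ) t) atTop (𝓝 (normalChar (l s ξ) (q s ξ) t))) :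
    ∃ a b : ℝ, ∀ s ξ, l s ξ = a + b * ξ ∧ q s ξ = q 0 0 + s * b ^ 2 := by
  have hlm : ∀ s, Measurable (l s) := fun s =>
    measurable_mean_of_normalChar fun t => (hcont s t).measurable
  have hqc : ∀ s, Continuous (q s) := by
    intro s
    have : q s = fun ξ => -2 * Real.log ‖normalChar (l s ξ) (q s ξ) 1‖ :=
      funext fun ξ => variance_eq_neg_two_mul_log _ _
    rw [this]
    refine continuous_const.mul (Continuous.log (hcont s 1).norm fun ξ => ?_)
    rw [norm_normalChar]; exact (Real.exp_pos _).ne'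
  have hqlim : ∀ s ξ, Tendsto (fun n : ℕ => q (s + 1 / ((n : ℝ≥0) + 1)) ξ) atTop
      (𝓝 (q s ξ)) := by
    intro s ξ
    rw [variance_eq_neg_two_mul_log (l s ξ) (q s ξ)]
    have h0 : ‖normalChar (l s ξ) (q s ξ) 1‖ ≠ 0 := by
      rw [norm_normalChar]; exact (Real.exp_pos _).ne'
    refine (((hlim s ξ 1).norm.log h0).const_mul (-2)).congr fun n => ?_
    rw [← variance_eq_neg_two_mul_log]
  have hpos : ∀ n : ℕ, (1 / ((n : ℝ≥0) + 1)) ≠ 0 := fun n => by positivity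
  -- a Gaussian mixture dominates its components in variance, at every point by continuity
  have hle : ∀ s h, h ≠ 0 → ∀ ξ z, q s z ≤ q (s + h) ξ := by
    intro s h hh ξ z
    have h1 : ∀ᵐ z ∂(gaussianReal ξ h), q s z ≤ q (s + h) ξ :=
      ae_le_of_mixture _ (hlm s) (hqc s).measurable (hq0 s) (hq0 _ _)
        (fun t => hmix s h ξ t)
    have h2 : ∀ᵐ z : ℝ, q s z ≤ q (s + h) ξ :=
      (gaussianReal_absolutelyContinuous' ξ hh).ae_le h1
    have h3 : IsClosed {z | q s z ≤ q (s + h) ξ} := isClosed_le (hqc s) continuous_const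
    have h4 := (Measure.dense_of_ae h2).closure_eq
    rw [h3.closure_eq] at h4
    exact Set.eq_univ_iff_forall.1 h4 z
  -- letting `h → 0`, the variance does not depend on the mean parameter
  have hqconst : ∀ s z ξ, q s z = q s ξ := by
    have : ∀ s z ξ, q s z ≤ q s ξ := fun s z ξ =>
      ge_of_tendsto (hqlim s ξ) (Eventually.of_forall fun n => hle s _ (hpos n) ξ z)
    exact fun s z ξ => le_antisymm (this s z ξ) (this s ξ z)
  set v : ℝ≥0 → ℝ≥0 → ℝ≥0 := fun s h => (q (s + h) 0 - q s 0).toNNReal with hv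
  have hvcoe : ∀ s h, (v s h : ℝ) = q (s + h) 0 - q s 0 := by
    intro s h
    rcases eq_or_ne h 0 with rfl | hh
    · simp [hv]
    · exact Real.coe_toNNReal _ (sub_nonneg.2 (hle s h hh 0 0))
  -- the constant variance divides out, and the law of the mean itself is normal
  have hmap : ∀ s h ξ, (gaussianReal ξ h).map (l s) = gaussianReal (l (s + h) ξ) (v s h) := by
    intro s h ξ
    have : IsProbabilityMeasure ((gaussianReal ξ h).map (l s)) :=
      Measure.isProbabilityMeasure_map (hlm s).aemeasurable
    refine Measure.ext_of_charFun (funext fun t => ?_)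
    rw [charFun_gaussianReal, charFun_apply_real,
      integral_map (hlm s).aemeasurable (by fun_prop)]
    have h1 := hmix s h ξ t
    have h2 : ∀ z, normalChar (l s z) (q s z) t
        = Complex.exp (t * l s z * Complex.I) * Complex.exp (-(q s 0 * t ^ 2 / 2)) := by
      intro z
      rw [normalChar, hqconst s z 0, ← Complex.exp_add]
      ring_nf
    simp only [h2] at h1
    rw [integral_mul_const] at h1
    have h3 : normalChar (l (s + h) ξ) (q (s + h) ξ) t
        = Complex.exp (t * l (s + h) ξ * Complex.I - (v s h : ℝ) * t ^ 2 / 2)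
          * Complex.exp (-(q s 0 * t ^ 2 / 2)) := by
      rw [normalChar, hqconst (s + h) ξ 0, ← Complex.exp_add, hvcoe]
      push_cast
      ring_nf
    rw [h3] at h1
    exact mul_right_cancel₀ (Complex.exp_ne_zero _) h1
  have hmean : ∀ s h ξ, ∫ z, l s z ∂(gaussianReal ξ h) = l (s + h) ξ := by
    intro s h ξ
    have h1 := integral_id_gaussianReal (μ := l (s + h) ξ) (v := v s h)
    rw [← hmap, integral_map (hlm s).aemeasurable (by fun_prop)] at h1
    exact h1
  have hvar : ∀ s h ξ, Var[l s; gaussianReal ξ h] = v s h := by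
    intro s h ξ
    have h1 := variance_fun_id_gaussianReal (μ := l (s + h) ξ) (v := v s h)
    rw [← hmap, variance_map (by fun_prop) (hlm s).aemeasurable] at h1
    exact h1
  -- half of the time `s` is spent on making `l` Lipschitz, then half on making it differentiable
  have hlip : ∀ s, s ≠ 0 → ∃ C, LipschitzWith C (l s) := by
    intro s hs
    have hs2 : s / 2 ≠ 0 := by positivity
    refine ⟨Real.toNNReal √((v (s / 2) (s / 2) : ℝ) / ((s / 2 : ℝ≥0) : ℝ)),
      LipschitzWith.of_dist_le_mul fun x y => ?_⟩
    have h1 := sq_sub_le_of_map_gaussianReal (hlm (s / 2)) hs2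
      (m := l (s / 2 + s / 2)) (v := v (s / 2) (s / 2)) (fun ξ => hmap _ _ ξ) y x
    rw [add_halves] at h1
    rw [Real.coe_toNNReal _ (Real.sqrt_nonneg _), Real.dist_eq, Real.dist_eq,
      ← Real.sqrt_sq_eq_abs, ← Real.sqrt_sq_eq_abs, ← Real.sqrt_mul (by positivity)]
    exact Real.sqrt_le_sqrt h1
  have hdiff : ∀ s, s ≠ 0 → Differentiable ℝ (l s) := by
    intro s hs
    have hs2 : s / 2 ≠ 0 := by positivity
    obtain ⟨C, hC⟩ := hlip (s / 2) hs2
    have h1 := differentiable_integral_gaussianReal_of_lipschitz hC hs2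
    have h2 : (fun ξ => ∫ z, l (s / 2) z ∂(gaussianReal ξ (s / 2))) = l s := by
      funext ξ
      rw [hmean, add_halves]
    rwa [h2] at h1
  -- the variance of `l s` under `N(ξ, h)` does not depend on `ξ`; the limit `h → 0` of its
  -- quotient by `h` is the squared derivative of `l s`
  have haff : ∀ s, s ≠ 0 → ∃ a b : ℝ, ∀ ξ, l s ξ = a + b * ξ := by
    intro s hs
    obtain ⟨C, hC⟩ := hlip s hs
    refine exists_affine_of_deriv_sq_const (hdiff s hs) (c := deriv (l s) 0 ^ 2) fun ξ => ?_
    have h1 := tendsto_variance_gaussianReal_of_lipschitz hC ((hdiff s hs ξ).hasDerivAt)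
    have h2 := tendsto_variance_gaussianReal_of_lipschitz hC ((hdiff s hs 0).hasDerivAt)
    simp only [hvar] at h1 h2
    exact tendsto_nhds_unique h1 h2
  have hstep : ∀ s, s ≠ 0 → ∀ h ξ, l (s + h) ξ = l s ξ := by
    intro s hs h ξ
    obtain ⟨a, b, hab⟩ := haff s hs
    rw [← hmean, hab ξ]
    simp only [hab]
    have hid : Integrable (fun z : ℝ => z) (gaussianReal ξ h) :=
      (memLp_id_gaussianReal 1).integrable le_rfl
    rw [integral_add (integrable_const _) (hid.const_mul b), integral_const_mul,
      integral_id_gaussianReal]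
    simp
  obtain ⟨a, b, hab⟩ := haff 1 one_ne_zero
  have hl : ∀ s, s ≠ 0 → ∀ ξ, l s ξ = a + b * ξ := by
    intro s hs ξ
    rw [← hab, ← hstep s hs 1 ξ, add_comm, hstep 1 one_ne_zero]
  -- the case `s = 0` is a limit of characteristic functions
  have hl0 : ∀ s ξ, l s ξ = a + b * ξ := by
    intro s ξ
    have h1 : ∀ t : ℝ, Complex.exp (t * (a + b * ξ - l s ξ : ℝ) * Complex.I) = 1 := by
      intro t
      have hn : ∀ n : ℕ, l (s + 1 / ((n : ℝ≥0) + 1)) ξ = a + b * ξ := fun n =>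
        hl _ (by positivity) ξ
      have h2 : Tendsto (fun n : ℕ => normalChar (a + b * ξ) (q (s + 1 / ((n : ℝ≥0) + 1)) ξ) t)
          atTop (𝓝 (normalChar (a + b * ξ) (q s ξ) t)) := by
        have hc : Continuous fun x : ℝ => normalChar (a + b * ξ) x t := by
          unfold normalChar; fun_prop
        exact (hc.tendsto _).comp (hqlim s ξ)
      have h3 := hlim s ξ t
      simp only [hn] at h3
      have h4 := tendsto_nhds_unique h2 h3
      have h5 : normalChar (a + b * ξ) (q s ξ) t = normalChar (l s ξ) (q s ξ) t *
          Complex.exp (t * (a + b * ξ - l s ξ : ℝ) * Complex.I) := by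
        rw [normalChar, normalChar, ← Complex.exp_add]
        push_cast
        ring_nf
      rw [h5] at h4
      exact mul_left_cancel₀ (Complex.exp_ne_zero _) (h4.trans (mul_one _).symm)
    linarith [eq_zero_of_forall_exp_eq_one h1]
  refine ⟨a, b, fun s ξ => ⟨hl0 s ξ, ?_⟩⟩
  have h1 := hvar 0 s 0
  rw [hvcoe, zero_add] at h1
  have h2 : l 0 = fun z => b * z + a := funext fun z => by rw [hl0]; ring
  rw [h2, variance_add_const (by fun_prop), variance_const_mul, variance_fun_id_gaussianReal] at h1
  rw [hqconst s ξ 0]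
  linarith

/-! ### Rigidity of Gaussian families in several dimensions -/

lemma IsSymm.eq_of_forall_dotProduct_mulVec {ι : Type*} [Fintype ι] [DecidableEq ι]
    {A B : Matrix ι ι ℝ} (hA : A.IsSymm) (hB : B.IsSymm)
    (h : ∀ k, k ⬝ᵥ (A *ᵥ k) = k ⬝ᵥ (B *ᵥ k)) : A = B := by
  have key : ∀ (A : Matrix ι ι ℝ) (i j : ι),
      (Pi.single i (1 : ℝ)) ⬝ᵥ (A *ᵥ Pi.single j 1) = A i j := by
    intro A i j; simp
  ext i j
  have h1 := h (Pi.single i 1 + Pi.single j 1)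
  have h2 := h (Pi.single i 1)
  have h3 := h (Pi.single j 1)
  simp only [Matrix.mulVec_add, add_dotProduct, dotProduct_add, key] at h1 h2 h3
  have h4 := hA.apply i j
  have h5 := hB.apply i j
  linarith

lemma dotProduct_vecMulVec_mulVec {ι : Type*} [Fintype ι] (k u v w : ι → ℝ) :
    k ⬝ᵥ (Matrix.vecMulVec u v *ᵥ w) = (k ⬝ᵥ u) * (v ⬝ᵥ w) := by
  rw [Matrix.vecMulVec_mulVec]
  simp [dotProduct, Finset.sum_mul, mul_assoc]

lemma dotProduct_conj_mulVec {ι : Type*} [Fintype ι] (K σ : Matrix ι ι ℝ) (k w : ι → ℝ) :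
    k ⬝ᵥ ((K * σ * Kᵀ) *ᵥ w) = (k ᵥ* K) ⬝ᵥ (σ *ᵥ (w ᵥ* K)) := by
  rw [← Matrix.mulVec_mulVec, ← Matrix.mulVec_mulVec, Matrix.mulVec_transpose,
    Matrix.dotProduct_mulVec]

lemma gaussFactor_smul {ι : Type*} [Fintype ι] (α : Matrix ι ι ℝ) (y k : ι → ℝ) (t : ℝ) :
    gaussFactor α y (t • k) = normalChar (k ⬝ᵥ y) (k ⬝ᵥ (α *ᵥ k) / 2) t := by
  rw [gaussFactor, normalChar, Matrix.mulVec_smul, smul_dotProduct, smul_dotProduct,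
    dotProduct_smul]
  congr 1
  simp only [smul_eq_mul]
  push_cast
  ring

/-- A property of symmetric matrices that is stable under adding positive multiples of `u uᵀ` is
stable under adding positive semidefinite matrices. -/
lemma PosSemidef.add_induction {ι : Type*} [Fintype ι] [DecidableEq ι]
    {p : Matrix ι ι ℝ → Prop}
    (hp : ∀ σ u, p σ → p (σ + Matrix.vecMulVec u u)) {σ τ : Matrix ι ι ℝ}
    (hσ : p σ) (hτ : τ.PosSemidef) : p (σ + τ) := by
  obtain ⟨m, B, rfl⟩ := Matrix.posSemidef_iff_eq_sum_vecMulVec.1 hτ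
  have : ∀ s : Finset (Fin m), p (σ + ∑ i ∈ s, Matrix.vecMulVec (B i) (star (B i))) := by
    intro s
    induction s using Finset.induction_on with
    | empty => simpa
    | insert a s ha ih =>
      rw [Finset.sum_insert ha, add_comm (Matrix.vecMulVec _ _), ← add_assoc]
      exact hp _ _ ih
  exact this _

lemma vecMulVec_smul_smul {ι : Type*} (c : ℝ) (u : ι → ℝ) :
    Matrix.vecMulVec (c • u) (c • u) = c ^ 2 • Matrix.vecMulVec u u := by
  ext i j
  simp [Matrix.vecMulVec_apply]; ring

/-- Rigidity of Gaussian families. If Gaussian factors with parameters `S σ x`, `Y σ x` are mapped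
to each other when `x` is averaged over a line with a normal law, then `S` and `Y` are affine. -/
theorem exists_affine_of_gaussian_mixture {ι : Type*} [Fintype ι] [DecidableEq ι]
    {𝒮 : Set (Matrix ι ι ℝ)} (hne : 𝒮.Nonempty) (hpsd : ∀ σ ∈ 𝒮, σ.PosSemidef)
    (hadd : ∀ σ ∈ 𝒮, ∀ u, σ + Matrix.vecMulVec u u ∈ 𝒮)
    {S : Matrix ι ι ℝ → (ι → ℝ) → Matrix ι ι ℝ} {Y : Matrix ι ι ℝ → (ι → ℝ) → ι → ℝ}
    (hS : ∀ σ ∈ 𝒮, ∀ x, (S σ x).PosSemidef)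
    (hmix : ∀ σ ∈ 𝒮, ∀ x u k, ∀ (h : ℝ≥0) (ξ : ℝ),
      ∫ z : ℝ, gaussFactor (S σ (x + z • u)) (Y σ (x + z • u)) k ∂(gaussianReal ξ h)
        = gaussFactor (S (σ + (2 * h : ℝ) • Matrix.vecMulVec u u) (x + ξ • u))
          (Y (σ + (2 * h : ℝ) • Matrix.vecMulVec u u) (x + ξ • u)) k)
    (hcont : ∀ σ ∈ 𝒮, ∀ x u k, Continuous fun ξ : ℝ =>
      gaussFactor (S σ (x + ξ • u)) (Y σ (x + ξ • u)) k)
    (hlim : ∀ σ ∈ 𝒮, ∀ x u k, Tendsto (fun n : ℕ =>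
      gaussFactor (S (σ + (2 * (1 / ((n : ℝ) + 1))) • Matrix.vecMulVec u u) x)
        (Y (σ + (2 * (1 / ((n : ℝ) + 1))) • Matrix.vecMulVec u u) x) k) atTop
      (𝓝 (gaussFactor (S σ x) (Y σ x) k))) :
    ∃ (K α : Matrix ι ι ℝ) (y₀ : ι → ℝ), α.IsSymm ∧
      ∀ σ ∈ 𝒮, ∀ x, S σ x = K * σ * Kᵀ + α ∧ Y σ x = K *ᵥ x + y₀ := by
  have hsymm : ∀ σ ∈ 𝒮, ∀ x, (S σ x).IsSymm := fun σ hσ x => by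
    simpa using (hS σ hσ x).isHermitian
  have hnn : ∀ σ ∈ 𝒮, ∀ x k, 0 ≤ k ⬝ᵥ (S σ x *ᵥ k) := fun σ hσ x k => by
    simpa using (hS σ hσ x).dotProduct_mulVec_nonneg k
  have hadd' : ∀ σ ∈ 𝒮, ∀ c : ℝ, 0 ≤ c → ∀ u, σ + c • Matrix.vecMulVec u u ∈ 𝒮 := by
    intro σ hσ c hc u
    have := hadd σ hσ (√c • u)
    rwa [vecMulVec_smul_smul, Real.sq_sqrt hc] at this
  -- the one-dimensional statement along the line `x + ξ u` for the functional `k`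
  have key : ∀ σ ∈ 𝒮, ∀ x u k, ∃ a b : ℝ, ∀ (s : ℝ≥0) (ξ : ℝ),
      k ⬝ᵥ Y (σ + (2 * s : ℝ) • Matrix.vecMulVec u u) (x + ξ • u) = a + b * ξ ∧
      k ⬝ᵥ (S (σ + (2 * s : ℝ) • Matrix.vecMulVec u u) (x + ξ • u) *ᵥ k) / 2
        = k ⬝ᵥ (S (σ + (2 * (0 : ℝ≥0) : ℝ) • Matrix.vecMulVec u u) (x + (0 : ℝ) • u) *ᵥ k) / 2
          + s * b ^ 2 := by
    intro σ hσ x u k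
    have hmem : ∀ s : ℝ≥0, σ + (2 * s : ℝ) • Matrix.vecMulVec u u ∈ 𝒮 :=
      fun s => hadd' σ hσ _ (by positivity) u
    have hsum : ∀ s h : ℝ≥0, σ + (2 * (s + h : ℝ≥0) : ℝ) • Matrix.vecMulVec u u
        = σ + (2 * s : ℝ) • Matrix.vecMulVec u u + (2 * h : ℝ) • Matrix.vecMulVec u u := by
      intro s h
      rw [add_assoc, ← add_smul]
      push_cast
      ring_nf
    refine rigidity_of_heat_flow
      (l := fun s ξ => k ⬝ᵥ Y (σ + (2 * s : ℝ) • Matrix.vecMulVec u u) (x + ξ • u))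
      (q := fun s ξ => k ⬝ᵥ (S (σ + (2 * s : ℝ) • Matrix.vecMulVec u u) (x + ξ • u) *ᵥ k) / 2)
      ?_ ?_ ?_ ?_
    · intro s ξ
      have := hnn _ (hmem s) (x + ξ • u) k
      positivity
    · intro s h ξ t
      simp only [← gaussFactor_smul]
      rw [hmix _ (hmem s), hsum]
    · intro s t
      simp only [← gaussFactor_smul]
      exact hcont _ (hmem s) _ _ _
    · intro s ξ t
      simp only [← gaussFactor_smul]
      have := hlim _ (hmem s) (x + ξ • u) u (t • k)
      simp only [hsum]
      push_cast
      exact this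
  -- `Y` is affine along lines and does not depend on `σ`, and `S` does not depend on `x`
  have hY1 : ∀ σ ∈ 𝒮, ∀ x u, ∀ ξ : ℝ,
      Y σ (x + ξ • u) = Y σ x + ξ • (Y σ (x + u) - Y σ x) := by
    intro σ hσ x u ξ
    refine dotProduct_eq _ _ fun k => ?_
    obtain ⟨a, b, hab⟩ := key σ hσ x u k
    have h0 := (hab 0 0).1
    have h1 := (hab 0 1).1
    have h2 := (hab 0 ξ).1
    simp only [NNReal.coe_zero, mul_zero, zero_smul, add_zero, one_smul, mul_one] at h0 h1 h2
    simp only [dotProduct_comm _ k, dotProduct_add, dotProduct_smul, dotProduct_sub, h0, h1, h2,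
      smul_eq_mul]
    ring
  have hY2 : ∀ σ ∈ 𝒮, ∀ u x, Y (σ + Matrix.vecMulVec u u) x = Y σ x := by
    intro σ hσ u x
    refine dotProduct_eq _ _ fun k => ?_
    obtain ⟨a, b, hab⟩ := key σ hσ x u k
    have h0 := (hab 0 0).1
    have h1 := (hab (1 / 2) 0).1
    simp only [NNReal.coe_zero, mul_zero, zero_smul, add_zero] at h0 h1
    rw [show (2 * ((1 / 2 : ℝ≥0) : ℝ)) = 1 by norm_num, one_smul] at h1
    rw [dotProduct_comm, dotProduct_comm _ k, h0, h1]
  have hS1 : ∀ σ ∈ 𝒮, ∀ x u, S σ (x + u) = S σ x := by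
    intro σ hσ x u
    refine IsSymm.eq_of_forall_dotProduct_mulVec (hsymm σ hσ _) (hsymm σ hσ _) fun k => ?_
    obtain ⟨a, b, hab⟩ := key σ hσ x u k
    have h1 := (hab 0 1).2
    simp only [NNReal.coe_zero, mul_zero, zero_smul, add_zero, one_smul, zero_mul] at h1
    linarith
  have hS2 : ∀ σ ∈ 𝒮, ∀ x u k, k ⬝ᵥ (S (σ + Matrix.vecMulVec u u) x *ᵥ k)
      = k ⬝ᵥ (S σ x *ᵥ k) + (k ⬝ᵥ (Y σ (x + u) - Y σ x)) ^ 2 := by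
    intro σ hσ x u k
    obtain ⟨a, b, hab⟩ := key σ hσ x u k
    have h0 := (hab 0 0).1
    have h1 := (hab 0 1).1
    have h2 := (hab (1 / 2) 0).2
    rw [show (2 * ((1 / 2 : ℝ≥0) : ℝ)) = 1 by norm_num] at h2
    simp only [NNReal.coe_zero, mul_zero, zero_smul, add_zero, one_smul, mul_one] at h0 h1 h2
    rw [dotProduct_sub, h0, h1]
    push_cast at h2
    linear_combination 2 * h2
  obtain ⟨σ₀, hσ₀⟩ := hne
  set f : (ι → ℝ) → ι → ℝ := fun x => Y σ₀ x - Y σ₀ 0 with hf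
  have fsmul : ∀ (c : ℝ) x, f (c • x) = c • f x := by
    intro c x
    have := hY1 σ₀ hσ₀ 0 x c
    rw [zero_add, zero_add] at this
    simp only [hf, this, add_sub_cancel_left]
  have fadd : ∀ x w, f (x + w) = f x + f w := by
    intro x w
    have h1 := hY1 σ₀ hσ₀ x (w - x) (1 / 2)
    have e1 : x + (1 / 2 : ℝ) • (w - x) = (1 / 2 : ℝ) • (x + w) := by
      ext i; simp; ring
    rw [add_sub_cancel, e1] at h1
    have h2 := fsmul (1 / 2) (x + w)
    ext i
    have h1' := congrFun h1 i
    have h2' := congrFun h2 i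
    simp only [hf, Pi.add_apply, Pi.sub_apply, Pi.smul_apply, smul_eq_mul] at h1' h2' ⊢
    linarith
  set K : Matrix ι ι ℝ := LinearMap.toMatrix' ⟨⟨f, fadd⟩, fsmul⟩ with hK
  have hKf : ∀ x, K *ᵥ x = f x := by
    intro x
    rw [hK, LinearMap.toMatrix'_mulVec]
    rfl
  have hYadd : ∀ σ ∈ 𝒮, ∀ τ : Matrix ι ι ℝ, τ.PosSemidef →
      σ + τ ∈ 𝒮 ∧ ∀ x, Y (σ + τ) x = Y σ x := by
    intro σ hσ τ hτ
    refine PosSemidef.add_induction (p := fun ρ => ρ ∈ 𝒮 ∧ ∀ x, Y ρ x = Y σ x) ?_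
      ⟨hσ, fun _ => rfl⟩ hτ
    exact fun ρ u h => ⟨hadd ρ h.1 u, fun x => by rw [hY2 ρ h.1, h.2]⟩
  -- any two elements of `𝒮` are compared through their sum
  have hYσ : ∀ σ ∈ 𝒮, ∀ x, Y σ x = K *ᵥ x + Y σ₀ 0 := by
    intro σ hσ x
    rw [hKf, hf, ← (hYadd σ hσ σ₀ (hpsd _ hσ₀)).2, add_comm σ,
      (hYadd σ₀ hσ₀ σ (hpsd _ hσ)).2]
    simp
  have hS0 : ∀ σ ∈ 𝒮, ∀ x, S σ x = S σ 0 := fun σ hσ x => by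
    simpa using hS1 σ hσ 0 x
  have hSstep : ∀ σ ∈ 𝒮, ∀ u, S (σ + Matrix.vecMulVec u u) 0
      = S σ 0 + K * Matrix.vecMulVec u u * Kᵀ := by
    intro σ hσ u
    have hsy : (K * Matrix.vecMulVec u u * Kᵀ).IsSymm := by
      rw [Matrix.IsSymm, Matrix.transpose_mul, Matrix.transpose_mul, Matrix.transpose_transpose,
        Matrix.transpose_vecMulVec, Matrix.mul_assoc]
    refine IsSymm.eq_of_forall_dotProduct_mulVec (hsymm _ (hadd σ hσ u) _)
      ((hsymm σ hσ 0).add hsy) fun k => ?_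
    rw [hS2 σ hσ, Matrix.add_mulVec, dotProduct_add, dotProduct_conj_mulVec,
      dotProduct_vecMulVec_mulVec, hYσ σ hσ, hYσ σ hσ]
    simp only [zero_add, Matrix.mulVec_zero, add_sub_cancel_right]
    rw [Matrix.dotProduct_mulVec k K u, dotProduct_comm u]
    ring
  have hSadd : ∀ σ ∈ 𝒮, ∀ τ : Matrix ι ι ℝ, τ.PosSemidef →
      S (σ + τ) 0 = S σ 0 + K * τ * Kᵀ := by
    intro σ hσ τ hτ
    have := PosSemidef.add_induction
      (p := fun ρ => ρ ∈ 𝒮 ∧ S ρ 0 = S σ 0 + K * (ρ - σ) * Kᵀ) ?_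
      (σ := σ) ⟨hσ, by simp⟩ hτ
    · simpa using this.2
    · intro ρ u h
      refine ⟨hadd ρ h.1 u, ?_⟩
      rw [hSstep ρ h.1, h.2, add_sub_right_comm, mul_add, add_mul, add_assoc]
  refine ⟨K, S σ₀ 0 - K * σ₀ * Kᵀ, Y σ₀ 0, ?_, fun σ hσ x => ⟨?_, hYσ σ hσ x⟩⟩
  · refine (hsymm σ₀ hσ₀ 0).sub ?_
    have h1 : σ₀ᵀ = σ₀ := (hpsd _ hσ₀).isHermitian
    rw [Matrix.IsSymm, Matrix.transpose_mul, Matrix.transpose_mul, Matrix.transpose_transpose,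
      h1, Matrix.mul_assoc]
  · have h1 := hSadd σ hσ σ₀ (hpsd _ hσ₀)
    have h2 := hSadd σ₀ hσ₀ σ (hpsd _ hσ)
    rw [add_comm σ, h2] at h1
    rw [hS0 σ hσ]
    rw [← sub_eq_iff_eq_add] at h1
    rw [← h1]
    abel

/-! ### Plancherel's theorem for integrable square-integrable functions -/

section Plancherel
open FourierTransform SchwartzMap

variable {E : Type*} [NormedAddCommGroup E] [InnerProductSpace ℝ E] [FiniteDimensional ℝ E]
  [MeasurableSpace E] [BorelSpace E]

/-- The Fourier integral of a function in `L¹ ∩ L²` represents its `L²` Fourier transform. -/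
lemma coeFn_fourier_toLp_ae_eq {h : E → ℂ} (h1 : Integrable h) (h2 : MemLp h 2) :
    (𝓕 (h2.toLp h) : Lp (α := E) ℂ 2) =ᵐ[volume] 𝓕 h := by
  have hc : Continuous (𝓕 h) :=
    VectorFourier.fourierIntegral_continuous Real.continuous_fourierChar
      (L := innerₗ E) continuous_inner h1
  refine ae_eq_of_integral_contDiff_smul_eq
    ((Lp.memLp (𝓕 (h2.toLp h) : Lp ℂ 2 (volume : Measure E))).locallyIntegrable (by norm_num))
    hc.locallyIntegrable fun g hg hgc => ?_
  have hg1 : HasCompactSupport (Complex.ofRealCLM ∘ g) := hgc.comp_left rfl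
  have hg2 : ContDiff ℝ ((⊤ : ℕ∞) : WithTop ℕ∞) (Complex.ofRealCLM ∘ g) :=
    Complex.ofRealCLM.contDiff.comp hg
  set φ : 𝓢(E, ℂ) := hg1.toSchwartzMap hg2 with hφ
  have hφg : ∀ x, φ x = g x := fun x => rfl
  have e1 := congrArg (fun T => T φ) (Lp.fourier_toTemperedDistribution_eq (h2.toLp h))
  simp only [TemperedDistribution.fourier_apply, Lp.toTemperedDistribution_apply] at e1
  have e2 : ∫ x, (𝓕 φ) x • (h2.toLp h) x = ∫ x, (𝓕 φ) x • h x := by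
    refine integral_congr_ae ?_
    filter_upwards [h2.coeFn_toLp] with x hx
    rw [hx]
  have e3 : ∫ x, (𝓕 φ) x • h x = ∫ x, φ x • (𝓕 h) x := by
    have := VectorFourier.integral_fourierIntegral_smul_eq_flip (L := innerₗ E)
      (μ := volume) (ν := volume) Real.continuous_fourierChar continuous_inner φ.integrable h1
    rw [flip_innerₗ] at this
    exact this
  have hs : ∀ (x : E) (z : ℂ), g x • z = φ x • z := by
    intro x z
    rw [hφg, Complex.coe_smul]
  simp only [hs]
  rw [← e1, e2, e3]

theorem eLpNorm_fourier_eq {h : E → ℂ} (h1 : Integrable h) (h2 : MemLp h 2) :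
    eLpNorm (𝓕 h) 2 volume = eLpNorm h 2 volume := by
  rw [← eLpNorm_congr_ae (coeFn_fourier_toLp_ae_eq h1 h2), ← Lp.enorm_def,
    ← eLpNorm_congr_ae h2.coeFn_toLp, ← Lp.enorm_def, ← ofReal_norm, ← ofReal_norm,
    Lp.norm_fourier_eq]

lemma ae_eq_zero_of_fourier_eq_zero {h : E → ℂ} (h1 : Integrable h) (h2 : MemLp h 2)
    (h0 : ∀ w, 𝓕 h w = 0) : h =ᵐ[volume] 0 := by
  have e := eLpNorm_fourier_eq h1 h2
  have : 𝓕 h = 0 := funext h0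
  rw [this, eLpNorm_zero] at e
  exact (eLpNorm_eq_zero_iff h2.1 two_ne_zero).1 e.symm

end Plancherel

/-! ### The Weyl operators -/

section Weyl
variable {n : ℕ}

lemma weyl_coeFn (k : Quad n → ℝ) (ψ : Modes n) :
    weyl k ψ =ᵐ[volume] fun x => phase k x * ψ (x + shift k) :=
  MemLp.coeFn_toLp (memLp_weyl k ψ)

lemma norm_weyl_apply (k : Quad n → ℝ) (ψ : Modes n) : ‖weyl k ψ‖ = ‖ψ‖ := by
  have h : eLpNorm (fun x => phase k x * ψ (x + shift k)) 2 volume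
      = eLpNorm (fun x => ψ (x + shift k)) 2 volume :=
    eLpNorm_congr_norm_ae (Eventually.of_forall fun x => by simp [norm_phase])
  have h2 : eLpNorm (fun x => ψ (x + shift k)) 2 volume = eLpNorm ψ 2 volume :=
    eLpNorm_comp_measurePreserving (Lp.aestronglyMeasurable ψ)
      (measurePreserving_add_right volume (shift k))
  rw [Lp.norm_def, eLpNorm_congr_ae (weyl_coeFn k ψ), h, h2, ← Lp.norm_def]

/-- The exponent `(a' · b - a · b') / 2` of the Weyl cocycle. -/
def cocycle (k h : Quad n → ℝ) : ℝ := (∑ j, (h (j, 0) * k (j, 1) - k (j, 0) * h (j, 1))) / 2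

lemma weyl_weyl (k h : Quad n → ℝ) (ψ : Modes n) :
    weyl k (weyl h ψ) = Complex.exp (cocycle k h * Complex.I) • weyl (k + h) ψ := by
  refine Lp.ext ?_
  filter_upwards [weyl_coeFn k (weyl h ψ), ae_shift k (weyl_coeFn h ψ), weyl_coeFn (k + h) ψ,
    Lp.coeFn_smul (Complex.exp (cocycle k h * Complex.I)) (weyl (k + h) ψ)] with x h1 h2 h3 h4
  have hs : shift (k + h) = shift k + shift h := rfl
  rw [h1, h2, h4, Pi.smul_apply, h3, hs, add_assoc, smul_eq_mul, ← mul_assoc, ← mul_assoc]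
  congr 1
  simp only [phase]
  rw [← Complex.exp_add, ← Complex.exp_add, ← add_mul, ← add_mul, ← Complex.ofReal_add,
    ← Complex.ofReal_add]
  congr 3
  simp only [cocycle, ← Finset.sum_add_distrib, Finset.sum_div, shift, PiLp.add_apply,
    Pi.add_apply]
  exact Finset.sum_congr rfl fun j _ => by ring

lemma weyl_zero (ψ : Modes n) : weyl 0 ψ = ψ := by
  refine Lp.ext ?_
  filter_upwards [weyl_coeFn 0 ψ] with x hx
  have : shift (0 : Quad n → ℝ) = 0 := rfl
  rw [hx, this]
  simp [phase]

lemma weyl_neg_weyl (k : Quad n → ℝ) (ψ : Modes n) : weyl (-k) (weyl k ψ) = ψ := by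
  rw [weyl_weyl, neg_add_cancel, weyl_zero]
  have : cocycle (-k) k = 0 := by
    simp only [cocycle, Pi.neg_apply]
    rw [div_eq_zero_iff]; left
    exact Finset.sum_eq_zero fun j _ => by ring
  simp [this]

lemma inner_weyl_left (k : Quad n → ℝ) (φ ψ : Modes n) :
    inner ℂ (weyl k φ) ψ = inner ℂ φ (weyl (-k) ψ) := by
  have h := (LinearMap.norm_map_iff_inner_map_map (𝕜 := ℂ) (weyl (-k) : Op n)).1
    (norm_weyl_apply (-k)) (weyl k φ) ψ
  rw [weyl_neg_weyl] at h
  exact h.symm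

lemma continuous_weyl_translation (ψ : Modes n) :
    Continuous fun k : Quad n → ℝ => weyl (fun p => if p.2 = 0 then 0 else k p) ψ := by
  have : Fact ((2 : ℝ≥0∞) ≠ ∞) := ⟨ENNReal.ofNat_ne_top⟩
  have hc : Continuous fun b : EuclideanSpace ℝ (Fin n) => (DomAddAct.mk b) +ᵥ ψ :=
    (DomAddAct.mkHomeomorph.continuous).vadd continuous_const
  have hs : Continuous fun k : Quad n → ℝ => shift k := by
    unfold shift
    exact (PiLp.continuous_toLp 2 _).comp (by fun_prop)
  refine (hc.comp hs).congr fun k => ?_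
  refine Lp.ext ?_
  filter_upwards [weyl_coeFn (fun p => if p.2 = 0 then 0 else k p) ψ,
    DomAddAct.vadd_Lp_ae_eq (DomAddAct.mk (shift k)) ψ] with x h1 h2
  rw [h1, Function.comp_apply, h2]
  have : shift (fun p : Quad n => if p.2 = 0 then 0 else k p) = shift k := by
    simp [shift]
  simp [this, phase, add_comm]

lemma continuous_phase_left (x : EuclideanSpace ℝ (Fin n)) :
    Continuous fun k : Quad n → ℝ => phase k x := by
  unfold phase
  fun_prop

lemma continuous_weyl_multiplication (ψ : Modes n) :
    Continuous fun k : Quad n → ℝ => weyl (fun p => if p.2 = 0 then k p else 0) ψ := by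
  have hw : ∀ k : Quad n → ℝ, weyl (fun p => if p.2 = 0 then k p else 0) ψ =ᵐ[volume]
      fun x => phase (fun p => if p.2 = 0 then k p else 0) x * ψ x := by
    intro k
    filter_upwards [weyl_coeFn (fun p => if p.2 = 0 then k p else 0) ψ] with x h1
    have : shift (fun p : Quad n => if p.2 = 0 then k p else 0) = 0 := by
      ext j; simp [shift]
    rw [h1, this, add_zero]
  refine continuous_iff_continuousAt.2 fun k₀ => ?_
  rw [ContinuousAt, tendsto_iff_edist_tendsto_0]
  have hsq : Tendsto (fun k : Quad n → ℝ => ∫⁻ x,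
      ‖phase (fun p => if p.2 = 0 then k p else 0) x * ψ x
        - phase (fun p => if p.2 = 0 then k₀ p else 0) x * ψ x‖ₑ ^ (2 : ℝ)) (𝓝 k₀) (𝓝 0) := by
    have h0 : (0 : ℝ≥0∞) = ∫⁻ _ : EuclideanSpace ℝ (Fin n), 0 := by simp
    rw [h0]
    have hψ := (Lp.stronglyMeasurable ψ).measurable
    refine tendsto_lintegral_filter_of_dominated_convergence
      (fun x => (2 * ‖ψ x‖ₑ) ^ (2 : ℝ)) (Eventually.of_forall fun k => ?_)
      (Eventually.of_forall fun k => Eventually.of_forall fun x => ?_) ?_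
      (Eventually.of_forall fun x => ?_)
    · have h1 := (continuous_phase (fun p : Quad n => if p.2 = 0 then k p else 0)).measurable
      have h2 := (continuous_phase (fun p : Quad n => if p.2 = 0 then k₀ p else 0)).measurable
      exact (((h1.mul hψ).sub (h2.mul hψ)).enorm).pow_const _
    · refine ENNReal.rpow_le_rpow ?_ (by norm_num)
      rw [two_mul]
      refine enorm_sub_le.trans_eq ?_
      simp [← ofReal_norm, norm_phase]
    · have h := (Lp.memLp ψ).2
      rw [eLpNorm_lt_top_iff_lintegral_rpow_enorm_lt_top two_ne_zero ENNReal.ofNat_ne_top] at h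
      simp only [ENNReal.toReal_ofNat] at h
      simp only [ENNReal.mul_rpow_of_nonneg _ _ (show (0 : ℝ) ≤ 2 by norm_num)]
      have h4 : (2 : ℝ≥0∞) ^ (2 : ℝ) ≠ ∞ :=
        ENNReal.rpow_ne_top_of_nonneg (by norm_num) ENNReal.ofNat_ne_top
      rw [lintegral_const_mul' _ _ h4]
      exact ENNReal.mul_ne_top h4 h.ne
    · have hc : Continuous fun k : Quad n → ℝ =>
          ‖phase (fun p => if p.2 = 0 then k p else 0) x * ψ x
          - phase (fun p => if p.2 = 0 then k₀ p else 0) x * ψ x‖ₑ ^ (2 : ℝ) := by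
        have h1 : Continuous fun k : Quad n → ℝ =>
            phase (fun p => if p.2 = 0 then k p else 0) x := by
          have hA : Continuous fun k : Quad n → ℝ =>
              (fun p : Quad n => if p.2 = 0 then k p else 0) :=
            continuous_pi fun p => by split_ifs <;> fun_prop
          exact (continuous_phase_left x).comp hA
        exact (ENNReal.continuous_rpow_const (y := 2)).comp
          ((h1.mul (continuous_const (y := ψ x))).sub (continuous_const
            (y := phase (fun p => if p.2 = 0 then k₀ p else 0) x * ψ x))).enorm
      have h2 := hc.tendsto k₀
      rwa [sub_self, enorm_zero, ENNReal.zero_rpow_of_pos two_pos] at h2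
  have h3 := (ENNReal.continuous_rpow_const (y := 1 / 2)).tendsto 0 |>.comp hsq
  rw [ENNReal.zero_rpow_of_pos (by norm_num)] at h3
  refine h3.congr fun k => ?_
  rw [Function.comp_apply, Lp.edist_def, eLpNorm_eq_lintegral_rpow_enorm_toReal two_ne_zero
    ENNReal.ofNat_ne_top, ENNReal.toReal_ofNat]
  congr 1
  refine lintegral_congr_ae ?_
  filter_upwards [hw k, hw k₀] with x h1 h2
  rw [Pi.sub_apply, h1, h2]

/-- The Weyl operators are strongly continuous. -/
lemma continuous_weyl_apply (ψ : Modes n) : Continuous fun k : Quad n → ℝ => weyl k ψ := by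
  set A : (Quad n → ℝ) → Quad n → ℝ := fun k p => if p.2 = 0 then k p else 0
  set B : (Quad n → ℝ) → Quad n → ℝ := fun k p => if p.2 = 0 then 0 else k p
  have hAB : ∀ k, A k + B k = k := by
    intro k; ext p; simp only [A, B, Pi.add_apply]; split_ifs <;> simp
  have h1 : ∀ k, weyl k ψ = Complex.exp (-(cocycle (A k) (B k) * Complex.I)) •
      weyl (A k) (weyl (B k) ψ) := by
    intro k
    rw [weyl_weyl, smul_smul, ← Complex.exp_add, hAB]
    simp
  rw [show (fun k => weyl k ψ) = _ from funext h1]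
  have hc : Continuous fun k => weyl (A k) (weyl (B k) ψ) := by
    refine continuous_iff_continuousAt.2 fun k₀ => ?_
    have t1 : Tendsto (fun k => weyl (B k) ψ) (𝓝 k₀) (𝓝 (weyl (B k₀) ψ)) :=
      (continuous_weyl_translation ψ).tendsto k₀
    have t2 := (continuous_weyl_multiplication (weyl (B k₀) ψ)).tendsto k₀
    have t3 : Tendsto (fun k => weyl (A k) (weyl (B k) ψ - weyl (B k₀) ψ)) (𝓝 k₀) (𝓝 0) := by
      rw [tendsto_zero_iff_norm_tendsto_zero]
      simp only [norm_weyl_apply]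
      have := (t1.sub_const (weyl (B k₀) ψ)).norm
      rwa [sub_self, norm_zero] at this
    have t4 := t3.add t2
    rw [zero_add] at t4
    refine t4.congr fun k => ?_
    rw [map_sub, sub_add_cancel]
  have h2 : Continuous fun k => cocycle (A k) (B k) := by
    simp only [cocycle, A, B, one_ne_zero, if_true, if_false]
    fun_prop
  have h3 : Continuous fun k => Complex.exp (-(cocycle (A k) (B k) * Complex.I)) := by
    fun_prop
  exact h3.smul hc

end Weyl

/-! ### The Moyal identity -/

section Moyal
variable {n : ℕ}

/-- The `Q`-components of `k`, as a vector. -/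
def freq (k : Quad n → ℝ) : EuclideanSpace ℝ (Fin n) := WithLp.toLp 2 fun j => k (j, 0)

/-- The quadrature indices, split into `Q`- and `P`-indices. -/
def quadEquivSum (n : ℕ) : Quad n ≃ Fin n ⊕ Fin n where
  toFun p := if p.2 = 0 then Sum.inl p.1 else Sum.inr p.1
  invFun := Sum.elim (fun j => (j, 0)) (fun j => (j, 1))
  left_inv := by
    rintro ⟨j, i⟩
    fin_cases i <;> simp
  right_inv := by rintro (j | j) <;> simp

lemma measurePreserving_freq_shift :
    MeasurePreserving (fun k : Quad n → ℝ => (freq k, shift k)) volume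
      ((volume : Measure (EuclideanSpace ℝ (Fin n))).prod volume) := by
  have h1 := volume_measurePreserving_piCongrLeft (fun _ : Fin n ⊕ Fin n => ℝ) (quadEquivSum n)
  have h2 := volume_measurePreserving_sumPiEquivProdPi (fun _ : Fin n ⊕ Fin n => ℝ)
  have h3 := (PiLp.volume_preserving_toLp (Fin n)).prod (PiLp.volume_preserving_toLp (Fin n))
  have h4 := h3.comp (h2.comp h1)
  convert h4 using 1
  funext k
  have hc : ∀ i, (MeasurableEquiv.piCongrLeft (fun _ : Fin n ⊕ Fin n => ℝ) (quadEquivSum n)) k i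
      = k ((quadEquivSum n).symm i) := by
    intro i
    rw [MeasurableEquiv.coe_piCongrLeft, Equiv.piCongrLeft_apply_eq_cast]
    simp
  refine Prod.ext ?_ ?_
  · ext j
    exact (hc (Sum.inl j)).symm
  · ext j
    exact (hc (Sum.inr j)).symm

lemma lintegral_comp_smul {E : Type*} [NormedAddCommGroup E] [NormedSpace ℝ E]
    [MeasurableSpace E] [BorelSpace E] [FiniteDimensional ℝ E] (μ : Measure E)
    [μ.IsAddHaarMeasure] {r : ℝ} (hr : r ≠ 0) {f : E → ℝ≥0∞} (hf : Measurable f) :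
    ∫⁻ x, f (r • x) ∂μ = ENNReal.ofReal |(r ^ Module.finrank ℝ E)⁻¹| * ∫⁻ x, f x ∂μ := by
  rw [← lintegral_map hf (by fun_prop), Measure.map_addHaar_smul _ hr, lintegral_smul_measure,
    smul_eq_mul]

open FourierTransform in
/-- For fixed shift, a matrix coefficient of the Weyl operators is the Fourier transform of
`φ̄ ψ(· + b)` in the frequency variable, up to a phase. -/
lemma enorm_inner_weyl (φ ψ : Modes n) (k : Quad n → ℝ) :
    ‖inner ℂ φ (weyl k ψ)‖ₑ =
      ‖𝓕 (fun x => starRingEnd ℂ (φ x) * ψ (x + shift k)) (-(2 * Real.pi)⁻¹ • freq k)‖ₑ := by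
  rw [L2.inner_def, Real.fourier_eq']
  have h1 : ∫ x, inner ℂ (φ x) (weyl k ψ x)
      = Complex.exp ((∑ j, k (j, 0) * k (j, 1) / 2 : ℝ) * Complex.I) *
        ∫ x, Complex.exp ((-2 * Real.pi * inner ℝ x (-(2 * Real.pi)⁻¹ • freq k) : ℝ) * Complex.I)
          • (starRingEnd ℂ (φ x) * ψ (x + shift k)) := by
    rw [← integral_const_mul]
    refine integral_congr_ae ?_
    filter_upwards [weyl_coeFn k ψ] with x hx
    rw [hx]
    have h2 : phase k x = Complex.exp ((∑ j, k (j, 0) * k (j, 1) / 2 : ℝ) * Complex.I) *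
        Complex.exp ((-2 * Real.pi * inner ℝ x (-(2 * Real.pi)⁻¹ • freq k) : ℝ) * Complex.I) := by
      rw [phase, ← Complex.exp_add, ← add_mul, ← Complex.ofReal_add]
      congr 3
      rw [Finset.sum_add_distrib, add_comm]
      congr 1
      have : inner ℝ x (-(2 * Real.pi)⁻¹ • freq k)
          = -(2 * Real.pi)⁻¹ * ∑ j, k (j, 0) * x j := by
        rw [inner_smul_right]
        simp [freq, PiLp.inner_apply]
      rw [this]
      field_simp [Real.pi_ne_zero]
    rw [h2]
    simp only [RCLike.inner_apply, smul_eq_mul]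
    ring
  rw [h1, enorm_mul, ← ofReal_norm (Complex.exp _), Complex.norm_exp_ofReal_mul_I,
    ENNReal.ofReal_one, one_mul]

/-- Moyal's identity for the matrix coefficients of the Weyl operators. For fixed shift the
coefficient is a Fourier transform in the frequency variable, so that the identity follows from
Plancherel's theorem. -/
theorem lintegral_enorm_inner_weyl_sq (φ ψ : Modes n) :
    ∫⁻ k : Quad n → ℝ, ‖inner ℂ φ (weyl k ψ)‖ₑ ^ 2
      = ENNReal.ofReal ((2 * Real.pi) ^ n) * (‖φ‖ₑ ^ 2 * ‖ψ‖ₑ ^ 2) := by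
  have hφ := Lp.stronglyMeasurable φ
  have hψ := Lp.stronglyMeasurable ψ
  set E := EuclideanSpace ℝ (Fin n)
  set h : E → E → ℂ := fun b x => starRingEnd ℂ (φ x) * ψ (x + b) with hdef
  have hmeas : StronglyMeasurable (Function.uncurry h) := by
    refine StronglyMeasurable.mul ?_ ?_
    · exact (Complex.continuous_conj.comp_stronglyMeasurable hφ).comp_measurable measurable_snd
    · exact hψ.comp_measurable (measurable_snd.add measurable_fst)
  have hsq : ∀ χ : Modes n, ∫⁻ x, ‖χ x‖ₑ ^ 2 = ‖χ‖ₑ ^ 2 := by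
    intro χ
    rw [Lp.enorm_def]
    have := eLpNorm_nnreal_pow_eq_lintegral (μ := volume) (f := χ) (p := 2) two_ne_zero
    simpa using this.symm
  have hint : ∫⁻ b, ∫⁻ x, ‖h b x‖ₑ ^ 2 = ‖φ‖ₑ ^ 2 * ‖ψ‖ₑ ^ 2 := by
    rw [lintegral_lintegral_swap (by
      exact (hmeas.measurable.enorm.pow_const 2).aemeasurable)]
    have : ∀ x, ∫⁻ b, ‖h b x‖ₑ ^ 2 = ‖φ x‖ₑ ^ 2 * ‖ψ‖ₑ ^ 2 := by
      intro x
      have e : ∀ b, ‖h b x‖ₑ ^ 2 = ‖φ x‖ₑ ^ 2 * ‖ψ (x + b)‖ₑ ^ 2 := by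
        intro b
        simp only [hdef]
        rw [enorm_mul, mul_pow, ← ofReal_norm, RCLike.norm_conj, ofReal_norm]
      simp only [e]
      rw [lintegral_const_mul _ (by
        exact ((hψ.measurable.comp (measurable_const_add x)).enorm.pow_const 2)),
        lintegral_add_left_eq_self (fun b => ‖ψ b‖ₑ ^ 2) x, hsq]
    simp only [this]
    rw [lintegral_mul_const _ (hφ.measurable.enorm.pow_const 2), hsq]
  obtain ⟨F, hF⟩ : ∃ F : E → E → ℂ, ∀ b w, F b w = FourierTransform.fourier (h b) w :=
    ⟨_, fun _ _ => rfl⟩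
  have hFs : StronglyMeasurable fun p : E × E => F p.2 p.1 := by
    have e : (fun p : E × E => F p.2 p.1) = fun p =>
        ∫ x, Complex.exp ((-2 * Real.pi * inner ℝ x p.1 : ℝ) * Complex.I) • h p.2 x :=
      funext fun p => (hF _ _).trans (Real.fourier_eq' _ _)
    rw [e]
    have hc : Continuous fun q : (E × E) × E =>
        Complex.exp ((-2 * Real.pi * inner ℝ q.2 q.1.1 : ℝ) * Complex.I) := by fun_prop
    exact StronglyMeasurable.integral_prod_right (f := fun (p : E × E) (x : E) =>
      Complex.exp ((-2 * Real.pi * inner ℝ x p.1 : ℝ) * Complex.I) • h p.2 x)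
      (hc.stronglyMeasurable.smul
        (hmeas.comp_measurable ((measurable_snd.comp measurable_fst).prodMk measurable_snd)))
  have hFmeas : Measurable fun p : E × E => ‖F p.2 p.1‖ₑ ^ 2 :=
    hFs.measurable.enorm.pow_const 2
  have hscal : Measurable fun p : E × E => ‖F p.2 (-(2 * Real.pi)⁻¹ • p.1)‖ₑ ^ 2 := by
    have h0 : Measurable fun p : E × E => (-(2 * Real.pi)⁻¹ • p.1, p.2) := by fun_prop
    exact (hFs.comp_measurable h0).measurable.enorm.pow_const 2
  have hr : -(2 * Real.pi)⁻¹ ≠ 0 := by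
    rw [neg_ne_zero]; exact inv_ne_zero (by positivity)
  calc ∫⁻ k : Quad n → ℝ, ‖inner ℂ φ (weyl k ψ)‖ₑ ^ 2
      = ∫⁻ k : Quad n → ℝ,
          ‖F (shift k) (-(2 * Real.pi)⁻¹ • freq k)‖ₑ ^ 2 :=
        lintegral_congr fun k => by rw [enorm_inner_weyl, hF]
    _ = ∫⁻ b, ∫⁻ a, ‖F b (-(2 * Real.pi)⁻¹ • a)‖ₑ ^ 2 := by
        rw [← lintegral_prod_symm' _ hscal]
        exact measurePreserving_freq_shift.lintegral_comp hscal
    _ = ∫⁻ b, ENNReal.ofReal ((2 * Real.pi) ^ n) * ∫⁻ x, ‖h b x‖ₑ ^ 2 := by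
        refine lintegral_congr_ae ?_
        have hfin : ∀ᵐ b, ∫⁻ x, ‖h b x‖ₑ ^ 2 < ∞ := by
          refine ae_lt_top ?_ ?_
          · exact Measurable.lintegral_prod_right' (f := fun p : E × E => ‖h p.1 p.2‖ₑ ^ 2)
              (hmeas.measurable.enorm.pow_const 2)
          · rw [hint]
            exact ENNReal.mul_ne_top (ENNReal.pow_ne_top enorm_ne_top)
              (ENNReal.pow_ne_top enorm_ne_top)
        filter_upwards [hfin] with b hb
        have hbm : AEStronglyMeasurable (h b) volume :=
          (hmeas.comp_measurable measurable_prodMk_left).aestronglyMeasurable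
        have hL := eLpNorm_nnreal_pow_eq_lintegral (μ := volume) (f := h b) (p := 2) two_ne_zero
        have hL2 := eLpNorm_nnreal_pow_eq_lintegral (μ := volume)
          (f := F b) (p := 2) two_ne_zero
        simp only [ENNReal.coe_ofNat, NNReal.coe_ofNat, ENNReal.rpow_ofNat] at hL hL2
        have h2 : MemLp (h b) 2 := by
          refine ⟨hbm, ?_⟩
          rw [← hL] at hb
          by_contra hcon
          rw [not_lt, top_le_iff] at hcon
          simp [hcon] at hb
        have h1 : Integrable (h b) := by
          have m1 : MemLp (fun x => starRingEnd ℂ (φ x)) 2 volume :=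
            (Lp.memLp φ).star
          have m2 : MemLp (fun x => ψ (x + b)) 2 volume :=
            (Lp.memLp ψ).comp_measurePreserving (measurePreserving_add_right volume b)
          exact m1.integrable_mul m2
        rw [lintegral_comp_smul volume hr
          (f := fun w => ‖F b w‖ₑ ^ 2)
          ((hFs.comp_measurable measurable_prodMk_right).measurable.enorm.pow_const 2), ← hL2,
          show F b = FourierTransform.fourier (h b) from funext (hF b),
            eLpNorm_fourier_eq h1 h2, hL]
        congr 2
        rw [abs_inv, abs_pow, abs_neg, abs_inv, abs_of_pos (by positivity : 0 < 2 * Real.pi),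
          inv_pow, inv_inv, finrank_euclideanSpace, Fintype.card_fin]
    _ = _ := by
        rw [lintegral_const_mul _ (Measurable.lintegral_prod_right'
          (f := fun p : E × E => ‖h p.1 p.2‖ₑ ^ 2) (hmeas.measurable.enorm.pow_const 2)), hint]

end Moyal

/-! ### Orthogonal series and adjoints of Hilbert–Schmidt operators -/

section Hilbert
variable {ι E : Type*} [NormedAddCommGroup E] [InnerProductSpace ℂ E]

lemma norm_sum_sq_of_orthogonal {f : ι → E} (hf : ∀ i j, i ≠ j → inner ℂ (f i) (f j) = 0)
    (s : Finset ι) : ‖∑ i ∈ s, f i‖ ^ 2 = ∑ i ∈ s, ‖f i‖ ^ 2 := by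
  have h : (inner ℂ (∑ i ∈ s, f i) (∑ i ∈ s, f i) : ℂ) = ∑ i ∈ s, ((‖f i‖ ^ 2 : ℝ) : ℂ) := by
    rw [sum_inner]
    refine Finset.sum_congr rfl fun i hi => ?_
    rw [inner_sum, Finset.sum_eq_single i (fun j _ hj => hf i j hj.symm) (fun h => absurd hi h),
      inner_self_eq_norm_sq_to_K]
    push_cast
    rfl
  rw [inner_self_eq_norm_sq_to_K, ← Complex.ofReal_sum] at h
  refine Complex.ofReal_injective ?_
  push_cast at h ⊢
  exact h

lemma summable_of_orthogonal [CompleteSpace E] {f : ι → E}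
    (hf : ∀ i j, i ≠ j → inner ℂ (f i) (f j) = 0) (hs : Summable fun i => ‖f i‖ ^ 2) :
    Summable f := by
  rw [summable_iff_vanishing_norm]
  intro ε hε
  obtain ⟨s, hs⟩ := summable_iff_vanishing_norm.1 hs (ε ^ 2) (by positivity)
  refine ⟨s, fun t ht => ?_⟩
  have h1 := hs t ht
  rw [Real.norm_of_nonneg (Finset.sum_nonneg fun _ _ => by positivity),
    ← norm_sum_sq_of_orthogonal hf] at h1
  exact lt_of_pow_lt_pow_left₀ 2 hε.le h1

lemma norm_tsum_sq_of_orthogonal {f : ι → E}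
    (hf : ∀ i j, i ≠ j → inner ℂ (f i) (f j) = 0) (hs : Summable f) :
    HasSum (fun i => ‖f i‖ ^ 2) (‖∑' i, f i‖ ^ 2) := by
  have h1 := (hs.hasSum.norm).pow 2
  simp only [norm_sum_sq_of_orthogonal hf] at h1
  exact h1

lemma tsum_enorm_inner_sq (b : HilbertBasis ι ℂ E) (x : E) :
    ∑' i, ‖inner ℂ (b i) x‖ₑ ^ 2 = ‖x‖ₑ ^ 2 := by
  have h := b.hasSum_inner_mul_inner x x
  have h1 : HasSum (fun i => ‖inner ℂ (b i) x‖ ^ 2) (‖x‖ ^ 2) := by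
    rw [inner_self_eq_norm_sq_to_K] at h
    have e : (fun i => inner ℂ x (b i) * inner ℂ (b i) x)
        = fun i => ((‖inner ℂ (b i) x‖ ^ 2 : ℝ) : ℂ) := by
      funext i
      rw [← inner_conj_symm x (b i), mul_comm, RCLike.mul_conj]
      push_cast
      rfl
    rw [e] at h
    refine Complex.hasSum_ofReal.1 ?_
    rw [Complex.ofReal_pow]
    exact h
  have h2 := ENNReal.ofReal_tsum_of_nonneg (fun i => by positivity) h1.summable
  rw [h1.tsum_eq] at h2
  rw [← ofReal_norm, ← ENNReal.ofReal_pow (norm_nonneg _), h2]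
  refine tsum_congr fun i => ?_
  rw [← ofReal_norm, ← ENNReal.ofReal_pow (norm_nonneg _)]

lemma tsum_enorm_adjoint_sq [CompleteSpace E] (b : HilbertBasis ι ℂ E) (T : E →L[ℂ] E) :
    ∑' i, ‖T.adjoint (b i)‖ₑ ^ 2 = ∑' i, ‖T (b i)‖ₑ ^ 2 := by
  have h1 : ∀ i, ‖T.adjoint (b i)‖ₑ ^ 2 = ∑' j, ‖inner ℂ (b j) (T.adjoint (b i))‖ₑ ^ 2 :=
    fun i => (tsum_enorm_inner_sq b _).symm
  have h2 : ∀ i, ‖T (b i)‖ₑ ^ 2 = ∑' j, ‖inner ℂ (b j) (T (b i))‖ₑ ^ 2 :=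
    fun i => (tsum_enorm_inner_sq b _).symm
  simp only [h1, h2]
  rw [ENNReal.tsum_comm]
  refine tsum_congr fun i => tsum_congr fun j => ?_
  rw [ContinuousLinearMap.adjoint_inner_right, ← inner_conj_symm, ← ofReal_norm,
    RCLike.norm_conj, ofReal_norm]

end Hilbert

lemma summable_norm_sq_iff {ι E : Type*} [NormedAddCommGroup E] (f : ι → E) :
    (Summable fun i => ‖f i‖ ^ 2) ↔ ∑' i, ‖f i‖ₑ ^ 2 ≠ ∞ := by
  have : ∀ i, ‖f i‖ₑ ^ 2 = ((‖f i‖₊ ^ 2 : ℝ≥0) : ℝ≥0∞) := fun i => by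
    simp [enorm_eq_nnnorm]
  simp only [this]
  rw [ENNReal.tsum_coe_ne_top_iff_summable, ← NNReal.summable_coe]
  simp

lemma tsum_norm_sq_eq_toReal {ι E : Type*} [NormedAddCommGroup E] (f : ι → E) :
    ∑' i, ‖f i‖ ^ 2 = (∑' i, ‖f i‖ₑ ^ 2).toReal := by
  rw [ENNReal.tsum_toReal_eq (fun i => ENNReal.pow_ne_top enorm_ne_top)]
  simp

/-! ### Characteristic functions of Hilbert–Schmidt operators -/

section CharFun
variable {n : ℕ}

/-- The square-integrable functions on phase space. -/
abbrev Phase (n : ℕ) : Type := Lp ℂ 2 (volume : Measure (Quad n → ℝ))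

lemma continuous_inner_weyl (φ ψ : Modes n) :
    Continuous fun k : Quad n → ℝ => inner ℂ φ (weyl k ψ) :=
  continuous_const.inner (continuous_weyl_apply ψ)

lemma eLpNorm_inner_weyl (φ ψ : Modes n) :
    eLpNorm (fun k : Quad n → ℝ => inner ℂ φ (weyl k ψ)) 2 volume ^ 2
      = ENNReal.ofReal ((2 * Real.pi) ^ n) * (‖φ‖ₑ ^ 2 * ‖ψ‖ₑ ^ 2) := by
  rw [← lintegral_enorm_inner_weyl_sq]
  have := eLpNorm_nnreal_pow_eq_lintegral (μ := volume) (p := 2) two_ne_zero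
    (f := fun k : Quad n → ℝ => inner ℂ φ (weyl k ψ))
  simpa using this

lemma memLp_inner_weyl (φ ψ : Modes n) :
    MemLp (fun k : Quad n → ℝ => inner ℂ φ (weyl k ψ)) 2 volume := by
  refine ⟨(continuous_inner_weyl φ ψ).aestronglyMeasurable, ?_⟩
  by_contra hcon
  rw [not_lt, top_le_iff] at hcon
  have h := eLpNorm_inner_weyl φ ψ
  rw [hcon] at h
  have h2 : ENNReal.ofReal ((2 * Real.pi) ^ n) * (‖φ‖ₑ ^ 2 * ‖ψ‖ₑ ^ 2) ≠ ∞ :=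
    ENNReal.mul_ne_top ENNReal.ofReal_ne_top
      (ENNReal.mul_ne_top (ENNReal.pow_ne_top enorm_ne_top) (ENNReal.pow_ne_top enorm_ne_top))
  rw [← h] at h2
  simp at h2

/-- The matrix coefficient `k ↦ ⟨φ, W(k) ψ⟩` as an element of `L²`. -/
def coeffLp (φ ψ : Modes n) : Phase n := (memLp_inner_weyl φ ψ).toLp

lemma coeffLp_coeFn (φ ψ : Modes n) :
    coeffLp φ ψ =ᵐ[volume] fun k => inner ℂ φ (weyl k ψ) :=
  (memLp_inner_weyl φ ψ).coeFn_toLp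

lemma norm_coeffLp_sq (φ ψ : Modes n) :
    ‖coeffLp φ ψ‖ ^ 2 = (2 * Real.pi) ^ n * (‖φ‖ ^ 2 * ‖ψ‖ ^ 2) := by
  have h := eLpNorm_inner_weyl φ ψ
  rw [coeffLp, Lp.norm_toLp, ← ENNReal.toReal_pow, h]
  simp [ENNReal.toReal_mul, Real.pi_nonneg]

lemma coeffLp_add_left (φ φ' ψ : Modes n) :
    coeffLp (φ + φ') ψ = coeffLp φ ψ + coeffLp φ' ψ := by
  rw [coeffLp, coeffLp, coeffLp, ← MemLp.toLp_add]
  congr 1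
  funext k
  simp [inner_add_left]

lemma coeffLp_smul_left (c : ℂ) (φ ψ : Modes n) :
    coeffLp (c • φ) ψ = starRingEnd ℂ c • coeffLp φ ψ := by
  rw [coeffLp, coeffLp, ← MemLp.toLp_const_smul]
  congr 1
  funext k
  simp [inner_smul_left]

lemma coeffLp_add_right (φ ψ ψ' : Modes n) :
    coeffLp φ (ψ + ψ') = coeffLp φ ψ + coeffLp φ ψ' := by
  rw [coeffLp, coeffLp, coeffLp, ← MemLp.toLp_add]
  congr 1
  funext k
  simp [inner_add_right]

lemma coeffLp_smul_right (c : ℂ) (φ ψ : Modes n) :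
    coeffLp φ (c • ψ) = c • coeffLp φ ψ := by
  rw [coeffLp, coeffLp, ← MemLp.toLp_const_smul]
  congr 1
  funext k
  simp [inner_smul_right]

/-- The orthogonality follows by polarization from the Moyal identity for the norms. -/
lemma inner_coeffLp_same_left {ψ ψ' : Modes n} (h : inner ℂ ψ ψ' = 0) (φ : Modes n) :
    inner ℂ (coeffLp φ ψ) (coeffLp φ ψ') = 0 := by
  have key : ∀ c : ℂ, RCLike.re (c * inner ℂ (coeffLp φ ψ) (coeffLp φ ψ')) = 0 := by
    intro c
    have h1 := norm_coeffLp_sq φ (ψ + c • ψ')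
    rw [coeffLp_add_right, coeffLp_smul_right, @norm_add_sq ℂ, @norm_add_sq ℂ, inner_smul_right,
      inner_smul_right, h, norm_smul, norm_smul, mul_pow ‖c‖ ‖coeffLp φ ψ'‖, norm_coeffLp_sq,
      norm_coeffLp_sq] at h1
    simp only [mul_zero, _root_.map_zero, add_zero] at h1
    rw [mul_pow ‖c‖] at h1
    linarith
  have h1 := key 1
  have h2 := key (-Complex.I)
  simp only [one_mul] at h1
  apply Complex.ext
  · simpa using h1
  · simpa using h2

/-- Matrix coefficients with orthogonal right vectors are orthogonal. -/
lemma inner_coeffLp_eq_zero {ψ ψ' : Modes n} (h : inner ℂ ψ ψ' = 0) (φ φ' : Modes n) :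
    inner ℂ (coeffLp φ ψ) (coeffLp φ' ψ') = 0 := by
  have key : ∀ c : ℂ, starRingEnd ℂ c * inner ℂ (coeffLp φ ψ) (coeffLp φ' ψ')
      + c * inner ℂ (coeffLp φ' ψ) (coeffLp φ ψ') = 0 := by
    intro c
    have h1 := inner_coeffLp_same_left h (φ + c • φ')
    rw [coeffLp_add_left, coeffLp_add_left, coeffLp_smul_left, coeffLp_smul_left,
      inner_add_left, inner_add_right, inner_add_right, inner_smul_left, inner_smul_left,
      inner_smul_right, inner_smul_right, inner_coeffLp_same_left h,
      inner_coeffLp_same_left h] at h1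
    simp only [mul_zero, add_zero, zero_add, RCLike.conj_conj] at h1
    linear_combination h1
  have h1 := key 1
  have h2 := key Complex.I
  simp only [map_one, one_mul, Complex.conj_I] at h1 h2
  have h3 : Complex.I * (2 * inner ℂ (coeffLp φ ψ) (coeffLp φ' ψ')) = 0 := by
    linear_combination Complex.I * h1 - h2
  simpa using h3

lemma diagEntry_comp_weyl (X : Op n) (k : Quad n → ℝ) (i : basisSet n) :
    diagEntry (X ∘L weyl k) i = inner ℂ (X.adjoint (onb n i)) (weyl k (onb n i)) := by
  rw [diagEntry, ContinuousLinearMap.adjoint_inner_left]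
  rfl

lemma inner_onb_of_ne {i j : basisSet n} (h : i ≠ j) : inner ℂ (onb n i) (onb n j) = 0 :=
  (onb n).orthonormal.2 h

lemma summable_adjoint_sq (X : HS n) :
    (Summable fun i => ‖(X : Op n).adjoint (onb n i)‖ ^ 2) ∧
    ∑' i, ‖(X : Op n).adjoint (onb n i)‖ ^ 2 = hsNorm X ^ 2 := by
  have h : Summable fun i => ‖(X : Op n) (onb n i)‖ ^ 2 := X.2
  constructor
  · rw [summable_norm_sq_iff, tsum_enorm_adjoint_sq, ← summable_norm_sq_iff]
    exact h
  · rw [hsNorm, Real.sq_sqrt (tsum_nonneg fun i => by positivity), tsum_norm_sq_eq_toReal,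
      tsum_enorm_adjoint_sq, ← tsum_norm_sq_eq_toReal]

/-- The trace series of the characteristic function converges in `L²`, since its terms are
orthogonal. -/
lemma summable_charFun (X : HS n) :
    Summable fun i => coeffLp ((X : Op n).adjoint (onb n i)) (onb n i) := by
  refine summable_of_orthogonal (fun i j hij => inner_coeffLp_eq_zero (inner_onb_of_ne hij) _ _) ?_
  simp only [norm_coeffLp_sq]
  simpa [(onb n).orthonormal.1] using (summable_adjoint_sq X).1.mul_left ((2 * Real.pi) ^ n)

/-- The characteristic function `X ↦ χ_X` as a linear map from the Hilbert–Schmidt operators to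
`L²` of the phase space. -/
def charLp (n : ℕ) : HS n →ₗ[ℂ] Phase n where
  toFun X := ∑' i, coeffLp ((X : Op n).adjoint (onb n i)) (onb n i)
  map_add' X Y := by
    rw [← (summable_charFun X).tsum_add (summable_charFun Y)]
    refine tsum_congr fun i => ?_
    rw [Submodule.coe_add, _root_.map_add, add_apply, coeffLp_add_left]
  map_smul' c X := by
    rw [RingHom.id_apply, ← (summable_charFun X).tsum_const_smul]
    refine tsum_congr fun i => ?_
    rw [Submodule.coe_smul, map_smulₛₗ, smul_apply, coeffLp_smul_left, Complex.conj_conj]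

/-- The noncommutative Plancherel identity `‖χ_X‖² = (2π)ⁿ ‖X‖²`. -/
lemma norm_charLp_sq (X : HS n) : ‖charLp n X‖ ^ 2 = (2 * Real.pi) ^ n * hsNorm X ^ 2 := by
  have h := norm_tsum_sq_of_orthogonal
    (f := fun i => coeffLp ((X : Op n).adjoint (onb n i)) (onb n i))
    (fun i j hij => inner_coeffLp_eq_zero (inner_onb_of_ne hij) _ _) (summable_charFun X)
  have h2 := h.tsum_eq
  simp only [norm_coeffLp_sq] at h2
  rw [tsum_mul_left] at h2
  simp only [(onb n).orthonormal.1, one_pow, mul_one, (summable_adjoint_sq X).2] at h2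
  exact h2.symm

lemma hsNorm_nonneg (X : HS n) : 0 ≤ hsNorm X := Real.sqrt_nonneg _

lemma norm_charLp (X : HS n) : ‖charLp n X‖ = √((2 * Real.pi) ^ n) * hsNorm X := by
  have h := norm_charLp_sq X
  rw [← Real.sqrt_sq (norm_nonneg (charLp n X)), h, Real.sqrt_mul (by positivity),
    Real.sqrt_sq (hsNorm_nonneg X)]

lemma toLp_sum_diagEntry (X : HS n) (s : Finset (basisSet n)) :
    (∑ i ∈ s, coeffLp ((X : Op n).adjoint (onb n i)) (onb n i) : Phase n)
      =ᵐ[volume] fun k => ∑ i ∈ s, diagEntry ((X : Op n) ∘L weyl k) i := by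
  have h : ∀ᵐ k : Quad n → ℝ, ∀ i ∈ s, coeffLp ((X : Op n).adjoint (onb n i)) (onb n i) k
      = inner ℂ ((X : Op n).adjoint (onb n i)) (weyl k (onb n i)) :=
    (eventually_all_finset s).2 fun i _ => coeffLp_coeFn _ _
  filter_upwards [h, Lp.coeFn_finsetSum s
    (fun i => coeffLp ((X : Op n).adjoint (onb n i)) (onb n i))] with k hk h2
  rw [h2, Finset.sum_apply]
  exact Finset.sum_congr rfl fun i hi => by rw [hk i hi, diagEntry_comp_weyl]

/-- The representatives of `charLp n X` are the characteristic functions of `X`. -/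
lemma hasCharFun_iff (X : HS n) (f : (Quad n → ℝ) → ℂ) :
    HasCharFun X f ↔ f =ᵐ[volume] charLp n X := by
  have hsum : Tendsto (fun s : Finset (basisSet n) =>
      ∑ i ∈ s, coeffLp ((X : Op n).adjoint (onb n i)) (onb n i)) atTop (𝓝 (charLp n X)) :=
    (summable_charFun X).hasSum
  have hiff : ∀ g : Phase n, (fun s : Finset (basisSet n) =>
      eLpNorm (fun k => (∑ i ∈ s, diagEntry ((X : Op n) ∘L weyl k) i) - g k) 2 volume)
      = fun s => eLpNorm (⇑(∑ i ∈ s, coeffLp ((X : Op n).adjoint (onb n i)) (onb n i)) - ⇑g)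
        2 volume := by
    intro g
    funext s
    refine eLpNorm_congr_ae ?_
    filter_upwards [toLp_sum_diagEntry X s] with k hk
    rw [Pi.sub_apply, hk]
  constructor
  · rintro ⟨hf, ht⟩
    have h1 : Tendsto (fun s : Finset (basisSet n) =>
        ∑ i ∈ s, coeffLp ((X : Op n).adjoint (onb n i)) (onb n i)) atTop (𝓝 hf.toLp) := by
      rw [Lp.tendsto_Lp_iff_tendsto_eLpNorm', ← hiff]
      refine ht.congr fun s => eLpNorm_congr_ae ?_
      filter_upwards [hf.coeFn_toLp] with k hk
      rw [hk]
    rw [tendsto_nhds_unique hsum h1]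
    exact hf.coeFn_toLp.symm
  · intro h
    refine ⟨(memLp_congr_ae h).2 (Lp.memLp _), ?_⟩
    rw [Lp.tendsto_Lp_iff_tendsto_eLpNorm', ← hiff] at hsum
    refine hsum.congr fun s => eLpNorm_congr_ae ?_
    filter_upwards [h] with k hk
    rw [hk]

end CharFun

/-! ### Density operators and their characteristic functions -/

section Density
variable {n : ℕ}

instance countable_basisSet (n : ℕ) : Countable (basisSet n) := by
  have : Fact ((2 : ℝ≥0∞) ≠ ∞) := ⟨ENNReal.ofNat_ne_top⟩
  have : TopologicalSpace.SeparableSpace (Modes n) := inferInstance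
  have hd : (Set.univ : Set (basisSet n)).PairwiseDisjoint
      fun i => Metric.ball (onb n i) (1 / 2) := by
    intro i _ j _ hij
    refine Metric.ball_disjoint_ball ?_
    have h1 : ‖onb n i - onb n j‖ ^ 2 = 2 := by
      rw [@norm_sub_sq ℂ, inner_onb_of_ne hij, (onb n).orthonormal.1, (onb n).orthonormal.1]
      simp
      norm_num
    rw [dist_eq_norm]
    nlinarith [norm_nonneg (onb n i - onb n j)]
  have h2 := hd.countable_of_isOpen (fun i _ => Metric.isOpen_ball)
    (fun i _ => ⟨onb n i, Metric.mem_ball_self (by norm_num)⟩)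
  exact Set.countable_univ_iff.1 h2

lemma exists_adjoint_eq_mul_self_eq {E : Type*} [NormedAddCommGroup E] [InnerProductSpace ℂ E]
    [CompleteSpace E] {ρ : E →L[ℂ] E} (hρ : ρ.IsPositive) :
    ∃ S : E →L[ℂ] E, S.adjoint = S ∧ S * S = ρ :=
  ⟨CFC.sqrt ρ, IsSelfAdjoint.of_nonneg (CFC.sqrt_nonneg ρ),
    CFC.sqrt_mul_sqrt_self ρ ((ContinuousLinearMap.nonneg_iff_isPositive ρ).2 hρ)⟩

/-- A density operator is the square of a self-adjoint operator of Hilbert–Schmidt norm one. -/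
lemma IsDensity.exists_sqrt {ρ : Op n} (hρ : IsDensity ρ) :
    ∃ S : Op n, S.adjoint = S ∧ S * S = ρ ∧ HasSum (fun i => ‖S (onb n i)‖ ^ 2) 1 := by
  obtain ⟨S, hsa, hsq⟩ := exists_adjoint_eq_mul_self_eq hρ.1
  refine ⟨S, hsa, hsq, ?_⟩
  rw [← Complex.hasSum_ofReal]
  have h1 := hρ.2
  have e : diagEntry ρ = fun i => ((‖S (onb n i)‖ ^ 2 : ℝ) : ℂ) := by
    funext i
    rw [diagEntry, ← hsq, mul_apply_eq_comp, ← ContinuousLinearMap.adjoint_inner_left, hsa,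
      inner_self_eq_norm_sq_to_K]
    push_cast
    rfl
  rw [e] at h1
  simpa using h1

lemma IsDensity.mem_HS {ρ : Op n} (hρ : IsDensity ρ) : ρ ∈ HS n := by
  obtain ⟨S, -, hS, hsum⟩ := hρ.exists_sqrt
  refine Summable.of_nonneg_of_le (fun i => by positivity) (fun i => ?_)
    (hsum.summable.mul_left (‖S‖ ^ 2))
  rw [← hS, mul_apply_eq_comp, ← mul_pow]
  exact pow_le_pow_left₀ (norm_nonneg _) (S.le_opNorm _) 2

lemma adjoint_weyl (k : Quad n → ℝ) : (weyl k : Op n).adjoint = weyl (-k) := by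
  refine ContinuousLinearMap.ext fun φ => ext_inner_right ℂ fun ψ => ?_
  rw [ContinuousLinearMap.adjoint_inner_left, inner_weyl_left, neg_neg]

/-- The Hilbert–Schmidt norm can be computed in the orthonormal basis rotated by a Weyl operator. -/
lemma hasSum_norm_sq_comp_weyl {S : Op n} {c : ℝ}
    (hS : HasSum (fun i => ‖S (onb n i)‖ ^ 2) c) (k : Quad n → ℝ) :
    HasSum (fun i => ‖S (weyl k (onb n i))‖ ^ 2) c := by
  have e : ∑' i, ‖S (weyl k (onb n i))‖ₑ ^ 2 = ∑' i, ‖S (onb n i)‖ₑ ^ 2 := by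
    have h1 := tsum_enorm_adjoint_sq (onb n) (S ∘L weyl k)
    rw [ContinuousLinearMap.adjoint_comp, adjoint_weyl] at h1
    rw [← tsum_enorm_adjoint_sq (onb n) S]
    refine h1.symm.trans (tsum_congr fun i => ?_)
    rw [ContinuousLinearMap.comp_apply, ← ofReal_norm, norm_weyl_apply, ofReal_norm]
  have hs : Summable fun i => ‖S (weyl k (onb n i))‖ ^ 2 := by
    rw [summable_norm_sq_iff, e, ← summable_norm_sq_iff]
    exact hS.summable
  have := hs.hasSum
  rwa [tsum_norm_sq_eq_toReal, e, ← tsum_norm_sq_eq_toReal, hS.tsum_eq] at this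

lemma norm_sum_diagEntry_le {S : Op n} (hS : S.adjoint = S)
    (h1 : HasSum (fun i => ‖S (onb n i)‖ ^ 2) 1) (k : Quad n → ℝ) (s : Finset (basisSet n)) :
    ∑ i ∈ s, ‖diagEntry ((S * S) ∘L weyl k) i‖ ≤ √(∑ i ∈ s, ‖S (onb n i)‖ ^ 2) := by
  have h2 := hasSum_norm_sq_comp_weyl h1 k
  have h3 : ∑ i ∈ s, ‖S (weyl k (onb n i))‖ ^ 2 ≤ 1 :=
    sum_le_hasSum s (fun i _ => by positivity) h2
  calc ∑ i ∈ s, ‖diagEntry ((S * S) ∘L weyl k) i‖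
      ≤ ∑ i ∈ s, ‖S (onb n i)‖ * ‖S (weyl k (onb n i))‖ := by
        refine Finset.sum_le_sum fun i _ => ?_
        rw [diagEntry, ContinuousLinearMap.comp_apply, mul_apply_eq_comp,
          ← ContinuousLinearMap.adjoint_inner_left, hS]
        exact norm_inner_le_norm _ _
    _ ≤ √(∑ i ∈ s, ‖S (onb n i)‖ ^ 2) * √(∑ i ∈ s, ‖S (weyl k (onb n i))‖ ^ 2) :=
        Real.sum_mul_le_sqrt_mul_sqrt _ _ _
    _ ≤ √(∑ i ∈ s, ‖S (onb n i)‖ ^ 2) * 1 := by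
        gcongr
        exact (Real.sqrt_le_sqrt h3).trans_eq Real.sqrt_one
    _ = _ := mul_one _

lemma IsDensity.hasSum_stateChar {ρ : Op n} (hρ : IsDensity ρ) (k : Quad n → ℝ) :
    HasSum (diagEntry (ρ ∘L weyl k)) (stateChar ρ k) := by
  obtain ⟨S, hS, rfl, h1⟩ := hρ.exists_sqrt
  refine Summable.hasSum ?_
  refine Summable.of_norm (summable_of_sum_le (c := 1) (fun i => norm_nonneg _) fun s => ?_)
  refine (norm_sum_diagEntry_le hS h1 k s).trans ?_
  exact (Real.sqrt_le_sqrt (sum_le_hasSum s (fun i _ => by positivity) h1)).trans_eq Real.sqrt_one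

/-- The trace defining the characteristic function of a density operator converges uniformly. -/
lemma IsDensity.tendstoUniformly_stateChar {ρ : Op n} (hρ : IsDensity ρ) :
    TendstoUniformly (fun (s : Finset (basisSet n)) k => ∑ i ∈ s, diagEntry (ρ ∘L weyl k) i)
      (stateChar ρ) atTop := by
  have hsum := fun k => hρ.hasSum_stateChar k
  obtain ⟨S, hS, rfl, h1⟩ := hρ.exists_sqrt
  rw [Metric.tendstoUniformly_iff]
  intro ε hε
  have hlim : Tendsto (fun s : Finset (basisSet n) => √(1 - ∑ i ∈ s, ‖S (onb n i)‖ ^ 2))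
      atTop (𝓝 0) := by
    have h2 : Tendsto (fun s : Finset (basisSet n) => ∑ i ∈ s, ‖S (onb n i)‖ ^ 2) atTop (𝓝 1) :=
      h1
    have := (h2.const_sub 1).sqrt
    simpa using this
  filter_upwards [hlim.eventually (gt_mem_nhds hε)] with s hs k
  refine lt_of_le_of_lt ?_ hs
  rw [dist_eq_norm]
  have h3 : Tendsto (fun t : Finset (basisSet n) =>
      ‖∑ i ∈ t, diagEntry ((S * S) ∘L weyl k) i - ∑ i ∈ s, diagEntry ((S * S) ∘L weyl k) i‖)
      atTop (𝓝 ‖stateChar (S * S) k - ∑ i ∈ s, diagEntry ((S * S) ∘L weyl k) i‖) :=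
    ((show Tendsto _ _ _ from hsum k).sub_const _).norm
  refine le_of_tendsto h3 ?_
  filter_upwards [eventually_ge_atTop s] with t ht
  classical
  rw [← Finset.sum_sdiff ht, add_sub_cancel_right]
  refine (norm_sum_le _ _).trans ((norm_sum_diagEntry_le hS h1 k _).trans ?_)
  refine Real.sqrt_le_sqrt ?_
  have h4 := sum_le_hasSum t (fun i _ => by positivity) h1
  rw [← Finset.sum_sdiff ht] at h4
  linarith

lemma IsDensity.continuous_stateChar {ρ : Op n} (hρ : IsDensity ρ) : Continuous (stateChar ρ) := by
  refine hρ.tendstoUniformly_stateChar.continuous (Frequently.of_forall fun s => ?_)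
  refine continuous_finsetSum _ fun i _ => ?_
  simp only [diagEntry_comp_weyl]
  exact continuous_inner_weyl _ _

lemma IsDensity.stateChar_ae_eq {ρ : HS n} (hρ : IsDensity (ρ : Op n)) :
    stateChar (ρ : Op n) =ᵐ[volume] charLp n ρ := by
  have hsum : Tendsto (fun s : Finset (basisSet n) =>
      ∑ i ∈ s, coeffLp ((ρ : Op n).adjoint (onb n i)) (onb n i)) atTop (𝓝 (charLp n ρ)) :=
    (summable_charFun ρ).hasSum
  rw [Lp.tendsto_Lp_iff_tendsto_eLpNorm'] at hsum
  have hm := tendstoInMeasure_of_tendsto_eLpNorm_of_ne_top two_ne_zero ENNReal.ofNat_ne_top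
    (fun s => Lp.aestronglyMeasurable _) (Lp.aestronglyMeasurable _) hsum
  obtain ⟨ns, hns, hae⟩ := hm.exists_seq_tendsto_ae'
  have hall : ∀ᵐ k : Quad n → ℝ, ∀ m,
      (∑ i ∈ ns m, coeffLp ((ρ : Op n).adjoint (onb n i)) (onb n i) : Phase n) k
        = ∑ i ∈ ns m, diagEntry ((ρ : Op n) ∘L weyl k) i :=
    ae_all_iff.2 fun m => toLp_sum_diagEntry ρ (ns m)
  filter_upwards [hae, hall] with k h1 h2
  have h3 : Tendsto (fun m => ∑ i ∈ ns m, diagEntry ((ρ : Op n) ∘L weyl k) i) atTop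
      (𝓝 (stateChar (ρ : Op n) k)) := (show Tendsto _ _ _ from hρ.hasSum_stateChar k).comp hns
  simp only [h2] at h1
  exact tendsto_nhds_unique h3 h1

end Density

/-! ### Mixtures of pure states -/

section Mixture
variable {n : ℕ} {Z : Type*} [MeasurableSpace Z] {γ : Measure Z} [IsProbabilityMeasure γ]
  {ψ : Z → Modes n}

/-- The mixture `∫ |ψ_z⟩⟨ψ_z| dγ(z)` of pure states. -/
def mixture (γ : Measure Z) (ψ : Z → Modes n) : Op n :=
  ∫ z, InnerProductSpace.rankOne ℂ (ψ z) (ψ z) ∂γ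

lemma continuous_rankOne_self {E : Type*} [NormedAddCommGroup E] [InnerProductSpace ℂ E] :
    Continuous fun φ : E => InnerProductSpace.rankOne ℂ φ φ :=
  (ContinuousLinearMap.smulRightL ℂ E E).continuous₂.comp
    ((innerSL ℂ (E := E)).continuous.prodMk continuous_id)

lemma stronglyMeasurable_rankOne (hψ : StronglyMeasurable ψ) :
    StronglyMeasurable fun z => InnerProductSpace.rankOne ℂ (ψ z) (ψ z) :=
  continuous_rankOne_self.comp_stronglyMeasurable hψ

lemma integrable_rankOne (hψ : StronglyMeasurable ψ) (h1 : ∀ z, ‖ψ z‖ = 1) :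
    Integrable (fun z => InnerProductSpace.rankOne ℂ (ψ z) (ψ z)) γ :=
  Integrable.of_bound (C := 1) (stronglyMeasurable_rankOne hψ).aestronglyMeasurable
    (Eventually.of_forall fun z => by rw [InnerProductSpace.norm_rankOne, h1, mul_one])

lemma inner_mixture (hψ : StronglyMeasurable ψ) (h1 : ∀ z, ‖ψ z‖ = 1) (v w : Modes n) :
    inner ℂ w (mixture γ ψ v) = ∫ z, inner ℂ w (ψ z) * inner ℂ (ψ z) v ∂γ := by
  have hi := integrable_rankOne (γ := γ) hψ h1
  rw [mixture, ContinuousLinearMap.integral_apply hi,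
    ← integral_inner (hi.apply_continuousLinearMap v)]
  refine integral_congr_ae (Eventually.of_forall fun z => ?_)
  simp only [InnerProductSpace.rankOne_apply, inner_smul_right]
  ring

/-- The trace of a mixture against a Weyl operator; the sum over the basis and the integral over `z`
are exchanged by the Bessel inequality. -/
lemma hasSum_diagEntry_mixture (hψ : StronglyMeasurable ψ) (h1 : ∀ z, ‖ψ z‖ = 1)
    (k : Quad n → ℝ) :
    HasSum (diagEntry (mixture γ ψ ∘L weyl k)) (∫ z, inner ℂ (ψ z) (weyl k (ψ z)) ∂γ) := by
  set F : basisSet n → Z → ℂ := fun i z =>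
    inner ℂ (onb n i) (ψ z) * inner ℂ (ψ z) (weyl k (onb n i)) with hF
  have hFm : ∀ i, StronglyMeasurable (F i) := fun i =>
    (stronglyMeasurable_const.inner hψ).mul (hψ.inner stronglyMeasurable_const)
  have hb : ∀ i z, ‖F i z‖ ≤
      1 / 2 * ‖inner ℂ (onb n i) (ψ z)‖ ^ 2 + 1 / 2 * ‖inner ℂ (onb n i) (weyl (-k) (ψ z))‖ ^ 2 := by
    intro i z
    have e : ‖inner ℂ (ψ z) (weyl k (onb n i))‖ = ‖inner ℂ (onb n i) (weyl (-k) (ψ z))‖ := by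
      rw [← inner_weyl_left, norm_inner_symm]
    rw [hF, norm_mul, e]
    nlinarith [sq_nonneg (‖inner ℂ (onb n i) (ψ z)‖ - ‖inner ℂ (onb n i) (weyl (-k) (ψ z))‖)]
  have hfin : ∀ (s : Finset (basisSet n)) z, ∑ i ∈ s, ‖F i z‖ ≤ 1 := by
    intro s z
    calc ∑ i ∈ s, ‖F i z‖ ≤ ∑ i ∈ s, (1 / 2 * ‖inner ℂ (onb n i) (ψ z)‖ ^ 2
          + 1 / 2 * ‖inner ℂ (onb n i) (weyl (-k) (ψ z))‖ ^ 2) :=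
          Finset.sum_le_sum fun i _ => hb i z
      _ = 1 / 2 * ∑ i ∈ s, ‖inner ℂ (onb n i) (ψ z)‖ ^ 2
          + 1 / 2 * ∑ i ∈ s, ‖inner ℂ (onb n i) (weyl (-k) (ψ z))‖ ^ 2 := by
          rw [Finset.sum_add_distrib, Finset.mul_sum, Finset.mul_sum]
      _ ≤ 1 / 2 * ‖ψ z‖ ^ 2 + 1 / 2 * ‖weyl (-k) (ψ z)‖ ^ 2 := by
          gcongr <;> exact (onb n).orthonormal.sum_inner_products_le _
      _ = 1 := by rw [norm_weyl_apply, h1]; norm_num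
  have hFi : ∀ i, Integrable (F i) γ := fun i =>
    Integrable.of_bound (C := 1) (hFm i).aestronglyMeasurable (Eventually.of_forall fun z => by
      simpa using hfin {i} z)
  have hs : Summable fun i => ∫ z, ‖F i z‖ ∂γ := by
    refine summable_of_sum_le (c := 1) (fun i => integral_nonneg fun _ => norm_nonneg _) fun s => ?_
    rw [← integral_finsetSum _ fun i _ => (hFi i).norm]
    calc ∫ z, ∑ i ∈ s, ‖F i z‖ ∂γ ≤ ∫ _, (1 : ℝ) ∂γ :=
          integral_mono (integrable_finsetSum _ fun i _ => (hFi i).norm) (integrable_const _)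
            (hfin s)
      _ = 1 := by simp
  have h2 := hasSum_integral_of_summable_integral_norm hFi hs
  have e1 : (fun i => ∫ z, F i z ∂γ) = diagEntry (mixture γ ψ ∘L weyl k) := by
    funext i
    rw [diagEntry, ContinuousLinearMap.comp_apply, inner_mixture hψ h1]
  have e2 : ∀ z, ∑' i, F i z = inner ℂ (ψ z) (weyl k (ψ z)) := by
    intro z
    have h3 := ((onb n).hasSum_inner_mul_inner (weyl (-k) (ψ z)) (ψ z)).tsum_eq
    rw [inner_weyl_left, neg_neg] at h3
    rw [← h3]
    refine tsum_congr fun i => ?_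
    rw [hF, inner_weyl_left, neg_neg, mul_comm]
  simp only [e1, e2] at h2
  exact h2

lemma isDensity_mixture (hψ : StronglyMeasurable ψ) (h1 : ∀ z, ‖ψ z‖ = 1) :
    IsDensity (mixture γ ψ) := by
  constructor
  · rw [ContinuousLinearMap.isPositive_iff_complex]
    intro x
    have h2 : inner ℂ x (mixture γ ψ x) = ((∫ z, ‖inner ℂ (ψ z) x‖ ^ 2 ∂γ : ℝ) : ℂ) := by
      rw [inner_mixture hψ h1, ← integral_complex_ofReal]
      refine integral_congr_ae (Eventually.of_forall fun z => ?_)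
      simp only
      rw [← inner_conj_symm x (ψ z), RCLike.conj_mul]
      push_cast
      rfl
    have h3 : inner ℂ (mixture γ ψ x) x = ((∫ z, ‖inner ℂ (ψ z) x‖ ^ 2 ∂γ : ℝ) : ℂ) := by
      rw [← inner_conj_symm, h2, Complex.conj_ofReal]
    rw [h3]
    refine ⟨by simp, ?_⟩
    simpa using integral_nonneg fun z => by positivity
  · have h2 := hasSum_diagEntry_mixture (γ := γ) hψ h1 0
    have e : (mixture γ ψ ∘L weyl 0) = mixture γ ψ := by
      ext1 v
      rw [ContinuousLinearMap.comp_apply, weyl_zero]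
    rw [e] at h2
    convert h2 using 1
    have : ∀ z, inner ℂ (ψ z) (weyl 0 (ψ z)) = (1 : ℂ) := fun z => by
      rw [weyl_zero, inner_self_eq_norm_sq_to_K, h1]; simp
    simp [this]

lemma stateChar_mixture (hψ : StronglyMeasurable ψ) (h1 : ∀ z, ‖ψ z‖ = 1) (k : Quad n → ℝ) :
    stateChar (mixture γ ψ) k = ∫ z, inner ℂ (ψ z) (weyl k (ψ z)) ∂γ :=
  (hasSum_diagEntry_mixture hψ h1 k).tsum_eq

end Mixture

/-! ### Pure Gaussian states -/

section Pure
variable {n : ℕ}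

local notation "E" => EuclideanSpace ℝ (Fin n)

lemma map_volume_equiv (A : E ≃L[ℝ] E) : ∃ c : ℝ≥0∞, c ≠ 0 ∧ c ≠ ∞ ∧
    (volume : Measure E).map A = c • volume := by
  have h : LinearMap.det (A : E →ₗ[ℝ] E) ≠ 0 := (LinearEquiv.isUnit_det' A.toLinearEquiv).ne_zero
  refine ⟨_, ?_, ENNReal.ofReal_ne_top, Measure.map_linearMap_addHaar_eq_smul_addHaar volume h⟩
  simpa using h

lemma integrable_comp_equiv (A : E ≃L[ℝ] E) {f : E → ℂ} (hf : Integrable f) :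
    Integrable fun x => f (A x) := by
  obtain ⟨c, -, hc, h⟩ := map_volume_equiv A
  have h2 : Integrable f ((volume : Measure E).map A) := by rw [h]; exact hf.smul_measure hc
  exact h2.comp_measurable A.continuous.measurable

/-- The Fourier integral of an anisotropic Gaussian; the prefactor is independent of the
frequency. -/
lemma integral_exp_neg_sq_norm_equiv (A : E ≃L[ℝ] E) : ∃ D : ℂ, D ≠ 0 ∧ ∀ w : E,
    ∫ x, Complex.exp (-((‖A x‖ ^ 2 : ℝ) : ℂ) + Complex.I * ((inner ℝ w x : ℝ) : ℂ))
      = D * Complex.exp (-((‖(A.symm : E →L[ℝ] E).adjoint w‖ ^ 2 : ℝ) : ℂ) / 4) := by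
  obtain ⟨c, hc0, hc, h⟩ := map_volume_equiv A
  refine ⟨c.toReal * ((Real.pi / 1 : ℂ) ^ (Module.finrank ℝ E / 2 : ℂ)), ?_, fun w => ?_⟩
  · refine mul_ne_zero (by simpa using ENNReal.toReal_ne_zero.2 ⟨hc0, hc⟩) ?_
    rw [Complex.cpow_ne_zero_iff]
    left; simp [Real.pi_ne_zero]
  · set v := (A.symm : E →L[ℝ] E).adjoint w with hv
    have e : ∀ x : E, (inner ℝ w x : ℝ) = inner ℝ v (A x) := by
      intro x
      rw [hv, ContinuousLinearMap.adjoint_inner_left]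
      simp
    simp only [e]
    have hm := integral_map (μ := (volume : Measure E)) A.continuous.measurable.aemeasurable
      (f := fun y : E => Complex.exp (-((‖y‖ ^ 2 : ℝ) : ℂ) + Complex.I * ((inner ℝ v y : ℝ) : ℂ)))
      (by
        refine Continuous.aestronglyMeasurable ?_
        fun_prop)
    rw [← hm, h, integral_smul_measure]
    have := GaussianFourier.integral_cexp_neg_mul_sq_norm_add (b := 1) (by simp) Complex.I v
    simp only [neg_mul, one_mul] at this
    push_cast
    rw [this, Complex.I_sq, Complex.real_smul]
    ring_nf

/-- The wave function `exp (-|A x|² / 2 - i ⟨x, Y x⟩ / 2)`, up to normalization. -/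
def gaussWave (A : E ≃L[ℝ] E) (Y : E →L[ℝ] E) (x : E) : ℂ :=
  Complex.exp (-((‖A x‖ ^ 2 : ℝ) : ℂ) / 2 - Complex.I * ((inner ℝ x (Y x) : ℝ) : ℂ) / 2)

lemma continuous_gaussWave (A : E ≃L[ℝ] E) (Y : E →L[ℝ] E) : Continuous (gaussWave A Y) := by
  unfold gaussWave
  have := A.continuous
  have := Y.continuous
  fun_prop

lemma memLp_gaussWave (A : E ≃L[ℝ] E) (Y : E →L[ℝ] E) : MemLp (gaussWave A Y) 2 volume := by
  rw [memLp_two_iff_integrable_sq_norm (continuous_gaussWave A Y).aestronglyMeasurable]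
  have h1 := (GaussianFourier.integrable_cexp_neg_mul_sq_norm_add (V := E) (b := 1) (by simp) 0 0)
  refine (integrable_comp_equiv A h1).norm.congr (Eventually.of_forall fun x => ?_)
  simp only [gaussWave, Complex.norm_exp, ← Real.exp_nat_mul]
  congr 1
  simp [← Complex.ofReal_pow]
  ring

lemma phase_eq (k : Quad n → ℝ) (x : E) : phase k x = Complex.exp
    (((inner ℝ (freq k) x + inner ℝ (freq k) (shift k) / 2 : ℝ) : ℂ) * Complex.I) := by
  rw [phase]
  congr 3
  simp only [PiLp.inner_apply, freq, shift, Finset.sum_add_distrib, Finset.sum_div]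
  simp [mul_comm]

/-- A Gaussian wave function and its characteristic function. In the position representation,
completing the square makes the integral that of `integral_exp_neg_sq_norm_equiv`. -/
lemma exists_pure_gaussian (A : E ≃L[ℝ] E) (Y : E →L[ℝ] E) (hY : Y.adjoint = Y) :
    ∃ ψ : Modes n, ‖ψ‖ = 1 ∧ ∀ k : Quad n → ℝ, inner ℂ ψ (weyl k ψ) =
      Complex.exp ((((-(‖A (shift k)‖ ^ 2
        + ‖(A.symm : E →L[ℝ] E).adjoint (freq k - Y (shift k))‖ ^ 2) / 4 : ℝ)) : ℂ)) := by
  obtain ⟨D, hD, hint⟩ := integral_exp_neg_sq_norm_equiv A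
  set φ : Modes n := (memLp_gaussWave A Y).toLp
  have hφ : φ =ᵐ[volume] gaussWave A Y := (memLp_gaussWave A Y).coeFn_toLp
  have key : ∀ k : Quad n → ℝ, inner ℂ φ (weyl k φ) = D *
      Complex.exp ((((-(‖A (shift k)‖ ^ 2
        + ‖(A.symm : E →L[ℝ] E).adjoint (freq k - Y (shift k))‖ ^ 2) / 4 : ℝ)) : ℂ)) := by
    intro k
    set a := freq k with ha
    set b := shift k with hb
    have h1 : inner ℂ φ (weyl k φ) = ∫ x, starRingEnd ℂ (gaussWave A Y x)
        * (phase k x * gaussWave A Y (x + b)) := by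
      rw [L2.inner_def]
      refine integral_congr_ae ?_
      filter_upwards [hφ, ae_shift k hφ, weyl_coeFn k φ] with x h1 h2 h3
      rw [h1, h3, h2]
      exact mul_comm _ _
    -- the shift by `b / 2` makes the integrand symmetric in `φ` and its translate
    rw [h1, ← integral_sub_right_eq_self _ ((1 / 2 : ℝ) • b)]
    have h2 := hint (a - Y b)
    rw [show D * Complex.exp ((((-(‖A b‖ ^ 2
        + ‖(A.symm : E →L[ℝ] E).adjoint (a - Y b)‖ ^ 2) / 4 : ℝ)) : ℂ))
        = Complex.exp (((-‖A b‖ ^ 2 / 4 : ℝ) : ℂ)) *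
          (D * Complex.exp
            (-((‖(A.symm : E →L[ℝ] E).adjoint (a - Y b)‖ ^ 2 : ℝ) : ℂ) / 4)) by
      rw [mul_left_comm, ← Complex.exp_add]; congr 2; push_cast; ring, ← h2,
      ← integral_const_mul]
    refine integral_congr_ae (Eventually.of_forall fun x => ?_)
    simp only
    rw [phase_eq, ← ha, ← hb]
    have hsh : x - (1 / 2 : ℝ) • b + b = x + (1 / 2 : ℝ) • b := by module
    rw [hsh]
    simp only [gaussWave]
    rw [← Complex.exp_conj, ← Complex.exp_add, ← Complex.exp_add, ← Complex.exp_add]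
    congr 1
    have hN1 : ‖A (x - (1 / 2 : ℝ) • b)‖ ^ 2
        = ‖A x‖ ^ 2 - inner ℝ (A x) (A b) + ‖A b‖ ^ 2 / 4 := by
      rw [_root_.map_sub, _root_.map_smul, norm_sub_sq_real, inner_smul_right, norm_smul]
      norm_num; ring
    have hN2 : ‖A (x + (1 / 2 : ℝ) • b)‖ ^ 2
        = ‖A x‖ ^ 2 + inner ℝ (A x) (A b) + ‖A b‖ ^ 2 / 4 := by
      rw [_root_.map_add, _root_.map_smul, norm_add_sq_real, inner_smul_right, norm_smul]
      norm_num; ring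
    have hsym : inner ℝ b (Y x) = inner ℝ (Y b) x := by
      rw [← ContinuousLinearMap.adjoint_inner_left, hY]
    have hsym2 : inner ℝ x (Y b) = inner ℝ (Y b) x := real_inner_comm _ _
    have hY1 : inner ℝ (x - (1 / 2 : ℝ) • b) (Y (x - (1 / 2 : ℝ) • b))
        = inner ℝ x (Y x) - inner ℝ (Y b) x + inner ℝ b (Y b) / 4 := by
      simp only [_root_.map_sub, _root_.map_smul, inner_sub_left, inner_sub_right, inner_smul_left,
        inner_smul_right, hsym, hsym2]
      norm_num; ring
    have hY2 : inner ℝ (x + (1 / 2 : ℝ) • b) (Y (x + (1 / 2 : ℝ) • b))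
        = inner ℝ x (Y x) + inner ℝ (Y b) x + inner ℝ b (Y b) / 4 := by
      simp only [_root_.map_add, _root_.map_smul, inner_add_left, inner_add_right, inner_smul_left,
        inner_smul_right, hsym, hsym2]
      norm_num; ring
    have ha1 : inner ℝ a (x - (1 / 2 : ℝ) • b) = inner ℝ a x - inner ℝ a b / 2 := by
      rw [inner_sub_right, inner_smul_right]; ring
    rw [hN1, hN2, hY1, hY2, ha1, inner_sub_left]
    simp only [_root_.map_sub, map_mul, map_div₀, map_neg, Complex.conj_ofReal, Complex.conj_I,
      map_ofNat]
    push_cast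
    ring
  have h0 : D = ((‖φ‖ ^ 2 : ℝ) : ℂ) := by
    have := key 0
    have hs : shift (0 : Quad n → ℝ) = 0 := rfl
    have hp : freq (0 : Quad n → ℝ) = 0 := rfl
    rw [weyl_zero, inner_self_eq_norm_sq_to_K, hs, hp] at this
    simpa using this.symm
  have hφ0 : ‖φ‖ ≠ 0 := by
    intro h
    rw [h] at h0
    exact hD (by simpa using h0)
  refine ⟨((‖φ‖⁻¹ : ℝ) : ℂ) • φ, ?_, fun k => ?_⟩
  · rw [norm_smul]; simp [hφ0]
  · rw [_root_.map_smul, inner_smul_left, inner_smul_right, key, h0, Complex.conj_ofReal]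
    push_cast
    have : (‖φ‖ : ℂ) ≠ 0 := by exact_mod_cast hφ0
    field_simp

end Pure

section SquareRoot
open scoped MatrixOrder

/-- The positive square root of `P` commutes with everything that commutes with `P`. -/
lemma exists_symm_sqrt {ι : Type*} [Fintype ι] [DecidableEq ι] {P : Matrix ι ι ℝ}
    (hP : P.PosSemidef) : ∃ S : Matrix ι ι ℝ, S.PosSemidef ∧ S.IsSymm ∧ S * S = P ∧
      ∀ B : Matrix ι ι ℝ, Commute B P → Commute B S := by
  have h0 : (CFC.sqrt P).PosSemidef := Matrix.nonneg_iff_posSemidef.1 (CFC.sqrt_nonneg P)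
  refine ⟨CFC.sqrt P, h0, ?_, CFC.sqrt_mul_sqrt_self P hP.nonneg, fun B hB => ?_⟩
  · have := h0.isHermitian
    rwa [Matrix.IsHermitian, Matrix.conjTranspose_eq_transpose_of_trivial] at this
  · exact (Commute.cfcₙ_nnreal hB.symm _).symm

lemma isUnit_det_of_sq {ι : Type*} [Fintype ι] [DecidableEq ι] {P S : Matrix ι ι ℝ}
    (hP : P.PosDef) (h : S * S = P) : IsUnit S.det := by
  have := hP.det_pos
  rw [← h, Matrix.det_mul] at this
  exact isUnit_iff_ne_zero.2 fun h0 => by simp [h0] at this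

end SquareRoot

section Pure
variable {n : ℕ}

/-- The pure Gaussian state whose position covariance is `P` and whose wave function carries the
quadratic phase given by `Y`. -/
lemma exists_pure_gaussian_matrix {P Y : Matrix (Fin n) (Fin n) ℝ} (hP : P.PosDef)
    (hY : Y.IsSymm) : ∃ ψ : Modes n, ‖ψ‖ = 1 ∧ ∀ a b : Fin n → ℝ, ∀ k : Quad n → ℝ,
      (∀ j, k (j, 0) = a j) → (∀ j, k (j, 1) = b j) → inner ℂ ψ (weyl k ψ) =
      Complex.exp ((((-(b ⬝ᵥ (P⁻¹ *ᵥ b) + (a - Y *ᵥ b) ⬝ᵥ (P *ᵥ (a - Y *ᵥ b))) / 4 : ℝ)) : ℂ)) := by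
  obtain ⟨S, -, hSs, hS, -⟩ := exists_symm_sqrt hP.posSemidef
  have hu := isUnit_det_of_sq hP hS
  set u : (Matrix (Fin n) (Fin n) ℝ)ˣ := Matrix.nonsingInvUnit S hu with hu'
  set A := (ContinuousLinearEquiv.unitsEquiv ℝ (EuclideanSpace ℝ (Fin n)))
    (Units.map (Matrix.toEuclideanCLM (n := Fin n) (𝕜 := ℝ)).toMonoidHom u⁻¹) with hA
  have hA1 : ∀ x, A x = WithLp.toLp 2 (S⁻¹ *ᵥ WithLp.ofLp x) := fun x => rfl
  have hA2 : (A.symm : EuclideanSpace ℝ (Fin n) →L[ℝ] EuclideanSpace ℝ (Fin n))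
      = Matrix.toEuclideanCLM (n := Fin n) (𝕜 := ℝ) S := rfl
  have hadj : ∀ M : Matrix (Fin n) (Fin n) ℝ, M.IsSymm →
      (Matrix.toEuclideanCLM (n := Fin n) (𝕜 := ℝ) M).adjoint
        = Matrix.toEuclideanCLM (n := Fin n) (𝕜 := ℝ) M := by
    intro M hM
    rw [← ContinuousLinearMap.star_eq_adjoint, ← map_star, Matrix.star_eq_conjTranspose,
      Matrix.conjTranspose_eq_transpose_of_trivial, hM]
  obtain ⟨ψ, h1, h2⟩ := exists_pure_gaussian A (Matrix.toEuclideanCLM (n := Fin n) (𝕜 := ℝ) Y)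
    (hadj Y hY)
  refine ⟨ψ, h1, fun a b k ha hb => ?_⟩
  have ea : freq k = WithLp.toLp 2 a := by ext j; exact ha j
  have eb : shift k = WithLp.toLp 2 b := by ext j; exact hb j
  have hn : ∀ (M : Matrix (Fin n) (Fin n) ℝ) (v : Fin n → ℝ), M.IsSymm →
      ‖(WithLp.toLp 2 (M *ᵥ v) : EuclideanSpace ℝ (Fin n))‖ ^ 2 = v ⬝ᵥ ((M * M) *ᵥ v) := by
    intro M v hM
    rw [← real_inner_self_eq_norm_sq, EuclideanSpace.inner_eq_star_dotProduct]
    simp only [star_trivial]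
    rw [← Matrix.mulVec_mulVec, Matrix.dotProduct_mulVec v, ← Matrix.mulVec_transpose, hM]
  have hSi : S⁻¹.IsSymm := by rw [Matrix.IsSymm, Matrix.transpose_nonsing_inv, hSs]
  rw [h2, ea, eb, hA2, hadj S hSs, hA1, Matrix.toEuclideanCLM_toLp, ← WithLp.toLp_sub,
    Matrix.toEuclideanCLM_toLp, hn _ _ hSi, hn _ _ hSs, ← Matrix.mul_inv_rev, hS]

/-! ### Gaussian measures with prescribed mean and covariance -/

section GaussMeasure
variable {ι : Type*} [Fintype ι] [DecidableEq ι]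

/-- The Gaussian measure on `ℝ^ι` with mean `r` and characteristic function
`gaussFactor σ r`, for `σ` positive semidefinite. -/
def gaussMeasure (r : ι → ℝ) (σ : Matrix ι ι ℝ) : Measure (ι → ℝ) :=
  (multivariateGaussian (WithLp.toLp 2 r) ((1 / 2 : ℝ) • σ)).map
    (EuclideanSpace.equiv ι ℝ)

instance isGaussian_gaussMeasure (r : ι → ℝ) (σ : Matrix ι ι ℝ) :
    IsGaussian (gaussMeasure r σ) := by
  unfold gaussMeasure; infer_instance

lemma integral_exp_gaussMeasure (r : ι → ℝ) {σ : Matrix ι ι ℝ} (hσ : σ.PosSemidef) (k : ι → ℝ) :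
    ∫ z, Complex.exp (((k ⬝ᵥ z : ℝ) : ℂ) * Complex.I) ∂(gaussMeasure r σ)
      = gaussFactor σ r k := by
  have h2 := charFun_multivariateGaussian (μ := WithLp.toLp 2 r)
    (hσ.smul (by norm_num : (0 : ℝ) ≤ 1 / 2)) (WithLp.toLp 2 k)
  rw [charFun_apply] at h2
  rw [gaussMeasure, integral_map (EuclideanSpace.equiv ι ℝ).continuous.measurable.aemeasurable
    (Continuous.aestronglyMeasurable (by fun_prop))]
  have e : ∀ x : EuclideanSpace ℝ ι, k ⬝ᵥ (EuclideanSpace.equiv ι ℝ x)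
      = inner ℝ x (WithLp.toLp 2 k) := by
    intro x
    rw [EuclideanSpace.inner_eq_star_dotProduct]
    rfl
  simp only [e]
  rw [h2, gaussFactor, EuclideanSpace.inner_eq_star_dotProduct]
  congr 1
  simp only [star_trivial, dotProduct_comm r k, Matrix.smul_mulVec, dotProduct_smul, smul_eq_mul]
  push_cast
  ring

end GaussMeasure

/-! ### Existence of Gaussian states -/

/-- The phase space point whose Weyl operator displaces the first moments by `r`. -/
def displacement (r : Quad n → ℝ) : Quad n → ℝ :=
  fun p => if p.2 = 0 then r (p.1, 1) else -r (p.1, 0)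

/-- Displacing a state by `r` multiplies its characteristic function by `exp (i k r)`. -/
lemma inner_displaced (ψ : Modes n) (r k : Quad n → ℝ) :
    inner ℂ (weyl (displacement r) ψ) (weyl k (weyl (displacement r) ψ))
      = Complex.exp (((k ⬝ᵥ r : ℝ) : ℂ) * Complex.I) * inner ℂ ψ (weyl k ψ) := by
  set h := displacement r with hh
  rw [inner_weyl_left, weyl_weyl k h, _root_.map_smul, weyl_weyl, smul_smul, inner_smul_right,
    ← Complex.exp_add, neg_add_cancel_comm_assoc]
  congr 2
  rw [← add_mul, ← Complex.ofReal_add]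
  congr 2
  simp only [cocycle, dotProduct, Fintype.sum_prod_type, Fin.sum_univ_two]
  rw [← add_div, ← Finset.sum_add_distrib, Finset.sum_div]
  refine Finset.sum_congr rfl fun j _ => ?_
  simp [hh, displacement]
  ring

lemma continuous_displacement : Continuous (displacement : (Quad n → ℝ) → Quad n → ℝ) := by
  refine continuous_pi fun p => ?_
  unfold displacement
  split_ifs <;> fun_prop

/-- A Gaussian mixture of displaced copies of a pure state with Gaussian characteristic function
is a density operator with Gaussian characteristic function. -/
lemma exists_density_of_pure {ψ : Modes n} (h1 : ‖ψ‖ = 1) {σ τ : Matrix (Quad n) (Quad n) ℝ}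
    (hψ : ∀ k, inner ℂ ψ (weyl k ψ) = gaussFactor σ 0 k) (hτ : τ.PosSemidef) (r : Quad n → ℝ) :
    ∃ ρ : Op n, IsDensity ρ ∧ ∀ k, stateChar ρ k = gaussFactor (σ + τ) r k := by
  have hm : StronglyMeasurable fun z : Quad n → ℝ => weyl (displacement z) ψ :=
    ((continuous_weyl_apply ψ).comp continuous_displacement).stronglyMeasurable
  have hn : ∀ z : Quad n → ℝ, ‖weyl (displacement z) ψ‖ = 1 := fun z => by
    rw [norm_weyl_apply, h1]
  refine ⟨mixture (gaussMeasure r τ) fun z => weyl (displacement z) ψ, isDensity_mixture hm hn,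
    fun k => ?_⟩
  rw [stateChar_mixture hm hn]
  simp only [inner_displaced]
  rw [integral_mul_const, integral_exp_gaussMeasure r hτ, hψ, gaussFactor, gaussFactor, gaussFactor,
    ← Complex.exp_add, Matrix.add_mulVec, dotProduct_add, dotProduct_zero]
  congr 1
  push_cast
  ring

end Pure

/-! ### Quantum covariance matrices -/

section QuantumCov
variable {n : ℕ}

lemma symp_transpose (n : ℕ) : (symp n)ᵀ = -symp n := by
  ext ⟨i, s⟩ ⟨j, t⟩
  fin_cases s <;> fin_cases t <;> simp [symp, Matrix.kroneckerMap_apply, Matrix.one_apply, eq_comm]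

lemma symp_mul_symp (n : ℕ) : symp n * symp n = -1 := by
  rw [symp, ← Matrix.mul_kronecker_mul]
  have : (!![0, 1; -1, 0] : Matrix (Fin 2) (Fin 2) ℝ) * !![0, 1; -1, 0] = -1 := by
    ext i j; fin_cases i <;> fin_cases j <;> simp
  rw [this, mul_one]
  rw [← Matrix.one_kronecker_one]
  ext ⟨i, s⟩ ⟨j, t⟩
  simp only [Matrix.kroneckerMap_apply, Matrix.neg_apply, mul_neg]

lemma dotProduct_symp_comm (u v : Quad n → ℝ) :
    u ⬝ᵥ (symp n *ᵥ v) = -(v ⬝ᵥ (symp n *ᵥ u)) := by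
  rw [Matrix.dotProduct_mulVec, ← Matrix.mulVec_transpose, symp_transpose, Matrix.neg_mulVec,
    neg_dotProduct, dotProduct_comm]

lemma symp_mulVec_mulVec (v : Quad n → ℝ) : symp n *ᵥ (symp n *ᵥ v) = -v := by
  rw [Matrix.mulVec_mulVec, symp_mul_symp, Matrix.neg_mulVec, Matrix.one_mulVec]

lemma symp_mulVec_dotProduct (u v : Quad n → ℝ) :
    (symp n *ᵥ u) ⬝ᵥ (symp n *ᵥ v) = u ⬝ᵥ v := by
  rw [dotProduct_symp_comm, symp_mulVec_mulVec, dotProduct_neg, neg_neg, dotProduct_comm]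

lemma dotProduct_map_mulVec {ι : Type*} [Fintype ι] (M : Matrix ι ι ℝ) (u v : ι → ℝ) :
    (fun i => (u i : ℂ)) ⬝ᵥ (M.map Complex.ofReal *ᵥ fun i => (v i : ℂ))
      = ((u ⬝ᵥ (M *ᵥ v) : ℝ) : ℂ) := by
  simp only [dotProduct, Matrix.mulVec, Matrix.map_apply]
  push_cast
  rfl

/-- The inequalities `σ ≥ ± i Δ` written with real vectors. -/
lemma isQuantumCov_iff {σ : Matrix (Quad n) (Quad n) ℝ} : IsQuantumCov σ ↔
    σ.IsSymm ∧ ∀ u v, 2 * (u ⬝ᵥ (symp n *ᵥ v)) ≤ u ⬝ᵥ (σ *ᵥ u) + v ⬝ᵥ (σ *ᵥ v) := by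
  have quad : ∀ (c : ℝ) (u v : Quad n → ℝ), σ.IsSymm →
      star ((fun i => (u i : ℂ)) + Complex.I • fun i => (v i : ℂ)) ⬝ᵥ
        ((σ.map Complex.ofReal + (c * Complex.I) • (symp n).map Complex.ofReal) *ᵥ
          ((fun i => (u i : ℂ)) + Complex.I • fun i => (v i : ℂ)))
        = ((u ⬝ᵥ (σ *ᵥ u) + v ⬝ᵥ (σ *ᵥ v) - c * (2 * (u ⬝ᵥ (symp n *ᵥ v))) : ℝ) : ℂ) := by
    intro c u v hs
    have e : star ((fun i => (u i : ℂ)) + Complex.I • fun i => (v i : ℂ))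
        = (fun i => (u i : ℂ)) - Complex.I • fun i => (v i : ℂ) := by
      ext i; simp [sub_eq_add_neg]
    have h1 : v ⬝ᵥ (σ *ᵥ u) = u ⬝ᵥ (σ *ᵥ v) := by
      rw [Matrix.dotProduct_mulVec, ← Matrix.mulVec_transpose, hs, dotProduct_comm]
    have h2 := dotProduct_symp_comm v u
    have h3 : ∀ w : Quad n → ℝ, w ⬝ᵥ (symp n *ᵥ w) = 0 := fun w => by
      have := dotProduct_symp_comm w w; linarith
    rw [e]
    simp only [Matrix.add_mulVec, Matrix.smul_mulVec, Matrix.mulVec_add, Matrix.mulVec_smul,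
      sub_dotProduct, smul_dotProduct, dotProduct_add, dotProduct_smul, dotProduct_map_mulVec,
      h1, h2, h3, smul_eq_mul]
    push_cast
    ring_nf
    simp only [Complex.I_sq]
    ring
  have e1 : σ.map Complex.ofReal - Complex.I • (symp n).map Complex.ofReal
      = σ.map Complex.ofReal + (((-1 : ℝ) : ℂ) * Complex.I) • (symp n).map Complex.ofReal := by
    push_cast
    rw [neg_one_mul, neg_smul, sub_eq_add_neg]
  have e2 : σ.map Complex.ofReal + Complex.I • (symp n).map Complex.ofReal
      = σ.map Complex.ofReal + (((1 : ℝ) : ℂ) * Complex.I) • (symp n).map Complex.ofReal := by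
    push_cast
    rw [one_mul]
  have hdec : ∀ z : Quad n → ℂ, z = (fun i => (((z i).re : ℝ) : ℂ)) +
      Complex.I • fun i => (((z i).im : ℝ) : ℂ) := by
    intro z
    ext i
    simp only [Pi.add_apply, Pi.smul_apply, smul_eq_mul]
    rw [mul_comm, Complex.re_add_im]
  rw [IsQuantumCov, e1, e2]
  constructor
  · rintro ⟨-, h⟩
    have hs : σ.IsSymm := by
      ext i j
      have := congrArg Complex.re (congrFun (congrFun h.1 i) j)
      simpa using this
    refine ⟨hs, fun u v => ?_⟩
    have h0 := h.dotProduct_mulVec_nonneg ((fun i => (u i : ℂ)) + Complex.I • fun i => (v i : ℂ))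
    rw [quad 1 u v hs, Complex.zero_le_real] at h0
    linarith
  · rintro ⟨hs, h⟩
    have hH : ∀ c : ℝ, (σ.map Complex.ofReal
        + ((c : ℂ) * Complex.I) • (symp n).map Complex.ofReal).IsHermitian := by
      intro c
      ext i j
      have h1 := hs.apply i j
      have h2 : symp n j i = -symp n i j := congrFun (congrFun (symp_transpose n) i) j
      simp only [Matrix.conjTranspose_apply, Matrix.add_apply, Matrix.map_apply, Matrix.smul_apply,
        h1, h2]
      simp
    constructor
    · refine Matrix.PosSemidef.of_dotProduct_mulVec_nonneg (hH _) fun z => ?_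
      rw [hdec z, quad _ _ _ hs, Complex.zero_le_real]
      have := h (fun i => (z i).re) (-fun i => (z i).im)
      simp only [Matrix.mulVec_neg, dotProduct_neg, neg_dotProduct, neg_neg] at this
      linarith
    · refine Matrix.PosSemidef.of_dotProduct_mulVec_nonneg (hH _) fun z => ?_
      rw [hdec z, quad _ _ _ hs, Complex.zero_le_real]
      have := h (fun i => (z i).re) (fun i => (z i).im)
      linarith

lemma posSemidef_iff_real {ι : Type*} [Fintype ι] {M : Matrix ι ι ℝ} :
    M.PosSemidef ↔ M.IsSymm ∧ ∀ x, 0 ≤ x ⬝ᵥ (M *ᵥ x) := by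
  rw [Matrix.posSemidef_iff_dotProduct_mulVec, Matrix.IsHermitian,
    Matrix.conjTranspose_eq_transpose_of_trivial]
  simp [Matrix.IsSymm]

lemma IsQuantumCov.isSymm {σ : Matrix (Quad n) (Quad n) ℝ} (h : IsQuantumCov σ) : σ.IsSymm :=
  (isQuantumCov_iff.1 h).1

/-- The uncertainty relation excludes degenerate directions: apply it to `u` and to a small multiple
of the direction conjugate to `u`. -/
lemma IsQuantumCov.posDef {σ : Matrix (Quad n) (Quad n) ℝ} (h : IsQuantumCov σ) : σ.PosDef := by
  obtain ⟨hs, h⟩ := isQuantumCov_iff.1 h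
  refine Matrix.posDef_iff_dotProduct_mulVec.2 ⟨?_, fun u hu => ?_⟩
  · rw [Matrix.IsHermitian, Matrix.conjTranspose_eq_transpose_of_trivial, hs]
  · rw [star_trivial]
    have hu2 : 0 < u ⬝ᵥ u := by
      have := Matrix.dotProduct_star_self_pos_iff.2 hu
      rwa [star_trivial] at this
    set w := symp n *ᵥ u with hw
    -- `v = - s Δ u` turns the inequality into `2 s |u|² ≤ uσu + s² wσw`
    have key : ∀ s : ℝ, 2 * s * (u ⬝ᵥ u) ≤ u ⬝ᵥ (σ *ᵥ u) + s ^ 2 * (w ⬝ᵥ (σ *ᵥ w)) := by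
      intro s
      have := h u (-(s • w))
      rw [hw, Matrix.mulVec_neg, Matrix.mulVec_smul, symp_mulVec_mulVec, ← hw] at this
      simp only [Matrix.mulVec_neg, Matrix.mulVec_smul, dotProduct_neg, neg_dotProduct, neg_neg,
        smul_neg, dotProduct_smul, smul_dotProduct, smul_eq_mul] at this
      linarith
    have hw0 : 0 ≤ w ⬝ᵥ (σ *ᵥ w) := by
      have := h w 0
      simpa using this
    by_contra hneg
    have h1 := key ((u ⬝ᵥ u) / (w ⬝ᵥ (σ *ᵥ w) + 1))
    have hd : 0 < w ⬝ᵥ (σ *ᵥ w) + 1 := by linarith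
    have h2 : ((u ⬝ᵥ u) / (w ⬝ᵥ (σ *ᵥ w) + 1)) ^ 2 * (w ⬝ᵥ (σ *ᵥ w))
        ≤ (u ⬝ᵥ u) / (w ⬝ᵥ (σ *ᵥ w) + 1) * (u ⬝ᵥ u) := by
      rw [sq, mul_assoc]
      refine mul_le_mul_of_nonneg_left ?_ (by positivity)
      rw [div_mul_eq_mul_div, div_le_iff₀ hd]
      nlinarith
    have h3 : 0 < (u ⬝ᵥ u) / (w ⬝ᵥ (σ *ᵥ w) + 1) * (u ⬝ᵥ u) := by positivity
    linarith

lemma IsQuantumCov.add {σ τ : Matrix (Quad n) (Quad n) ℝ} (h : IsQuantumCov σ)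
    (hτ : τ.PosSemidef) : IsQuantumCov (σ + τ) := by
  rw [isQuantumCov_iff] at h ⊢
  rw [posSemidef_iff_real] at hτ
  refine ⟨h.1.add hτ.1, fun u v => ?_⟩
  have := h.2 u v
  simp only [Matrix.add_mulVec, dotProduct_add]
  linarith [hτ.2 u, hτ.2 v]

lemma dotProduct_self_nonneg_real {ι : Type*} [Fintype ι] (v : ι → ℝ) : 0 ≤ v ⬝ᵥ v := by
  have := dotProduct_star_self_nonneg v
  rwa [star_trivial] at this

lemma two_mul_dotProduct_le {ι : Type*} [Fintype ι] (u v : ι → ℝ) :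
    2 * (u ⬝ᵥ v) ≤ u ⬝ᵥ u + v ⬝ᵥ v := by
  have := dotProduct_self_nonneg_real (u - v)
  simp only [sub_dotProduct, dotProduct_sub, dotProduct_comm v u] at this
  linarith

lemma isQuantumCov_one : IsQuantumCov (1 : Matrix (Quad n) (Quad n) ℝ) := by
  refine isQuantumCov_iff.2 ⟨Matrix.isSymm_one, fun u v => ?_⟩
  rw [Matrix.one_mulVec, Matrix.one_mulVec, ← symp_mulVec_dotProduct v v]
  exact two_mul_dotProduct_le _ _

/-- Squeezing: a quantum covariance matrix can be arbitrarily small in a given direction. -/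
lemma exists_isQuantumCov_le (k : Quad n → ℝ) {ε : ℝ} (hε : 0 < ε) :
    ∃ σ : Matrix (Quad n) (Quad n) ℝ, IsQuantumCov σ ∧ k ⬝ᵥ (σ *ᵥ k) ≤ ε * (k ⬝ᵥ k) := by
  by_cases hk : k = 0
  · exact ⟨1, isQuantumCov_one, by simp [hk]⟩
  set c := √(k ⬝ᵥ k) with hc
  have hk2 : 0 < k ⬝ᵥ k := by
    have := Matrix.dotProduct_star_self_pos_iff.2 hk
    rwa [star_trivial] at this
  have hc0 : 0 < c := Real.sqrt_pos.2 hk2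
  have hcc : c * c = k ⬝ᵥ k := Real.mul_self_sqrt hk2.le
  set e := c⁻¹ • k with he
  set f := -(symp n *ᵥ e) with hf
  have hee : e ⬝ᵥ e = 1 := by
    rw [he, smul_dotProduct, dotProduct_smul, ← hcc]
    simp only [smul_eq_mul]
    field_simp
  have hff : f ⬝ᵥ f = 1 := by
    rw [hf, neg_dotProduct_neg, symp_mulVec_dotProduct, hee]
  have h0 : ∀ w : Quad n → ℝ, w ⬝ᵥ (symp n *ᵥ w) = 0 := fun w => by
    have := dotProduct_symp_comm w w; linarith
  have hef : e ⬝ᵥ f = 0 := by rw [hf, dotProduct_neg, h0, neg_zero]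
  have hΔe : symp n *ᵥ e = -f := by rw [hf, neg_neg]
  have hΔf : symp n *ᵥ f = e := by rw [hf, Matrix.mulVec_neg, symp_mulVec_mulVec, neg_neg]
  have heΔ : ∀ v, e ⬝ᵥ (symp n *ᵥ v) = f ⬝ᵥ v := fun v => by
    rw [dotProduct_symp_comm, hΔe, dotProduct_neg, neg_neg, dotProduct_comm]
  have hfΔ : ∀ v, f ⬝ᵥ (symp n *ᵥ v) = -(e ⬝ᵥ v) := fun v => by
    rw [dotProduct_symp_comm, hΔf, dotProduct_comm]
  have hform : ∀ u, u ⬝ᵥ ((1 + (ε - 1) • Matrix.vecMulVec e e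
      + (ε⁻¹ - 1) • Matrix.vecMulVec f f : Matrix (Quad n) (Quad n) ℝ) *ᵥ u)
      = u ⬝ᵥ u + (ε - 1) * (e ⬝ᵥ u) ^ 2 + (ε⁻¹ - 1) * (f ⬝ᵥ u) ^ 2 := by
    intro u
    simp only [Matrix.add_mulVec, Matrix.smul_mulVec, Matrix.one_mulVec, dotProduct_add,
      dotProduct_smul, dotProduct_vecMulVec_mulVec, dotProduct_comm u e, dotProduct_comm u f,
      smul_eq_mul]
    ring
  refine ⟨1 + (ε - 1) • Matrix.vecMulVec e e + (ε⁻¹ - 1) • Matrix.vecMulVec f f,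
    isQuantumCov_iff.2 ⟨?_, fun u v => ?_⟩, ?_⟩
  · ext i j
    simp [Matrix.vecMulVec_apply, Matrix.one_apply, eq_comm, mul_comm]
  · rw [hform, hform]
    -- split off the components of `u` and `v` in the symplectic plane spanned by `e` and `f`
    have hu := two_mul_dotProduct_le (u - (e ⬝ᵥ u) • e - (f ⬝ᵥ u) • f)
      (symp n *ᵥ (v - (e ⬝ᵥ v) • e - (f ⬝ᵥ v) • f))
    rw [symp_mulVec_dotProduct] at hu
    simp only [Matrix.mulVec_sub, Matrix.mulVec_smul, hΔe, hΔf, sub_dotProduct, dotProduct_sub,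
      smul_dotProduct, dotProduct_smul, dotProduct_neg, heΔ, hfΔ, hee, hff, hef,
      dotProduct_comm f e, dotProduct_comm u e, dotProduct_comm u f, dotProduct_comm v e,
      dotProduct_comm v f, smul_eq_mul] at hu
    have hmix : ∀ x y : ℝ, 2 * (x * y) ≤ ε * x ^ 2 + ε⁻¹ * y ^ 2 := by
      intro x y
      have h1 : ε * (x - ε⁻¹ * y) ^ 2 = ε * x ^ 2 + ε⁻¹ * y ^ 2 - 2 * (x * y) := by
        field_simp
        ring
      have h2 : 0 ≤ ε * (x - ε⁻¹ * y) ^ 2 := by positivity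
      linarith
    have m1 := hmix (e ⬝ᵥ u) (f ⬝ᵥ v)
    have m2 := hmix (-(e ⬝ᵥ v)) (f ⬝ᵥ u)
    nlinarith
  · rw [hform]
    have h1 : e ⬝ᵥ k = c := by
      rw [he, smul_dotProduct, ← hcc, smul_eq_mul]; field_simp
    have h2 : f ⬝ᵥ k = 0 := by
      have : k = c • e := by rw [he, smul_smul, mul_inv_cancel₀ hc0.ne', one_smul]
      rw [this, dotProduct_smul, dotProduct_comm, hef, smul_zero]
    rw [h1, h2, ← hcc]
    apply le_of_eq
    ring

end QuantumCov

/-! ### Every quantum covariance matrix dominates a pure one -/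

section PureCov
variable {n : ℕ}

lemma dotProduct_transpose_mulVec {ι : Type*} [Fintype ι] (M : Matrix ι ι ℝ) (u v : ι → ℝ) :
    u ⬝ᵥ (Mᵀ *ᵥ v) = (M *ᵥ u) ⬝ᵥ v := by
  rw [Matrix.mulVec_transpose, dotProduct_comm, ← Matrix.dotProduct_mulVec, dotProduct_comm]

lemma dotProduct_mulVec_comm_of_isSymm {ι : Type*} [Fintype ι] {M : Matrix ι ι ℝ} (hM : M.IsSymm)
    (u v : ι → ℝ) : u ⬝ᵥ (M *ᵥ v) = (M *ᵥ u) ⬝ᵥ v := by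
  rw [Matrix.dotProduct_mulVec, ← Matrix.mulVec_transpose, hM]

/-- Williamson's normal form in disguise: with `B = σ^{-1/2} Δ σ^{-1/2}`, the matrix
`σ^{1/2} |B| σ^{1/2}` is dominated by `σ` and is, up to a factor, symplectic. -/
lemma IsQuantumCov.exists_pure_le {σ : Matrix (Quad n) (Quad n) ℝ} (hσ : IsQuantumCov σ) :
    ∃ π : Matrix (Quad n) (Quad n) ℝ, π.PosDef ∧ π * symp n * π = symp n ∧
      (σ - π).PosSemidef := by
  have hpd := hσ.posDef
  obtain ⟨S, hS0, hSs, hS, -⟩ := exists_symm_sqrt hpd.posSemidef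
  have hu := isUnit_det_of_sq hpd hS
  set T := S⁻¹ with hT
  have hST : S * T = 1 := Matrix.mul_nonsing_inv S hu
  have hTS : T * S = 1 := Matrix.nonsing_inv_mul S hu
  have hTs : Tᵀ = T := by rw [hT, Matrix.transpose_nonsing_inv, hSs]
  set B := T * symp n * T with hB
  have hBt : Bᵀ = -B := by
    rw [hB, Matrix.transpose_mul, Matrix.transpose_mul, hTs, symp_transpose]
    simp [Matrix.mul_assoc]
  have hSBS : S * B * S = symp n := by
    calc S * B * S = (S * T) * symp n * (T * S) := by rw [hB]; simp only [Matrix.mul_assoc]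
      _ = symp n := by rw [hST, hTS, Matrix.one_mul, Matrix.mul_one]
  set D := S * symp n * S with hD
  have hDB : D * B = -1 := by
    calc D * B = S * (symp n * (S * T) * symp n) * T := by
          rw [hD, hB]; simp only [Matrix.mul_assoc]
      _ = -1 := by rw [hST, Matrix.mul_one, symp_mul_symp]; simp [hST]
  have hBD : B * D = -1 := by
    calc B * D = T * (symp n * (T * S) * symp n) * S := by
          rw [hD, hB]; simp only [Matrix.mul_assoc]
      _ = -1 := by rw [hTS, Matrix.mul_one, symp_mul_symp]; simp [hTS]
  have hQpsd : (Bᵀ * B).PosSemidef := by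
    have := Matrix.posSemidef_conjTranspose_mul_self B
    rwa [Matrix.conjTranspose_eq_transpose_of_trivial] at this
  obtain ⟨N, hN0, hNs, hN, hNc⟩ := exists_symm_sqrt hQpsd
  have hBN : B * N = N * B := (hNc B (by
    change B * (Bᵀ * B) = Bᵀ * B * B
    rw [hBt]; simp [Matrix.mul_assoc])).eq
  have hDN : D * N = N * D := by
    calc D * N = -(D * N * (B * D)) := by rw [hBD]; simp
      _ = -(D * (N * B) * D) := by simp only [Matrix.mul_assoc]
      _ = -((D * B) * N * D) := by rw [← hBN]; simp only [Matrix.mul_assoc]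
      _ = N * D := by rw [hDB]; simp
  have hNDN : N * D * N = B := by
    calc N * D * N = (N * N) * D := by rw [Matrix.mul_assoc, hDN, Matrix.mul_assoc]
      _ = -(B * (B * D)) := by rw [hN, hBt]; simp [Matrix.mul_assoc]
      _ = B := by rw [hBD]; simp
  have hdetB : B.det ≠ 0 := by
    intro h
    have h1 := congrArg Matrix.det hDB
    rw [Matrix.det_mul, h, mul_zero, Matrix.det_neg, Matrix.det_one, mul_one] at h1
    exact pow_ne_zero _ (by norm_num) h1.symm
  have hdetN : N.det ≠ 0 := by
    intro h
    have h1 := congrArg Matrix.det hN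
    rw [Matrix.det_mul, Matrix.det_mul, h, mul_zero, Matrix.det_transpose] at h1
    exact mul_ne_zero hdetB hdetB h1.symm
  have hNpd : N.PosDef := hN0.posDef_iff_det_ne_zero.2 hdetN
  have hform : ∀ (M : Matrix (Quad n) (Quad n) ℝ) (u : Quad n → ℝ),
      u ⬝ᵥ ((S * M * S) *ᵥ u) = (S *ᵥ u) ⬝ᵥ (M *ᵥ (S *ᵥ u)) := by
    intro M u
    rw [← Matrix.mulVec_mulVec, ← Matrix.mulVec_mulVec, dotProduct_mulVec_comm_of_isSymm hSs]
  have hSinj : ∀ u, T *ᵥ (S *ᵥ u) = u := fun u => by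
    rw [Matrix.mulVec_mulVec, hTS, Matrix.one_mulVec]
  have hSinj' : ∀ u, S *ᵥ (T *ᵥ u) = u := fun u => by
    rw [Matrix.mulVec_mulVec, hST, Matrix.one_mulVec]
  have hsymm : (S * N * S).IsSymm := by
    rw [Matrix.IsSymm, Matrix.transpose_mul, Matrix.transpose_mul, hSs, hNs, Matrix.mul_assoc]
  -- `σ ≥ ± i Δ` says that `B` is a contraction, hence so is `N = |B|`
  have hBle : ∀ v, (B *ᵥ v) ⬝ᵥ (B *ᵥ v) ≤ v ⬝ᵥ v := by
    intro v
    have h1 := (isQuantumCov_iff.1 hσ).2 (T *ᵥ (B *ᵥ v)) (T *ᵥ v)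
    have h2 : ∀ w, (T *ᵥ w) ⬝ᵥ (σ *ᵥ (T *ᵥ w)) = w ⬝ᵥ w := by
      intro w
      rw [← hS, ← Matrix.mulVec_mulVec, hSinj', dotProduct_mulVec_comm_of_isSymm hSs, hSinj']
    have h3 : (T *ᵥ (B *ᵥ v)) ⬝ᵥ (symp n *ᵥ (T *ᵥ v)) = (B *ᵥ v) ⬝ᵥ (B *ᵥ v) := by
      rw [← dotProduct_mulVec_comm_of_isSymm (show T.IsSymm from hTs), Matrix.mulVec_mulVec,
        Matrix.mulVec_mulVec, ← hB]
    rw [h2, h2, h3] at h1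
    linarith
  have hNle : ∀ v, v ⬝ᵥ (N *ᵥ v) ≤ v ⬝ᵥ v := by
    intro v
    have h1 := two_mul_dotProduct_le v (N *ᵥ v)
    have h2 : (N *ᵥ v) ⬝ᵥ (N *ᵥ v) = (B *ᵥ v) ⬝ᵥ (B *ᵥ v) := by
      rw [← dotProduct_mulVec_comm_of_isSymm hNs, Matrix.mulVec_mulVec, hN,
        ← Matrix.mulVec_mulVec, dotProduct_transpose_mulVec]
    linarith [hBle v]
  refine ⟨S * N * S, ?_, ?_, ?_⟩
  · refine Matrix.posDef_iff_dotProduct_mulVec.2 ⟨?_, fun u hu => ?_⟩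
    · rwa [Matrix.IsHermitian, Matrix.conjTranspose_eq_transpose_of_trivial]
    · rw [star_trivial, hform]
      have h1 : S *ᵥ u ≠ 0 := fun h => hu (by rw [← hSinj u, h, Matrix.mulVec_zero])
      have := hNpd.dotProduct_mulVec_pos h1
      rwa [star_trivial] at this
  · calc S * N * S * symp n * (S * N * S) = S * (N * D * N) * S := by
          rw [hD]; simp only [Matrix.mul_assoc]
      _ = symp n := by rw [hNDN, hSBS]
  · refine posSemidef_iff_real.2 ⟨hσ.isSymm.sub hsymm, fun u => ?_⟩
    rw [Matrix.sub_mulVec, dotProduct_sub, hform, ← hS, ← Matrix.mulVec_mulVec,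
      dotProduct_mulVec_comm_of_isSymm hSs]
    linarith [hNle (S *ᵥ u)]

/-- The block of a phase space matrix belonging to the `s`-th and `t`-th quadratures (`0` for
positions, `1` for momenta). -/
def block (M : Matrix (Quad n) (Quad n) ℝ) (s t : Fin 2) : Matrix (Fin n) (Fin n) ℝ :=
  M.submatrix (fun i => (i, s)) (fun i => (i, t))

/-- The block form of `M Δ M'`. -/
lemma block_mul_symp_mul (M M' : Matrix (Quad n) (Quad n) ℝ) (s t : Fin 2) :
    block (M * symp n * M') s t
      = block M s 0 * block M' 1 t - block M s 1 * block M' 0 t := by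
  ext i l
  simp [block, Matrix.mul_apply, Fintype.sum_prod_type, Fin.sum_univ_two, symp,
    Matrix.kroneckerMap_apply, Matrix.one_apply, sub_eq_add_neg,
    Finset.sum_add_distrib, add_comm]

lemma dotProduct_mulVec_eq_block (M : Matrix (Quad n) (Quad n) ℝ) (k : Quad n → ℝ)
    (a b : Fin n → ℝ) (ha : ∀ j, k (j, 0) = a j) (hb : ∀ j, k (j, 1) = b j) :
    k ⬝ᵥ (M *ᵥ k) = a ⬝ᵥ (block M 0 0 *ᵥ a) + a ⬝ᵥ (block M 0 1 *ᵥ b)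
      + b ⬝ᵥ (block M 1 0 *ᵥ a) + b ⬝ᵥ (block M 1 1 *ᵥ b) := by
  simp only [dotProduct, Matrix.mulVec, Fintype.sum_prod_type, Fin.sum_univ_two, ha, hb, block,
    Matrix.submatrix_apply, Finset.sum_add_distrib, mul_add]
  ring

/-- There is a pure Gaussian state for every pure quantum covariance matrix. -/
lemma exists_pure_of_symplectic {π : Matrix (Quad n) (Quad n) ℝ} (hπ : π.PosDef)
    (hsp : π * symp n * π = symp n) :
    ∃ ψ : Modes n, ‖ψ‖ = 1 ∧ ∀ k, inner ℂ ψ (weyl k ψ) = gaussFactor π 0 k := by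
  have hs : π.IsSymm := by
    have := hπ.isHermitian
    rwa [Matrix.IsHermitian, Matrix.conjTranspose_eq_transpose_of_trivial] at this
  set P := block π 0 0 with hP
  set C := block π 0 1 with hC
  set R := block π 1 1 with hR
  have hPs : Pᵀ = P := by ext i j; exact hs.apply _ _
  have hCt : block π 1 0 = Cᵀ := by ext i j; exact hs.apply _ _
  have hPd : P.PosDef := hπ.submatrix (fun i j h => by simpa using h)
  have h00 : P * Cᵀ - C * P = 0 := by
    rw [← hCt, ← block_mul_symp_mul, hsp]
    ext i j; simp [block, symp]
  have h01 : P * R - C * C = 1 := by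
    rw [← block_mul_symp_mul, hsp]
    ext i j; simp [block, symp, Matrix.kroneckerMap_apply]
  have hu : IsUnit P.det := isUnit_iff_ne_zero.2 hPd.det_pos.ne'
  have hPi : P⁻¹ * P = 1 := Matrix.nonsing_inv_mul P hu
  have hPi' : P * P⁻¹ = 1 := Matrix.mul_nonsing_inv P hu
  have hPis : (P⁻¹)ᵀ = P⁻¹ := by rw [Matrix.transpose_nonsing_inv, hPs]
  have hY : Cᵀ * P⁻¹ = P⁻¹ * C := by
    calc Cᵀ * P⁻¹ = P⁻¹ * (P * Cᵀ) * P⁻¹ := by rw [← Matrix.mul_assoc, hPi, Matrix.one_mul]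
      _ = P⁻¹ * (C * P) * P⁻¹ := by rw [sub_eq_zero.1 h00]
      _ = P⁻¹ * C := by rw [Matrix.mul_assoc, Matrix.mul_assoc, hPi', Matrix.mul_one]
  have hYs : (-(P⁻¹ * C)).IsSymm := by
    rw [Matrix.IsSymm, Matrix.transpose_neg, Matrix.transpose_mul, hPis, hY]
  obtain ⟨ψ, h1, h2⟩ := exists_pure_gaussian_matrix hPd hYs
  refine ⟨ψ, h1, fun k => ?_⟩
  rw [h2 (fun j => k (j, 0)) (fun j => k (j, 1)) k (fun _ => rfl) (fun _ => rfl), gaussFactor,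
    dotProduct_zero, dotProduct_mulVec_eq_block π k _ _ (fun _ => rfl) (fun _ => rfl), hCt,
    ← hP, ← hC, ← hR]
  set a : Fin n → ℝ := fun j => k (j, 0)
  set b : Fin n → ℝ := fun j => k (j, 1)
  have e1 : R = P⁻¹ + P⁻¹ * C * C := by
    calc R = P⁻¹ * (P * R) := by rw [← Matrix.mul_assoc, hPi, Matrix.one_mul]
      _ = P⁻¹ * (1 + C * C) := by rw [← h01]; simp
      _ = _ := by rw [Matrix.mul_add, Matrix.mul_one, Matrix.mul_assoc]
  have e2 : P *ᵥ (P⁻¹ *ᵥ (C *ᵥ b)) = C *ᵥ b := by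
    rw [Matrix.mulVec_mulVec, hPi', Matrix.one_mulVec]
  have e3 : (P⁻¹ *ᵥ (C *ᵥ b)) ⬝ᵥ (P *ᵥ a) = b ⬝ᵥ (Cᵀ *ᵥ a) := by
    rw [dotProduct_mulVec_comm_of_isSymm (show P.IsSymm from hPs), e2,
      dotProduct_transpose_mulVec]
  have e4 : (P⁻¹ *ᵥ (C *ᵥ b)) ⬝ᵥ (C *ᵥ b) = b ⬝ᵥ ((P⁻¹ * C * C) *ᵥ b) := by
    rw [← hY, ← Matrix.mulVec_mulVec, ← Matrix.mulVec_mulVec, dotProduct_transpose_mulVec,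
      dotProduct_comm]
  have e5 : a - -(P⁻¹ * C) *ᵥ b = a + P⁻¹ *ᵥ (C *ᵥ b) := by
    rw [Matrix.neg_mulVec, sub_neg_eq_add, Matrix.mulVec_mulVec]
  rw [e5, Matrix.mulVec_add, e2, add_dotProduct, dotProduct_add, dotProduct_add, e3, e4, e1,
    Matrix.add_mulVec, dotProduct_add]
  congr 1
  push_cast
  ring

/-- Every quantum covariance matrix and every first moment are those of a Gaussian state. -/
theorem exists_isGaussianStateWith {σ : Matrix (Quad n) (Quad n) ℝ} (hσ : IsQuantumCov σ)
    (r : Quad n → ℝ) : ∃ ρ : HS n, IsGaussianStateWith (ρ : Op n) σ r := by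
  obtain ⟨π, hπ, hsp, hle⟩ := hσ.exists_pure_le
  obtain ⟨ψ, h1, h2⟩ := exists_pure_of_symplectic hπ hsp
  obtain ⟨ρ, hρ, h⟩ := exists_density_of_pure h1 h2 hle r
  exact ⟨⟨ρ, hρ.mem_HS⟩, hρ, hσ, by simpa using h⟩

end PureCov

/-! ### Gaussian factors as elements of `L²` -/

section GaussFactor

lemma tendsto_eLpNorm_two_of_dominated {Ω J : Type*} [MeasurableSpace Ω] {μ : Measure Ω}
    {l : Filter J} [l.IsCountablyGenerated] {F : J → Ω → ℂ} {f : Ω → ℂ} {b : Ω → ℝ}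
    (hF : ∀ j, AEStronglyMeasurable (F j) μ) (hf : AEStronglyMeasurable f μ)
    (hb : ∀ j, ∀ᵐ x ∂μ, ‖F j x - f x‖ ≤ b x) (hb2 : MemLp b 2 μ)
    (hlim : ∀ᵐ x ∂μ, Tendsto (fun j => F j x) l (𝓝 (f x))) :
    Tendsto (fun j => eLpNorm (F j - f) 2 μ) l (𝓝 0) := by
  have hsq : Tendsto (fun j => ∫⁻ x, ‖F j x - f x‖ₑ ^ (2 : ℝ) ∂μ) l (𝓝 (∫⁻ _, 0 ∂μ)) := by
    refine tendsto_lintegral_filter_of_dominated_convergence' (fun x => ‖b x‖ₑ ^ (2 : ℝ))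
      (Eventually.of_forall fun j => ?_) (Eventually.of_forall fun j => ?_) ?_ ?_
    · exact (((hF j).sub hf).enorm).pow_const _
    · filter_upwards [hb j] with x hx
      refine ENNReal.rpow_le_rpow ?_ (by norm_num)
      rw [← ofReal_norm, ← ofReal_norm, Real.norm_eq_abs]
      exact ENNReal.ofReal_le_ofReal (hx.trans (le_abs_self _))
    · have h := hb2.2
      rw [eLpNorm_lt_top_iff_lintegral_rpow_enorm_lt_top two_ne_zero ENNReal.ofNat_ne_top] at h
      simpa using h.ne
    · filter_upwards [hlim] with x hx
      have h1 := (ENNReal.continuous_rpow_const (y := 2)).tendsto 0 |>.comp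
        ((continuous_enorm.tendsto (0 : ℂ)).comp (tendsto_sub_nhds_zero_iff.2 hx) |>.trans
          (by rw [enorm_zero]))
      rwa [ENNReal.zero_rpow_of_pos two_pos] at h1
  rw [lintegral_zero] at hsq
  have h3 := (ENNReal.continuous_rpow_const (y := 1 / 2)).tendsto 0 |>.comp hsq
  rw [ENNReal.zero_rpow_of_pos (by norm_num)] at h3
  refine h3.congr fun k => ?_
  rw [Function.comp_apply, eLpNorm_eq_lintegral_rpow_enorm_toReal two_ne_zero
    ENNReal.ofNat_ne_top, ENNReal.toReal_ofNat]
  rfl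

variable {ι : Type*} [Fintype ι]

lemma norm_gaussFactor (α : Matrix ι ι ℝ) (y k : ι → ℝ) :
    ‖gaussFactor α y k‖ = Real.exp (-(k ⬝ᵥ (α *ᵥ k)) / 4) := by
  rw [gaussFactor, Complex.exp_add, norm_mul, Complex.norm_exp_ofReal_mul_I, mul_one,
    Complex.norm_exp, Complex.ofReal_re]

lemma gaussFactor_ne_zero (α : Matrix ι ι ℝ) (y k : ι → ℝ) : gaussFactor α y k ≠ 0 :=
  Complex.exp_ne_zero _

lemma continuous_gaussFactor (α : Matrix ι ι ℝ) (y : ι → ℝ) : Continuous (gaussFactor α y) := by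
  unfold gaussFactor dotProduct Matrix.mulVec dotProduct
  fun_prop

lemma norm_gaussFactor_le_of_le {α β : Matrix ι ι ℝ}
    (h : ∀ k, k ⬝ᵥ (α *ᵥ k) ≤ k ⬝ᵥ (β *ᵥ k)) (x y k : ι → ℝ) :
    ‖gaussFactor β y k‖ ≤ ‖gaussFactor α x k‖ := by
  rw [norm_gaussFactor, norm_gaussFactor, Real.exp_le_exp]
  linarith [h k]

lemma norm_gaussFactor_le_one {α : Matrix ι ι ℝ} (h : α.PosSemidef) (y k : ι → ℝ) :
    ‖gaussFactor α y k‖ ≤ 1 := by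
  rw [norm_gaussFactor, Real.exp_le_one_iff]
  linarith [(posSemidef_iff_real.1 h).2 k]

/-- The value of a Gaussian factor at `k` is a continuous function of its values at `k₁`, `k₁ + k`
and `k₁ - k`, because the modulus satisfies the parallelogram law. -/
lemma gaussFactor_eq_of_shifts (α : Matrix ι ι ℝ) (y k k₁ : ι → ℝ) :
    gaussFactor α y k = ((√(‖gaussFactor α y (k + k₁)‖ * ‖gaussFactor α y (k₁ - k)‖)
        / (‖gaussFactor α y k₁‖ ^ 2 * ‖gaussFactor α y (k + k₁)‖) : ℝ) : ℂ)
      * (gaussFactor α y (k + k₁) * starRingEnd ℂ (gaussFactor α y k₁)) := by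
  have e1 : √(‖gaussFactor α y (k + k₁)‖ * ‖gaussFactor α y (k₁ - k)‖)
      = Real.exp (-(k ⬝ᵥ (α *ᵥ k) + k₁ ⬝ᵥ (α *ᵥ k₁)) / 4) := by
    rw [norm_gaussFactor, norm_gaussFactor, ← Real.exp_add, Real.sqrt_eq_iff_mul_self_eq
      (Real.exp_pos _).le (Real.exp_pos _).le, ← Real.exp_add]
    congr 1
    simp only [Matrix.mulVec_add, Matrix.mulVec_sub, add_dotProduct, dotProduct_add,
      sub_dotProduct, dotProduct_sub]
    ring
  rw [e1, norm_gaussFactor, norm_gaussFactor, ← Real.exp_nat_mul, ← Real.exp_add, ← Real.exp_sub,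
    gaussFactor, gaussFactor, gaussFactor, ← Complex.exp_conj, ← Complex.exp_add,
    Complex.ofReal_exp, ← Complex.exp_add]
  congr 1
  simp only [_root_.map_add, map_mul, Complex.conj_ofReal, Complex.conj_I, add_dotProduct]
  push_cast
  ring

/-- Convergence of Gaussian factors in `L²` implies convergence at every point: almost everywhere
convergence of a subsequence is improved by translation invariance, since the value at `k` is a
continuous function of the values at `k₁`, `k₁ + k` and `k₁ - k`. -/
lemma tendsto_gaussFactor_of_tendsto_eLpNorm {A : ℕ → Matrix ι ι ℝ} {B : ℕ → ι → ℝ}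
    {α : Matrix ι ι ℝ} {y : ι → ℝ}
    (h : Tendsto (fun m => eLpNorm (gaussFactor (A m) (B m) - gaussFactor α y) 2 volume)
      atTop (𝓝 0)) (k : ι → ℝ) :
    Tendsto (fun m => gaussFactor (A m) (B m) k) atTop (𝓝 (gaussFactor α y k)) := by
  refine tendsto_of_subseq_tendsto fun ns hns => ?_
  have hm := tendstoInMeasure_of_tendsto_eLpNorm_of_ne_top two_ne_zero ENNReal.ofNat_ne_top
    (fun s => (continuous_gaussFactor (A (ns s)) (B (ns s))).aestronglyMeasurable)
    (continuous_gaussFactor α y).aestronglyMeasurable (h.comp hns)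
  obtain ⟨ms, hms, hae⟩ := hm.exists_seq_tendsto_ae
  refine ⟨ms, ?_⟩
  have h1 : ∀ᵐ k₁ : ι → ℝ, Tendsto (fun i => gaussFactor (A (ns (ms i))) (B (ns (ms i))) (k + k₁))
      atTop (𝓝 (gaussFactor α y (k + k₁))) :=
    (measurePreserving_add_left volume k).quasiMeasurePreserving.ae hae
  have h2 : ∀ᵐ k₁ : ι → ℝ, Tendsto (fun i => gaussFactor (A (ns (ms i))) (B (ns (ms i))) (k₁ - k))
      atTop (𝓝 (gaussFactor α y (k₁ - k))) := by
    simp only [sub_eq_add_neg]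
    exact (measurePreserving_add_right volume (-k)).quasiMeasurePreserving.ae hae
  obtain ⟨k₁, h0, h1, h2⟩ := (hae.and (h1.and h2)).exists
  rw [gaussFactor_eq_of_shifts α y k k₁]
  simp only [gaussFactor_eq_of_shifts (A (ns (ms _))) (B (ns (ms _))) k k₁]
  refine Tendsto.mul ?_ (h1.mul ((Complex.continuous_conj.tendsto _).comp h0))
  refine (Complex.continuous_ofReal.tendsto _).comp ?_
  refine ((h1.norm.mul h2.norm).sqrt).div ((h0.norm.pow 2).mul h1.norm) ?_
  have := gaussFactor_ne_zero α y k₁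
  have := gaussFactor_ne_zero α y (k + k₁)
  positivity

/-- A Gaussian factor as an element of `L²` (zero if it is not square integrable). -/
def gaussLp (α : Matrix ι ι ℝ) (y : ι → ℝ) : Lp ℂ 2 (volume : Measure (ι → ℝ)) :=
  open Classical in if h : MemLp (gaussFactor α y) 2 volume then h.toLp else 0

lemma gaussLp_coeFn {α : Matrix ι ι ℝ} {y : ι → ℝ} (h : MemLp (gaussFactor α y) 2 volume) :
    gaussLp α y =ᵐ[volume] gaussFactor α y := by
  rw [gaussLp, dif_pos h]
  exact h.coeFn_toLp

lemma memLp_gaussFactor_of_le {α β : Matrix ι ι ℝ} {x : ι → ℝ}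
    (h : MemLp (gaussFactor α x) 2 volume)
    (hle : ∀ k, k ⬝ᵥ (α *ᵥ k) ≤ k ⬝ᵥ (β *ᵥ k)) (y : ι → ℝ) :
    MemLp (gaussFactor β y) 2 volume :=
  h.of_le (continuous_gaussFactor β y).aestronglyMeasurable
    (Eventually.of_forall fun k => norm_gaussFactor_le_of_le hle x y k)

/-- Pointwise convergence of Gaussian factors improves to convergence in `L²` when the covariances
are bounded below. -/
lemma tendsto_gaussLp {J : Type*} {l : Filter J} [l.IsCountablyGenerated] {A : J → Matrix ι ι ℝ}
    {B : J → ι → ℝ} {α : Matrix ι ι ℝ} {y : ι → ℝ} (h : MemLp (gaussFactor α y) 2 volume)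
    (hle : ∀ j k, k ⬝ᵥ (α *ᵥ k) ≤ k ⬝ᵥ (A j *ᵥ k))
    (hlim : ∀ k, Tendsto (fun j => gaussFactor (A j) (B j) k) l (𝓝 (gaussFactor α y k))) :
    Tendsto (fun j => gaussLp (A j) (B j)) l (𝓝 (gaussLp α y)) := by
  have hA : ∀ j, MemLp (gaussFactor (A j) (B j)) 2 volume := fun j =>
    memLp_gaussFactor_of_le h (hle j) _
  rw [tendsto_iff_edist_tendsto_0]
  have := tendsto_eLpNorm_two_of_dominated (l := l) (b := fun k => 2 * ‖gaussFactor α y k‖)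
    (fun j => (hA j).1) h.1 (fun j => Eventually.of_forall fun k => ?_) (h.norm.const_mul 2)
    (Eventually.of_forall hlim)
  · refine this.congr fun j => ?_
    rw [Lp.edist_def]
    exact eLpNorm_congr_ae ((gaussLp_coeFn (hA j)).sub (gaussLp_coeFn h)).symm
  · refine (norm_sub_le _ _).trans ?_
    rw [two_mul]
    gcongr
    exact norm_gaussFactor_le_of_le (hle j) _ _ _

lemma tendsto_gaussFactor_of_tendsto_gaussLp {A : ℕ → Matrix ι ι ℝ} {B : ℕ → ι → ℝ}
    {α : Matrix ι ι ℝ} {y : ι → ℝ} (hA : ∀ m, MemLp (gaussFactor (A m) (B m)) 2 volume)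
    (h : MemLp (gaussFactor α y) 2 volume)
    (hlim : Tendsto (fun m => gaussLp (A m) (B m)) atTop (𝓝 (gaussLp α y))) (k : ι → ℝ) :
    Tendsto (fun m => gaussFactor (A m) (B m) k) atTop (𝓝 (gaussFactor α y k)) := by
  refine tendsto_gaussFactor_of_tendsto_eLpNorm ?_ k
  rw [tendsto_iff_edist_tendsto_0] at hlim
  refine hlim.congr fun j => ?_
  rw [Lp.edist_def]
  exact eLpNorm_congr_ae ((gaussLp_coeFn (hA j)).sub (gaussLp_coeFn h))

/-- The Bochner integral in `L²` of a family of Gaussian factors is their pointwise integral. -/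
lemma integral_gaussLp_ae_eq {γ : Measure ℝ} [IsProbabilityMeasure γ] {A : ℝ → Matrix ι ι ℝ}
    {B : ℝ → ι → ℝ} (hA : ∀ z, MemLp (gaussFactor (A z) (B z)) 2 volume)
    (hpsd : ∀ z, (A z).PosSemidef)
    (hc : ∀ k, Continuous fun z => gaussFactor (A z) (B z) k)
    (hi : Integrable (fun z => gaussLp (A z) (B z)) γ) :
    (∫ z, gaussLp (A z) (B z) ∂γ : Lp ℂ 2 (volume : Measure (ι → ℝ))) =ᵐ[volume]
      fun k => ∫ z, gaussFactor (A z) (B z) k ∂γ := by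
  have hmeas : StronglyMeasurable (Function.uncurry fun (k : ι → ℝ) z =>
      gaussFactor (A z) (B z) k) := by
    have := stronglyMeasurable_uncurry_of_continuous_of_stronglyMeasurable
      (u := fun z (k : ι → ℝ) => gaussFactor (A z) (B z) k)
      (fun k => hc k) (fun z => (continuous_gaussFactor (A z) (B z)).stronglyMeasurable)
    exact this.comp_measurable measurable_swap
  have hsm : StronglyMeasurable fun k => ∫ z, gaussFactor (A z) (B z) k ∂γ :=
    hmeas.integral_prod_right
  have hle : ∀ k, ‖∫ z, gaussFactor (A z) (B z) k ∂γ‖ ≤ 1 := fun k => by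
    refine (MeasureTheory.norm_integral_le_of_norm_le_const (C := 1) (Eventually.of_forall fun z =>
      norm_gaussFactor_le_one (hpsd z) _ _)).trans_eq ?_
    simp
  refine ae_eq_of_forall_setIntegral_eq_of_sigmaFinite (fun s hs hμ => ?_) (fun s hs hμ => ?_)
    fun s hs hμ => ?_
  · exact integrableOn_Lp_of_measure_ne_top _ one_le_two hμ.ne
  · have : IsFiniteMeasure (volume.restrict s : Measure (ι → ℝ)) := ⟨by simpa using hμ⟩
    exact Integrable.of_bound (C := 1) hsm.aestronglyMeasurable (Eventually.of_forall hle)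
  · have : IsFiniteMeasure (volume.restrict s : Measure (ι → ℝ)) := ⟨by simpa using hμ⟩
    rw [← L2.inner_indicatorConstLp_one hs hμ.ne, ← integral_inner hi]
    simp only [L2.inner_indicatorConstLp_one hs hμ.ne]
    have e : ∀ z, ∫ k in s, gaussLp (A z) (B z) k = ∫ k in s, gaussFactor (A z) (B z) k := fun z =>
      integral_congr_ae (ae_restrict_of_ae (gaussLp_coeFn (hA z)))
    simp only [e]
    rw [integral_integral_swap]
    exact Integrable.of_bound (C := 1)
      ((hmeas.comp_measurable measurable_swap).aestronglyMeasurable)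
      (Eventually.of_forall fun p => norm_gaussFactor_le_one (hpsd _) _ _)

end GaussFactor

/-! ### Completeness of the Gaussian factors with fixed covariance -/

section Dense
variable {ι : Type*} [Fintype ι]

lemma gaussFactor_eq_zero_mul (α : Matrix ι ι ℝ) (y k : ι → ℝ) :
    gaussFactor α y k = gaussFactor α 0 k * Complex.exp (((k ⬝ᵥ y : ℝ) : ℂ) * Complex.I) := by
  rw [gaussFactor, gaussFactor, ← Complex.exp_add, dotProduct_zero]
  simp

open FourierTransform in
/-- The inner products of `f` with the Gaussian factors of covariance `α` are the values of the
Fourier transform of `gaussFactor α 0 * f`, up to conjugation. -/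
lemma eq_zero_of_inner_gaussLp {α : Matrix ι ι ℝ} (hα : α.PosSemidef)
    (h2 : MemLp (gaussFactor α 0) 2 volume) {f : Lp ℂ 2 (volume : Measure (ι → ℝ))}
    (h : ∀ x, inner ℂ (gaussLp α x) f = 0) : f = 0 := by
  have hmem : ∀ x, MemLp (gaussFactor α x) 2 volume := fun x =>
    memLp_gaussFactor_of_le h2 (fun _ => le_rfl) x
  set g : (ι → ℝ) → ℂ := fun k => starRingEnd ℂ (gaussFactor α 0 k) * f k with hg
  have hgm : AEStronglyMeasurable g volume :=
    (Complex.continuous_conj.comp (continuous_gaussFactor α 0)).aestronglyMeasurable.mul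
      (Lp.aestronglyMeasurable f)
  have hg1 : Integrable g := MemLp.integrable_mul h2.star (Lp.memLp f)
  have hg2 : MemLp g 2 volume := (Lp.memLp f).of_le hgm (Eventually.of_forall fun k => by
    rw [hg, norm_mul, RCLike.norm_conj]
    exact mul_le_of_le_one_left (norm_nonneg _) (norm_gaussFactor_le_one hα _ _))
  have hmp := PiLp.volume_preserving_ofLp ι
  have hF : ∀ w, 𝓕 (fun v : EuclideanSpace ℝ ι => g (WithLp.ofLp v)) w = 0 := by
    intro w
    rw [Real.fourier_eq', ← h ((2 * Real.pi) • WithLp.ofLp w), L2.inner_def]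
    have := hmp.integral_comp (MeasurableEquiv.toLp 2 (ι → ℝ)).symm.measurableEmbedding
      (fun k => Complex.exp ((-2 * Real.pi * (k ⬝ᵥ WithLp.ofLp w) : ℝ) * Complex.I) • g k)
    refine Eq.trans ?_ (this.trans ?_)
    · refine integral_congr_ae (Eventually.of_forall fun v => ?_)
      simp only [EuclideanSpace.inner_eq_star_dotProduct, star_trivial]
      rw [dotProduct_comm]
    · refine integral_congr_ae ?_
      filter_upwards [gaussLp_coeFn (hmem ((2 * Real.pi) • WithLp.ofLp w))] with k hk
      rw [hk, gaussFactor_eq_zero_mul, RCLike.inner_apply, map_mul, ← Complex.exp_conj, map_mul,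
        Complex.conj_ofReal, Complex.conj_I, dotProduct_smul, smul_eq_mul, smul_eq_mul]
      have : ((-2 * Real.pi * (k ⬝ᵥ WithLp.ofLp w) : ℝ) : ℂ) * Complex.I
          = ((2 * Real.pi * (k ⬝ᵥ WithLp.ofLp w) : ℝ) : ℂ) * -Complex.I := by
        push_cast; ring
      rw [this, hg]
      ring
  have h0 := ae_eq_zero_of_fourier_eq_zero
    (hmp.integrable_comp_of_integrable hg1) (hg2.comp_measurePreserving hmp) hF
  have h1 : ∀ᵐ k : ι → ℝ, g k = 0 := by
    have := (PiLp.volume_preserving_toLp ι).quasiMeasurePreserving.ae h0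
    filter_upwards [this] with k hk using hk
  refine Lp.ext ?_
  filter_upwards [h1, Lp.coeFn_zero ℂ 2 (volume : Measure (ι → ℝ))] with k hk hk0
  rw [hk0]
  refine (mul_eq_zero.1 hk).resolve_left ?_
  simp [gaussFactor_ne_zero]

/-- The Gaussian factors with fixed covariance span a dense subspace of `L²`. -/
lemma topologicalClosure_span_gaussLp {α : Matrix ι ι ℝ} (hα : α.PosSemidef)
    (h2 : MemLp (gaussFactor α 0) 2 volume) :
    (Submodule.span ℂ (Set.range (gaussLp α))).topologicalClosure = ⊤ := by
  rw [Submodule.topologicalClosure_eq_top_iff, Submodule.eq_bot_iff]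
  intro f hf
  refine eq_zero_of_inner_gaussLp hα h2 fun x => ?_
  exact (Submodule.mem_orthogonal _ f).1 hf _ (Submodule.subset_span ⟨x, rfl⟩)

lemma norm_gaussLp_le {α β : Matrix ι ι ℝ} {x : ι → ℝ} (h : MemLp (gaussFactor α x) 2 volume)
    (hle : ∀ k, k ⬝ᵥ (α *ᵥ k) ≤ k ⬝ᵥ (β *ᵥ k)) (y : ι → ℝ) :
    ‖gaussLp β y‖ ≤ ‖gaussLp α x‖ := by
  refine Lp.norm_le_norm_of_ae_le ?_
  filter_upwards [gaussLp_coeFn h, gaussLp_coeFn (memLp_gaussFactor_of_le h hle y)] with k h1 h2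
  rw [h1, h2]
  exact norm_gaussFactor_le_of_le hle _ _ _

lemma gaussLp_ne_zero {α : Matrix ι ι ℝ} {x : ι → ℝ} (h : MemLp (gaussFactor α x) 2 volume) :
    gaussLp α x ≠ 0 := by
  intro h0
  have h1 := gaussLp_coeFn h
  rw [h0] at h1
  obtain ⟨k, hk, hk'⟩ := (h1.and (Lp.coeFn_zero ℂ 2 (volume : Measure (ι → ℝ)))).exists
  rw [hk'] at hk
  exact gaussFactor_ne_zero α x k hk.symm

lemma gaussFactor_eq_of_gaussLp_eq {α β : Matrix ι ι ℝ} {x y : ι → ℝ}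
    (hα : MemLp (gaussFactor α x) 2 volume) (hβ : MemLp (gaussFactor β y) 2 volume)
    (h : gaussLp α x = gaussLp β y) : gaussFactor α x = gaussFactor β y := by
  refine ((continuous_gaussFactor α x).ae_eq_iff_eq volume (continuous_gaussFactor β y)).1 ?_
  refine (gaussLp_coeFn hα).symm.trans ?_
  rw [h]
  exact gaussLp_coeFn hβ

lemma gaussFactor_add_smul (σ : Matrix ι ι ℝ) (x u k : ι → ℝ) (z : ℝ) :
    gaussFactor σ (x + z • u) k
      = gaussFactor σ x k * Complex.exp ((k ⬝ᵥ u : ℝ) * z * Complex.I) := by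
  rw [gaussFactor, gaussFactor, ← Complex.exp_add, dotProduct_add, dotProduct_smul]
  congr 1
  push_cast
  simp only [smul_eq_mul, Complex.ofReal_mul]
  ring

lemma gaussFactor_add_vecMulVec (σ : Matrix ι ι ℝ) (x u k : ι → ℝ) (c : ℝ) :
    gaussFactor (σ + c • Matrix.vecMulVec u u) x k
      = gaussFactor σ x k * Complex.exp (-(c * (k ⬝ᵥ u) ^ 2 / 4 : ℝ)) := by
  rw [gaussFactor, gaussFactor, ← Complex.exp_add, Matrix.add_mulVec, dotProduct_add,
    Matrix.smul_mulVec, dotProduct_smul, dotProduct_vecMulVec_mulVec, dotProduct_comm u k]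
  congr 1
  simp only [smul_eq_mul]
  push_cast
  ring

/-- The heat flow on Gaussian factors: averaging the first moment over a normal law on a line adds
a rank-one matrix to the covariance. -/
lemma integral_gaussFactor_line (σ : Matrix ι ι ℝ) (x u k : ι → ℝ) (h : ℝ≥0) (ξ : ℝ) :
    ∫ z : ℝ, gaussFactor σ (x + z • u) k ∂(gaussianReal ξ h)
      = gaussFactor (σ + (2 * h : ℝ) • Matrix.vecMulVec u u) (x + ξ • u) k := by
  have hc := charFun_gaussianReal (μ := ξ) (v := h) (k ⬝ᵥ u)
  rw [charFun_apply_real] at hc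
  simp only [gaussFactor_add_smul]
  rw [integral_const_mul, hc, gaussFactor_add_vecMulVec, mul_assoc (gaussFactor σ x k),
    ← Complex.exp_add]
  congr 2
  push_cast
  ring

lemma continuous_gaussFactor_line (σ : Matrix ι ι ℝ) (x u k : ι → ℝ) :
    Continuous fun z : ℝ => gaussFactor σ (x + z • u) k := by
  simp only [gaussFactor_add_smul]
  fun_prop

lemma continuous_integral_gaussFactor {γ : Measure ℝ} [IsProbabilityMeasure γ]
    {A : ℝ → Matrix ι ι ℝ} {B : ℝ → ι → ℝ} (hpsd : ∀ z, (A z).PosSemidef)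
    (hc : ∀ k, Continuous fun z => gaussFactor (A z) (B z) k) :
    Continuous fun k => ∫ z, gaussFactor (A z) (B z) k ∂γ :=
  continuous_of_dominated (bound := fun _ => 1)
    (fun k => (hc k).aestronglyMeasurable)
    (fun _ => Eventually.of_forall fun z => norm_gaussFactor_le_one (hpsd z) _ _)
    (integrable_const _) (Eventually.of_forall fun _ => continuous_gaussFactor _ _)

lemma vecMulVec_form_nonneg {c : ℝ} (hc : 0 ≤ c) (σ : Matrix ι ι ℝ) (u k : ι → ℝ) :
    k ⬝ᵥ (σ *ᵥ k) ≤ k ⬝ᵥ ((σ + c • Matrix.vecMulVec u u) *ᵥ k) := by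
  rw [Matrix.add_mulVec, dotProduct_add, Matrix.smul_mulVec, dotProduct_smul,
    dotProduct_vecMulVec_mulVec, dotProduct_comm u k, smul_eq_mul]
  have : 0 ≤ c * ((k ⬝ᵥ u) * (k ⬝ᵥ u)) := mul_nonneg hc (mul_self_nonneg _)
  linarith

end Dense

/-! ### Bounded operators on `L²` that preserve Gaussian factors -/

section Operator
variable {n : ℕ}

lemma IsGaussianStateWith.memLp {ρ : HS n} {σ : Matrix (Quad n) (Quad n) ℝ} {r : Quad n → ℝ}
    (h : IsGaussianStateWith (ρ : Op n) σ r) : MemLp (gaussFactor σ r) 2 volume := by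
  refine (memLp_congr_ae ?_).1 (Lp.memLp (charLp n ρ))
  filter_upwards [h.1.stateChar_ae_eq] with k hk
  rw [← hk, h.2.2]

lemma IsGaussianStateWith.charLp_eq {ρ : HS n} {σ : Matrix (Quad n) (Quad n) ℝ} {r : Quad n → ℝ}
    (h : IsGaussianStateWith (ρ : Op n) σ r) : charLp n ρ = gaussLp σ r := by
  refine Lp.ext ?_
  filter_upwards [h.1.stateChar_ae_eq, gaussLp_coeFn h.memLp] with k hk hk'
  rw [← hk, h.2.2, hk']

lemma IsQuantumCov.memLp {σ : Matrix (Quad n) (Quad n) ℝ} (h : IsQuantumCov σ) (r : Quad n → ℝ) :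
    MemLp (gaussFactor σ r) 2 volume := by
  obtain ⟨ρ, hρ⟩ := exists_isGaussianStateWith h r
  exact hρ.memLp

/-- The range contains all Gaussian factors of covariance `1`. -/
lemma denseRange_charLp : DenseRange (charLp n) := by
  have h := topologicalClosure_span_gaussLp (isQuantumCov_one (n := n)).posDef.posSemidef
    (isQuantumCov_one.memLp 0)
  have hle : Submodule.span ℂ (Set.range (gaussLp (1 : Matrix (Quad n) (Quad n) ℝ)))
      ≤ LinearMap.range (charLp n) := by
    rw [Submodule.span_le]
    rintro _ ⟨x, rfl⟩
    obtain ⟨ρ, hρ⟩ := exists_isGaussianStateWith (isQuantumCov_one (n := n)) x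
    exact ⟨ρ, hρ.charLp_eq⟩
  have h2 := Submodule.topologicalClosure_mono hle
  rw [h, top_le_iff] at h2
  have := (Submodule.dense_iff_topologicalClosure_eq_top).2 h2
  exact this

lemma isQuantumCov_add_vecMulVec {σ : Matrix (Quad n) (Quad n) ℝ} (h : IsQuantumCov σ) {c : ℝ}
    (hc : 0 ≤ c) (u : Quad n → ℝ) : IsQuantumCov (σ + c • Matrix.vecMulVec u u) := by
  refine h.add (Matrix.PosSemidef.smul ?_ hc)
  have := Matrix.posSemidef_vecMulVec_self_star u
  rwa [star_trivial] at this

lemma continuous_gaussLp_line {σ : Matrix (Quad n) (Quad n) ℝ} (hσ : IsQuantumCov σ)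
    (x u : Quad n → ℝ) : Continuous fun z : ℝ => gaussLp σ (x + z • u) := by
  refine continuous_iff_continuousAt.2 fun z₀ => ?_
  exact tendsto_gaussLp (hσ.memLp _) (fun _ _ => le_rfl) fun k =>
    (continuous_gaussFactor_line σ x u k).tendsto z₀

lemma integrable_gaussLp_line {σ : Matrix (Quad n) (Quad n) ℝ} (hσ : IsQuantumCov σ)
    (x u : Quad n → ℝ) (γ : Measure ℝ) [IsProbabilityMeasure γ] :
    Integrable (fun z : ℝ => gaussLp σ (x + z • u)) γ :=
  Integrable.of_bound (C := ‖gaussLp σ 0‖) (continuous_gaussLp_line hσ x u).aestronglyMeasurable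
    (Eventually.of_forall fun _ => norm_gaussLp_le (hσ.memLp 0) (fun _ => le_rfl) _)

lemma integral_gaussLp_line {σ : Matrix (Quad n) (Quad n) ℝ} (hσ : IsQuantumCov σ)
    (x u : Quad n → ℝ) (h : ℝ≥0) (ξ : ℝ) :
    ∫ z : ℝ, gaussLp σ (x + z • u) ∂(gaussianReal ξ h)
      = gaussLp (σ + (2 * h : ℝ) • Matrix.vecMulVec u u) (x + ξ • u) := by
  refine Lp.ext ?_
  have h1 := integral_gaussLp_ae_eq (γ := gaussianReal ξ h) (A := fun _ => σ)
    (B := fun z => x + z • u) (fun z => hσ.memLp _) (fun _ => hσ.posDef.posSemidef)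
    (continuous_gaussFactor_line σ x u)
    (integrable_gaussLp_line hσ x u _)
  filter_upwards [h1, gaussLp_coeFn ((isQuantumCov_add_vecMulVec hσ
    (by positivity : (0 : ℝ) ≤ 2 * h) u).memLp (x + ξ • u))] with k hk hk'
  rw [hk, hk', integral_gaussFactor_line]

/-- A bounded operator on `L²` that maps Gaussian factors with quantum covariance matrices to
Gaussian factors with quantum covariance matrices acts affinely on the parameters. -/
theorem exists_affine_of_operator {T : Phase n →L[ℂ] Phase n}
    (hT : ∀ σ : Matrix (Quad n) (Quad n) ℝ, IsQuantumCov σ → ∀ x, ∃ σ' y,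
      IsQuantumCov σ' ∧ T (gaussLp σ x) = gaussLp σ' y) :
    ∃ (K α : Matrix (Quad n) (Quad n) ℝ) (y₀ : Quad n → ℝ), α.IsSymm ∧
      ∀ σ : Matrix (Quad n) (Quad n) ℝ, IsQuantumCov σ → ∀ x,
        IsQuantumCov (K * σ * Kᵀ + α) ∧
        T (gaussLp σ x) = gaussLp (K * σ * Kᵀ + α) (K *ᵥ x + y₀) := by
  have hT' : ∀ (σ : Matrix (Quad n) (Quad n) ℝ) (x : Quad n → ℝ), ∃ σ' y,
      IsQuantumCov σ → IsQuantumCov σ' ∧ T (gaussLp σ x) = gaussLp σ' y := by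
    intro σ x
    by_cases h : IsQuantumCov σ
    · obtain ⟨σ', y, h1, h2⟩ := hT σ h x
      exact ⟨σ', y, fun _ => ⟨h1, h2⟩⟩
    · exact ⟨0, 0, fun h' => absurd h' h⟩
  choose S Y hSY using hT'
  have hadd : ∀ σ : Matrix (Quad n) (Quad n) ℝ, IsQuantumCov σ → ∀ c : ℝ, 0 ≤ c → ∀ u,
      IsQuantumCov (σ + c • Matrix.vecMulVec u u) := fun σ hσ c hc u =>
    isQuantumCov_add_vecMulVec hσ hc u
  have hcont : ∀ σ : Matrix (Quad n) (Quad n) ℝ, IsQuantumCov σ → ∀ x u k, Continuous fun ξ : ℝ =>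
      gaussFactor (S σ (x + ξ • u)) (Y σ (x + ξ • u)) k := by
    intro σ hσ x u k
    rw [continuous_iff_seqContinuous]
    intro zs z hz
    refine tendsto_gaussFactor_of_tendsto_gaussLp (fun m => (hSY σ _ hσ).1.memLp _)
      ((hSY σ _ hσ).1.memLp _) ?_ k
    simp only [← (hSY σ _ hσ).2]
    exact (T.continuous.comp (continuous_gaussLp_line hσ x u)).continuousAt.tendsto.comp hz
  obtain ⟨K, α, y₀, hα, h⟩ := exists_affine_of_gaussian_mixture
    (𝒮 := {σ : Matrix (Quad n) (Quad n) ℝ | IsQuantumCov σ}) (S := S) (Y := Y)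
    ⟨1, isQuantumCov_one⟩ (fun σ hσ => IsQuantumCov.posDef hσ |>.posSemidef)
    (fun σ hσ u => by simpa using hadd σ hσ 1 zero_le_one u)
    (fun σ hσ x => (hSY σ x hσ).1.posDef.posSemidef)
    (fun σ hσ x u k h ξ => by
      have hσ' : IsQuantumCov σ := hσ
      have hσ2 := hadd σ hσ (2 * h) (by positivity) u
      have e1 := integral_gaussLp_line hσ' x u h ξ
      have e2 := congrArg T e1
      rw [← ContinuousLinearMap.integral_comp_comm T (integrable_gaussLp_line hσ' x u _),
        (hSY _ _ hσ2).2] at e2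
      simp only [(hSY σ _ hσ').2] at e2
      have e3 := integral_gaussLp_ae_eq (γ := gaussianReal ξ h)
        (fun z => (hSY σ (x + z • u) hσ').1.memLp _)
        (fun z => (hSY σ (x + z • u) hσ').1.posDef.posSemidef) (hcont σ hσ' x u) (by
          have := T.integrable_comp (integrable_gaussLp_line hσ' x u (gaussianReal ξ h))
          simpa only [(hSY σ _ hσ').2] using this)
      rw [e2] at e3
      have e4 := (gaussLp_coeFn ((hSY _ (x + ξ • u) hσ2).1.memLp _)).symm.trans e3
      have e5 := ((continuous_gaussFactor _ _).ae_eq_iff_eq volume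
        (continuous_integral_gaussFactor (fun z => (hSY σ (x + z • u) hσ').1.posDef.posSemidef)
          (hcont σ hσ' x u))).1 e4
      exact (congrFun e5 k).symm)
    hcont
    (fun σ hσ x u k => by
      have hσ' : IsQuantumCov σ := hσ
      have hσ2 : ∀ m : ℕ, IsQuantumCov
          (σ + (2 * (1 / ((m : ℝ) + 1))) • Matrix.vecMulVec u u) := fun m =>
        hadd σ hσ _ (by positivity) u
      refine tendsto_gaussFactor_of_tendsto_gaussLp (fun m => (hSY _ _ (hσ2 m)).1.memLp _)
        ((hSY σ _ hσ').1.memLp _) ?_ k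
      simp only [← (hSY σ _ hσ').2, ← (hSY _ _ (hσ2 _)).2]
      refine (T.continuous.tendsto _).comp ?_
      refine tendsto_gaussLp (hσ'.memLp _) (fun m k => vecMulVec_form_nonneg (by positivity) _ _ _)
        fun k => ?_
      have hc : Continuous fun s : ℝ =>
          gaussFactor (σ + (2 * s) • Matrix.vecMulVec u u) x k := by
        simp only [gaussFactor_add_vecMulVec]
        fun_prop
      have h0 := (hc.tendsto 0).comp (tendsto_one_div_add_atTop_nhds_zero_nat (𝕜 := ℝ))
      simpa [Function.comp_def] using h0)
  refine ⟨K, α, y₀, hα, fun σ hσ x => ?_⟩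
  obtain ⟨h1, h2⟩ := h σ hσ x
  rw [← h1, ← h2]
  exact hSY σ x hσ

end Operator

section Consequences
variable {n : ℕ}

lemma ae_dotProduct_ne_zero {ι : Type*} [Fintype ι] [DecidableEq ι] {u : ι → ℝ} (hu : u ≠ 0) :
    ∀ᵐ k : ι → ℝ, k ⬝ᵥ u ≠ 0 := by
  let L : (ι → ℝ) →ₗ[ℝ] ℝ :=
    { toFun := fun k => k ⬝ᵥ u
      map_add' := fun a b => add_dotProduct a b u
      map_smul' := fun c a => smul_dotProduct c a u }
  have hLk : ∀ k, L k = k ⬝ᵥ u := fun k => rfl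
  have hne : LinearMap.ker L ≠ ⊤ := by
    intro h
    have h1 : L u = 0 := by
      rw [← LinearMap.mem_ker, h]; trivial
    rw [hLk] at h1
    exact hu (dotProduct_self_eq_zero.1 h1)
  have h0 := Measure.addHaar_submodule (volume : Measure (ι → ℝ)) (LinearMap.ker L) hne
  rw [ae_iff]
  refine measure_mono_null (fun k hk => ?_) h0
  simpa [hLk] using hk

/-- Adding noise in one direction with growing strength makes Gaussian factors vanish in `L²`. -/
lemma tendsto_gaussLp_add_vecMulVec {u : Quad n → ℝ} (hu : u ≠ 0) :
    Tendsto (fun m : ℕ => gaussLp (1 + (m : ℝ) • Matrix.vecMulVec u u) (0 : Quad n → ℝ))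
      atTop (𝓝 0) := by
  have hq : ∀ m : ℕ, IsQuantumCov (1 + (m : ℝ) • Matrix.vecMulVec u u) := fun m =>
    isQuantumCov_add_vecMulVec isQuantumCov_one (by positivity) u
  have h1 := (isQuantumCov_one (n := n)).memLp 0
  have hlim := tendsto_eLpNorm_two_of_dominated (l := atTop) (μ := volume)
    (F := fun m : ℕ => gaussFactor (1 + (m : ℝ) • Matrix.vecMulVec u u) (0 : Quad n → ℝ))
    (f := 0) (b := fun k => ‖gaussFactor 1 (0 : Quad n → ℝ) k‖)
    (fun m => ((hq m).memLp 0).1) aestronglyMeasurable_zero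
    (fun m => Eventually.of_forall fun k => by
      rw [Pi.zero_apply, sub_zero]
      exact norm_gaussFactor_le_of_le
        (fun k => vecMulVec_form_nonneg (by positivity) _ _ _) _ _ _) h1.norm (by
      filter_upwards [ae_dotProduct_ne_zero hu] with k hk
      simp only [gaussFactor_add_vecMulVec, Pi.zero_apply]
      rw [← mul_zero (gaussFactor 1 (0 : Quad n → ℝ) k)]
      refine tendsto_const_nhds.mul ?_
      have hpos : 0 < (k ⬝ᵥ u) ^ 2 / 4 := by positivity
      have h2 : Tendsto (fun m : ℕ => Real.exp (-((m : ℝ) * (k ⬝ᵥ u) ^ 2 / 4))) atTop (𝓝 0) := by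
        refine Real.tendsto_exp_neg_atTop_nhds_zero.comp ?_
        simp only [mul_div_assoc]
        exact tendsto_natCast_atTop_atTop.atTop_mul_const hpos
      have h3 := (Complex.continuous_ofReal.tendsto _).comp h2
      refine (h3.congr fun m => ?_)
      simp)
  rw [tendsto_iff_edist_tendsto_0]
  refine hlim.congr fun m => ?_
  rw [Lp.edist_def]
  exact eLpNorm_congr_ae ((gaussLp_coeFn ((hq m).memLp 0)).sub (Lp.coeFn_zero ℂ 2 _)).symm

lemma vecMulVec_mulVec_mulVec {ι : Type*} [Fintype ι] (K : Matrix ι ι ℝ) (u : ι → ℝ) :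
    K * Matrix.vecMulVec u u * Kᵀ = Matrix.vecMulVec (K *ᵥ u) (K *ᵥ u) := by
  rw [Matrix.mul_vecMulVec, Matrix.vecMulVec_mul, Matrix.vecMul_transpose]

/-- If `K u = 0`, the operator cannot see the noise added in the direction `u`, although this
noise makes its argument vanish. -/
lemma det_ne_zero_of_operator {T : Phase n →L[ℂ] Phase n} {K α : Matrix (Quad n) (Quad n) ℝ}
    {y₀ : Quad n → ℝ} (h : ∀ σ : Matrix (Quad n) (Quad n) ℝ, IsQuantumCov σ → ∀ x,
      IsQuantumCov (K * σ * Kᵀ + α) ∧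
        T (gaussLp σ x) = gaussLp (K * σ * Kᵀ + α) (K *ᵥ x + y₀)) : K.det ≠ 0 := by
  intro hdet
  obtain ⟨u, hu, hKu⟩ := Matrix.exists_mulVec_eq_zero_iff.2 hdet
  have h1 := (T.continuous.tendsto 0).comp (tendsto_gaussLp_add_vecMulVec hu)
  rw [_root_.map_zero] at h1
  have h2 : ∀ m : ℕ, T (gaussLp (1 + (m : ℝ) • Matrix.vecMulVec u u) 0)
      = gaussLp (K * 1 * Kᵀ + α) (K *ᵥ 0 + y₀) := by
    intro m
    rw [(h _ (isQuantumCov_add_vecMulVec isQuantumCov_one (by positivity) u) 0).2, Matrix.mul_add,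
      Matrix.add_mul, Matrix.mul_smul, Matrix.smul_mul, vecMulVec_mulVec_mulVec, hKu]
    simp
  have h3 : (T ∘ fun m : ℕ => gaussLp (1 + (m : ℝ) • Matrix.vecMulVec u u) (0 : Quad n → ℝ))
      = fun _ => gaussLp (K * 1 * Kᵀ + α) (K *ᵥ 0 + y₀) := funext h2
  rw [h3] at h1
  exact gaussLp_ne_zero ((h 1 isQuantumCov_one 0).1.memLp _)
    (tendsto_nhds_unique tendsto_const_nhds h1)

/-- The noise matrix is positive semidefinite, because quantum covariance matrices can be squeezed
in any direction. -/
lemma posSemidef_of_isQuantumCov {K α : Matrix (Quad n) (Quad n) ℝ} (hα : α.IsSymm)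
    (h : ∀ σ : Matrix (Quad n) (Quad n) ℝ, IsQuantumCov σ → IsQuantumCov (K * σ * Kᵀ + α)) :
    α.PosSemidef := by
  refine posSemidef_iff_real.2 ⟨hα, fun k => ?_⟩
  refine le_of_forall_pos_le_add fun ε hε => ?_
  have hc : 0 < (k ᵥ* K) ⬝ᵥ (k ᵥ* K) + 1 := by
    linarith [dotProduct_self_nonneg_real (k ᵥ* K)]
  obtain ⟨σ, hσ, hle⟩ := exists_isQuantumCov_le (k ᵥ* K) (div_pos hε hc)
  have h1 := (posSemidef_iff_real.1 (h σ hσ).posDef.posSemidef).2 k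
  rw [Matrix.add_mulVec, dotProduct_add, dotProduct_conj_mulVec] at h1
  have h2 : ε / ((k ᵥ* K) ⬝ᵥ (k ᵥ* K) + 1) * ((k ᵥ* K) ⬝ᵥ (k ᵥ* K)) ≤ ε := by
    rw [div_mul_eq_mul_div, div_le_iff₀ hc]
    nlinarith
  linarith

lemma gaussFactor_affine {ι : Type*} [Fintype ι] (K α σ : Matrix ι ι ℝ) (x y₀ k : ι → ℝ) :
    gaussFactor (K * σ * Kᵀ + α) (K *ᵥ x + y₀) k
      = gaussFactor σ x (k ᵥ* K) * gaussFactor α y₀ k := by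
  rw [gaussFactor, gaussFactor, gaussFactor, ← Complex.exp_add, Matrix.add_mulVec, dotProduct_add,
    dotProduct_add, dotProduct_conj_mulVec, Matrix.dotProduct_mulVec k K x]
  congr 1
  push_cast
  ring

lemma quasiMeasurePreserving_vecMul {ι : Type*} [Fintype ι] [DecidableEq ι] {K : Matrix ι ι ℝ}
    (hK : K.det ≠ 0) : Measure.QuasiMeasurePreserving (fun k : ι → ℝ => k ᵥ* K) := by
  have h : LinearMap.det (Matrix.toLin' Kᵀ) ≠ 0 := by
    rwa [LinearMap.det_toLin', Matrix.det_transpose]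
  have e : (fun k : ι → ℝ => k ᵥ* K) = Matrix.toLin' Kᵀ := by
    funext k
    rw [Matrix.toLin'_apply, Matrix.mulVec_transpose]
  rw [e]
  refine ⟨(LinearMap.continuous_of_finiteDimensional _).measurable, ?_⟩
  rw [Measure.map_linearMap_addHaar_eq_smul_addHaar volume h]
  exact Measure.smul_absolutelyContinuous

/-- The action on Gaussian factors determines the operator. -/
lemma operator_ae_eq {T : Phase n →L[ℂ] Phase n} {K α : Matrix (Quad n) (Quad n) ℝ}
    {y₀ : Quad n → ℝ} (h : ∀ σ : Matrix (Quad n) (Quad n) ℝ, IsQuantumCov σ → ∀ x,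
      IsQuantumCov (K * σ * Kᵀ + α) ∧
        T (gaussLp σ x) = gaussLp (K * σ * Kᵀ + α) (K *ᵥ x + y₀)) (f : Phase n) :
    T f =ᵐ[volume] fun k => f (k ᵥ* K) * gaussFactor α y₀ k := by
  have hqmp := quasiMeasurePreserving_vecMul (det_ne_zero_of_operator h)
  have hspan : ∀ f ∈ Submodule.span ℂ (Set.range (gaussLp (1 : Matrix (Quad n) (Quad n) ℝ))),
      T f =ᵐ[volume] fun k => f (k ᵥ* K) * gaussFactor α y₀ k := by
    intro f hf
    induction hf using Submodule.span_induction with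
    | mem f hf =>
      obtain ⟨x, rfl⟩ := hf
      obtain ⟨h1, h2⟩ := h 1 isQuantumCov_one x
      rw [h2]
      filter_upwards [gaussLp_coeFn (h1.memLp (K *ᵥ x + y₀)),
        hqmp.ae (gaussLp_coeFn (isQuantumCov_one.memLp x))] with k hk hk'
      rw [hk, hk', gaussFactor_affine]
    | zero =>
      rw [_root_.map_zero]
      filter_upwards [Lp.coeFn_zero ℂ 2 (volume : Measure (Quad n → ℝ)),
        hqmp.ae (Lp.coeFn_zero ℂ 2 (volume : Measure (Quad n → ℝ)))] with k hk hk'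
      rw [hk, hk']
      simp
    | add f g _ _ hf hg =>
      rw [_root_.map_add]
      filter_upwards [hf, hg, Lp.coeFn_add (T f) (T g), hqmp.ae (Lp.coeFn_add f g)]
        with k h1 h2 h3 h4
      rw [h3, h4, Pi.add_apply, Pi.add_apply, h1, h2, add_mul]
    | smul c f _ hf =>
      rw [_root_.map_smul]
      filter_upwards [hf, Lp.coeFn_smul c (T f), hqmp.ae (Lp.coeFn_smul c f)] with k h1 h2 h3
      rw [h2, h3, Pi.smul_apply, Pi.smul_apply, h1, smul_eq_mul, smul_eq_mul, mul_assoc]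
  have hmem : f ∈ (Submodule.span ℂ
      (Set.range (gaussLp (1 : Matrix (Quad n) (Quad n) ℝ)))).topologicalClosure := by
    rw [topologicalClosure_span_gaussLp isQuantumCov_one.posDef.posSemidef
      (isQuantumCov_one.memLp 0)]
    trivial
  obtain ⟨F, hF, hlim⟩ := mem_closure_iff_seq_limit.1 hmem
  have hae : ∀ {G : ℕ → Phase n} {g : Phase n}, Tendsto G atTop (𝓝 g) →
      TendstoInMeasure volume (fun m => (G m : (Quad n → ℝ) → ℂ)) atTop g := by
    intro G g hG
    rw [Lp.tendsto_Lp_iff_tendsto_eLpNorm'] at hG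
    exact tendstoInMeasure_of_tendsto_eLpNorm_of_ne_top two_ne_zero ENNReal.ofNat_ne_top
      (fun s => Lp.aestronglyMeasurable _) (Lp.aestronglyMeasurable _) hG
  obtain ⟨ns, hns, hae1⟩ := (hae hlim).exists_seq_tendsto_ae
  have hTlim : Tendsto (fun m => T (F (ns m))) atTop (𝓝 (T f)) :=
    (T.continuous.tendsto f).comp (hlim.comp hns.tendsto_atTop)
  obtain ⟨ms, hms, hae2⟩ := (hae hTlim).exists_seq_tendsto_ae
  filter_upwards [hqmp.ae hae1, hae2, ae_all_iff.2 fun m => hspan (F (ns (ms m))) (hF _)]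
    with k h1 h2 h3
  simp only [h3] at h2
  exact tendsto_nhds_unique h2 ((h1.comp hms.tendsto_atTop).mul_const _)

end Consequences

/-! ### Moments of convolutions with normal laws -/

section Moments

/-- Adding an independent normal variable adds means and variances. -/
lemma exists_conv_gaussianReal {μ : Measure ℝ} [IsProbabilityMeasure μ]
    (h2 : MemLp (fun x : ℝ => x) 2 μ) (m : ℝ) (v : ℝ≥0) :
    ∃ ν : Measure ℝ, IsProbabilityMeasure ν ∧
      (∀ t, charFun ν t = charFun μ t * charFun (gaussianReal m v) t) ∧
      MemLp (fun x : ℝ => x) 2 ν ∧ ∫ x, x ∂ν = ∫ x, x ∂μ + m ∧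
      Var[fun x : ℝ => x; ν] = Var[fun x : ℝ => x; μ] + v := by
  set γ := gaussianReal m v
  have hγ2 : MemLp (fun x : ℝ => x) 2 γ := memLp_id_gaussianReal 2
  have hX : MemLp (fun p : ℝ × ℝ => p.1) 2 (μ.prod γ) :=
    h2.comp_measurePreserving measurePreserving_fst
  have hY : MemLp (fun p : ℝ × ℝ => p.2) 2 (μ.prod γ) :=
    hγ2.comp_measurePreserving measurePreserving_snd
  have hm : AEMeasurable (fun p : ℝ × ℝ => p.1 + p.2) (μ.prod γ) := by fun_prop
  have e1 : ∫ p : ℝ × ℝ, p.1 ∂(μ.prod γ) = ∫ x, x ∂μ := by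
    have := integral_fun_fst (μ := μ) (ν := γ) (fun x : ℝ => x)
    simpa using this
  have e2 : ∫ p : ℝ × ℝ, p.2 ∂(μ.prod γ) = m := by
    have := integral_fun_snd (μ := μ) (ν := γ) (fun x : ℝ => x)
    simpa [γ, integral_id_gaussianReal] using this
  refine ⟨μ ∗ γ, inferInstance, fun t => charFun_conv t, ?_, ?_, ?_⟩
  · rw [Measure.conv, memLp_map_measure_iff (by fun_prop) hm]
    exact hX.add hY
  · rw [Measure.conv, integral_map hm (by fun_prop),
      MeasureTheory.integral_add (hX.integrable one_le_two) (hY.integrable one_le_two), e1, e2]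
  · rw [Measure.conv, variance_map (by fun_prop) hm]
    refine (variance_add_prod h2 hγ2).trans ?_
    rw [variance_fun_id_gaussianReal]

lemma charFun_gaussianReal_eq_gaussFactor {ι : Type*} [Fintype ι] {α : Matrix ι ι ℝ}
    (hα : α.PosSemidef) (y k : ι → ℝ) (t : ℝ) :
    charFun (gaussianReal (k ⬝ᵥ y) (k ⬝ᵥ (α *ᵥ k) / 2).toNNReal) t = gaussFactor α y (t • k) := by
  have h0 : 0 ≤ k ⬝ᵥ (α *ᵥ k) / 2 := by
    have := (posSemidef_iff_real.1 hα).2 k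
    linarith
  rw [charFun_gaussianReal, gaussFactor_smul, normalChar, Real.coe_toNNReal _ h0]

/-- The distribution of `k R̂` is convolved with a normal law, and `k` is replaced by `k K`. -/
lemma HasMoments.affine {n : ℕ} {χ : (Quad n → ℝ) → ℂ} {r : Quad n → ℝ}
    {σ : Matrix (Quad n) (Quad n) ℝ} (h : HasMoments χ r σ) {K α : Matrix (Quad n) (Quad n) ℝ}
    (hα : α.PosSemidef) (y₀ : Quad n → ℝ) :
    HasMoments (fun k => χ (k ᵥ* K) * gaussFactor α y₀ k) (K *ᵥ r + y₀) (K * σ * Kᵀ + α) := by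
  refine ⟨?_, fun k => ?_⟩
  · refine Matrix.IsSymm.add ?_ (posSemidef_iff_real.1 hα).1
    rw [Matrix.IsSymm, Matrix.transpose_mul, Matrix.transpose_mul, h.1, Matrix.transpose_transpose,
      Matrix.mul_assoc]
  · obtain ⟨μ, hμ, h1, h2, h3, h4⟩ := h.2 (k ᵥ* K)
    have h0 : 0 ≤ k ⬝ᵥ (α *ᵥ k) / 2 := by
      have := (posSemidef_iff_real.1 hα).2 k
      linarith
    obtain ⟨ν, hν, hc, hm, he, hv⟩ :=
      exists_conv_gaussianReal h2 (k ⬝ᵥ y₀) (k ⬝ᵥ (α *ᵥ k) / 2).toNNReal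
    refine ⟨ν, hν, fun t => ?_, hm, ?_, ?_⟩
    · rw [hc, h1, charFun_gaussianReal_eq_gaussFactor hα]
      simp only [Matrix.smul_vecMul]
    · rw [he, h3, dotProduct_add, Matrix.dotProduct_mulVec]
    · rw [hv, mul_add, h4, Real.coe_toNNReal _ h0, Matrix.add_mulVec, dotProduct_add,
        dotProduct_conj_mulVec]
      ring

end Moments

/-! ### Maps of Hilbert–Schmidt operators that preserve Gaussian states -/

/-- Through the characteristic function, `Φ` becomes a bounded operator on `L²` of the phase space
that preserves Gaussian factors. -/
theorem quantum_gaussian_maps (n : ℕ) (Φ : HS n →ₗ[ℂ] HS n)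
    (hb : ∃ C : ℝ, ∀ X, hsNorm (Φ X) ≤ C * hsNorm X)
    (hΦ : ∀ ρ : HS n, IsGaussianState (ρ : Op n) → IsGaussianState (Φ ρ : Op n)) :
    ∃ (K α : Matrix (Quad n) (Quad n) ℝ) (y₀ : Quad n → ℝ),
      α.IsSymm ∧ K.det ≠ 0 ∧
      (∀ X : HS n, (∃ f, HasCharFun X f) ∧ ∀ f, HasCharFun X f →
        HasCharFun (Φ X) (fun k => f (k ᵥ* K) * gaussFactor α y₀ k)) ∧
      (∀ (ρ : HS n) (σ : Matrix (Quad n) (Quad n) ℝ) (r : Quad n → ℝ),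
        IsGaussianStateWith (ρ : Op n) σ r →
          IsGaussianStateWith (Φ ρ : Op n) (K * σ * Kᵀ + α) (K *ᵥ r + y₀)) ∧
      (∀ (ρ : HS n) (r : Quad n → ℝ) (σ : Matrix (Quad n) (Quad n) ℝ),
        IsDensity (ρ : Op n) → HasMoments (stateChar (ρ : Op n)) r σ →
          (∃ χ, Continuous χ ∧ HasCharFun (Φ ρ) χ ∧
            HasMoments χ (K *ᵥ r + y₀) (K * σ * Kᵀ + α)) ∧
          (IsDensity (Φ ρ : Op n) →
            HasMoments (stateChar (Φ ρ : Op n)) (K *ᵥ r + y₀) (K * σ * Kᵀ + α))) ∧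
      (∀ σ : Matrix (Quad n) (Quad n) ℝ, IsQuantumCov σ → IsQuantumCov (K * σ * Kᵀ + α)) := by
  obtain ⟨C, hC⟩ := hb
  set T : Phase n →L[ℂ] Phase n := (charLp n ∘ₗ Φ).extendOfNorm (charLp n)
  have hT : ∀ X, T (charLp n X) = charLp n (Φ X) := fun X =>
    LinearMap.extendOfNorm_eq denseRange_charLp ⟨C, fun X => by
      rw [LinearMap.comp_apply, norm_charLp, norm_charLp, mul_left_comm]
      exact mul_le_mul_of_nonneg_left (hC X) (Real.sqrt_nonneg _)⟩ X
  obtain ⟨K, α, y₀, hα, h⟩ := exists_affine_of_operator (T := T) fun σ hσ x => by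
    obtain ⟨ρ, hρ⟩ := exists_isGaussianStateWith hσ x
    obtain ⟨σ', y, h'⟩ := hΦ ρ ⟨σ, x, hρ⟩
    exact ⟨σ', y, h'.2.1, by rw [← hρ.charLp_eq, hT, h'.charLp_eq]⟩
  have hK := det_ne_zero_of_operator h
  have hqc : ∀ σ : Matrix (Quad n) (Quad n) ℝ, IsQuantumCov σ → IsQuantumCov (K * σ * Kᵀ + α) :=
    fun σ hσ => (h σ hσ 0).1
  have hpsd := posSemidef_of_isQuantumCov hα hqc
  have hchar : ∀ X : HS n, ∀ f, HasCharFun X f →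
      HasCharFun (Φ X) (fun k => f (k ᵥ* K) * gaussFactor α y₀ k) := by
    intro X f hf
    rw [hasCharFun_iff] at hf ⊢
    rw [← hT]
    filter_upwards [operator_ae_eq h (charLp n X), (quasiMeasurePreserving_vecMul hK).ae hf]
      with k h1 h2
    rw [h1, h2]
  refine ⟨K, α, y₀, hα, hK, fun X => ⟨⟨charLp n X, (hasCharFun_iff X _).2 (by rfl)⟩, hchar X⟩,
    fun ρ σ r hρ => ?_, fun ρ r σ hρ hm => ?_, hqc⟩
  · obtain ⟨σ', y, h'⟩ := hΦ ρ ⟨σ, r, hρ⟩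
    obtain ⟨h1, h2⟩ := h σ hρ.2.1 r
    refine ⟨h'.1, h1, fun k => ?_⟩
    rw [h'.2.2]
    refine congrFun (gaussFactor_eq_of_gaussLp_eq h'.memLp (h1.memLp _) ?_) k
    rw [← h'.charLp_eq, ← hT, hρ.charLp_eq, h2]
  · have hcont : Continuous fun k => stateChar (ρ : Op n) (k ᵥ* K) * gaussFactor α y₀ k := by
      refine (hρ.continuous_stateChar.comp ?_).mul (continuous_gaussFactor α y₀)
      fun_prop
    have hcf := hchar ρ _ ((hasCharFun_iff ρ _).2 hρ.stateChar_ae_eq)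
    have hmom := hm.affine (K := K) hpsd y₀
    refine ⟨⟨_, hcont, hcf, hmom⟩, fun hd => ?_⟩
    have e : stateChar (Φ ρ : Op n)
        = fun k => stateChar (ρ : Op n) (k ᵥ* K) * gaussFactor α y₀ k :=
      (hd.continuous_stateChar.ae_eq_iff_eq volume hcont).1
        (hd.stateChar_ae_eq.trans ((hasCharFun_iff _ _).1 hcf).symm)
    rw [e]
    exact hmom

/-! ### Fourier transforms of finite measures and of finite signed measures -/

lemma continuous_exp_dotProduct {ι : Type*} [Fintype ι] (k : ι → ℝ) :
    Continuous fun x : ι → ℝ => Complex.exp (((k ⬝ᵥ x : ℝ) : ℂ) * Complex.I) := by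
  unfold dotProduct
  fun_prop

lemma integrable_exp_dotProduct {ι : Type*} [Fintype ι] (μ : Measure (ι → ℝ)) [IsFiniteMeasure μ]
    (k : ι → ℝ) :
    MeasureTheory.Integrable (fun x : ι → ℝ => Complex.exp (((k ⬝ᵥ x : ℝ) : ℂ) * Complex.I)) μ :=
  .of_bound (continuous_exp_dotProduct k).aestronglyMeasurable 1
    (Eventually.of_forall fun _ => (Complex.norm_exp_ofReal_mul_I _).le)

lemma strongDual_apply_eq_dotProduct {ι : Type*} [Fintype ι] [DecidableEq ι]
    (L : StrongDual ℝ (ι → ℝ)) (x : ι → ℝ) : L x = (fun i => L (Pi.single i 1)) ⬝ᵥ x := by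
  conv_lhs => rw [pi_eq_sum_univ' x]
  simp [dotProduct, mul_comm]

/-- A finite measure on `ℝ^ι` is determined by its Fourier transform. -/
lemma ext_of_integral_exp_eq {ι : Type*} [Fintype ι] {μ ν : Measure (ι → ℝ)}
    [IsFiniteMeasure μ] [IsFiniteMeasure ν]
    (h : ∀ k : ι → ℝ, ∫ x, Complex.exp (((k ⬝ᵥ x : ℝ) : ℂ) * Complex.I) ∂μ
      = ∫ x, Complex.exp (((k ⬝ᵥ x : ℝ) : ℂ) * Complex.I) ∂ν) : μ = ν := by
  classical
  refine Measure.ext_of_charFunDual (funext fun L => ?_)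
  rw [charFunDual_apply, charFunDual_apply]
  have hL := strongDual_apply_eq_dotProduct L
  generalize (fun i => L (Pi.single i 1)) = k at hL
  simp only [hL]
  exact h k

/-- Every Gaussian measure on `ℝ^ι`, degenerate or not, has a Fourier transform of the form
`exp (- k S kᵀ / 4 + i k y)` with `S ≥ 0`. -/
lemma exists_gaussFactor_of_isGaussian {ι : Type*} [Fintype ι] (ν : Measure (ι → ℝ))
    [IsGaussian ν] : ∃ (S : Matrix ι ι ℝ) (y : ι → ℝ), S.PosSemidef ∧
      ∀ k : ι → ℝ, ∫ z, Complex.exp (((k ⬝ᵥ z : ℝ) : ℂ) * Complex.I) ∂ν = gaussFactor S y k := by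
  classical
  set B := covarianceBilinDual ν
  set e : (ι → ℝ) → StrongDual ℝ (ι → ℝ) := fun k => ∑ i, k i • ContinuousLinearMap.proj i
  have he : ∀ k z, e k z = k ⬝ᵥ z := fun k z => by
    simp [e, dotProduct, sum_apply]
  have hB : ∀ k, k ⬝ᵥ ((Matrix.of fun i j => 2 * B (.proj i) (.proj j)) *ᵥ k)
      = 2 * B (e k) (e k) := fun k => by
    simp only [e, map_sum, _root_.map_smul, sum_apply, smul_apply, dotProduct, Matrix.mulVec,
      Matrix.of_apply, smul_eq_mul, Finset.mul_sum]
    rw [Finset.sum_comm]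
    refine Finset.sum_congr rfl fun i _ => Finset.sum_congr rfl fun j _ => by ring
  refine ⟨Matrix.of fun i j => 2 * B (.proj i) (.proj j), ∫ x, id x ∂ν,
    posSemidef_iff_real.2 ⟨?_, fun k => ?_⟩, fun k => ?_⟩
  · ext i j
    simp [B, covarianceBilinDual_comm (ContinuousLinearMap.proj (R := ℝ) (φ := fun _ : ι => ℝ) i)]
  · rw [hB]
    exact mul_nonneg zero_le_two (covarianceBilinDual_self_nonneg _)
  · have h := IsGaussian.charFunDual_eq' (μ := ν) (e k)
    rw [charFunDual_apply] at h
    simp only [he] at h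
    rw [h, gaussFactor, hB]
    congr 1
    push_cast [B]
    ring

lemma integral_eq_posPart_sub_negPart {X E : Type*} [MeasurableSpace X] [NormedAddCommGroup E]
    [NormedSpace ℝ E] (μ : SignedMeasure X) {f : X → E}
    (hp : MeasureTheory.Integrable f μ.toJordanDecomposition.posPart)
    (hn : MeasureTheory.Integrable f μ.toJordanDecomposition.negPart) :
    ∫ᵛ x, f x ∂<•μ = ∫ x, f x ∂μ.toJordanDecomposition.posPart
      - ∫ x, f x ∂μ.toJordanDecomposition.negPart := by
  conv_lhs => rw [← μ.toSignedMeasure_toJordanDecomposition]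
  rw [JordanDecomposition.toSignedMeasure, integral_sub_vectorMeasure, integral_toSignedMeasure,
    integral_toSignedMeasure]
  · rwa [VectorMeasure.Integrable, Measure.variation_toSignedMeasure]
  · rwa [VectorMeasure.Integrable, Measure.variation_toSignedMeasure]

lemma integral_ofReal_add_ofReal_mul_I {X : Type*} [MeasurableSpace X] [TopologicalSpace X]
    [OpensMeasurableSpace X]
    (μ : SignedMeasure X) (f g : BoundedContinuousFunction X ℝ) :
    ∫ᵛ x, ((f x : ℂ) + (g x : ℂ) * Complex.I) ∂<•μ
      = ((∫ᵛ x, f x ∂<•μ : ℝ) : ℂ) + ((∫ᵛ x, g x ∂<•μ : ℝ) : ℂ) * Complex.I := by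
  have hf : ∀ (h : BoundedContinuousFunction X ℝ) (ν : Measure X) [IsFiniteMeasure ν],
      MeasureTheory.Integrable h ν := fun h ν _ => h.integrable ν
  have key : ∀ (ν : Measure X) [IsFiniteMeasure ν],
      MeasureTheory.Integrable (fun x => (f x : ℂ) + (g x : ℂ) * Complex.I) ν ∧
      ∫ x, ((f x : ℂ) + (g x : ℂ) * Complex.I) ∂ν
        = ((∫ x, f x ∂ν : ℝ) : ℂ) + ((∫ x, g x ∂ν : ℝ) : ℂ) * Complex.I := fun ν _ => by
    have h1 : MeasureTheory.Integrable (fun x => (f x : ℂ)) ν := (hf f ν).ofReal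
    have h2 : MeasureTheory.Integrable (fun x => (g x : ℂ) * Complex.I) ν :=
      (hf g ν).ofReal.mul_const _
    exact ⟨h1.add h2, by
      rw [MeasureTheory.integral_add h1 h2, integral_mul_const, integral_complex_ofReal,
        integral_complex_ofReal]⟩
  rw [integral_eq_posPart_sub_negPart μ (key _).1 (key _).1,
    integral_eq_posPart_sub_negPart μ (hf f _) (hf f _),
    integral_eq_posPart_sub_negPart μ (hf g _) (hf g _), (key _).2, (key _).2]
  push_cast
  ring

lemma signedCharFun_eq_sub {n : ℕ} (μ : SignedMeasure (Fin n → ℝ)) (k : Fin n → ℝ) :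
    signedCharFun μ k
      = ∫ x, Complex.exp (((k ⬝ᵥ x : ℝ) : ℂ) * Complex.I) ∂μ.toJordanDecomposition.posPart
        - ∫ x, Complex.exp (((k ⬝ᵥ x : ℝ) : ℂ) * Complex.I) ∂μ.toJordanDecomposition.negPart :=
  integral_eq_posPart_sub_negPart μ (integrable_exp_dotProduct _ k) (integrable_exp_dotProduct _ k)

/-- The Fourier transform at zero is the total mass. -/
lemma signedCharFun_zero {n : ℕ} (μ : SignedMeasure (Fin n → ℝ)) :
    signedCharFun μ 0 = (μ Set.univ : ℂ) := by
  rw [signedCharFun_eq_sub, μ.apply_eq_posPart_real_sub_negPart_real .univ]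
  simp [Measure.real]

/-- A finite signed measure whose Fourier transform is that of a positive finite measure is that
measure. -/
lemma eq_toSignedMeasure_of_signedCharFun_eq {n : ℕ} {μ : SignedMeasure (Fin n → ℝ)}
    {ν : Measure (Fin n → ℝ)} [IsFiniteMeasure ν]
    (h : ∀ k, signedCharFun μ k = ∫ x, Complex.exp (((k ⬝ᵥ x : ℝ) : ℂ) * Complex.I) ∂ν) :
    μ = ν.toSignedMeasure := by
  have hj : μ.toJordanDecomposition.posPart = ν + μ.toJordanDecomposition.negPart := by
    refine ext_of_integral_exp_eq fun k => ?_
    rw [integral_add_measure (integrable_exp_dotProduct _ k) (integrable_exp_dotProduct _ k),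
      ← h, signedCharFun_eq_sub, sub_add_cancel]
  rw [← μ.toSignedMeasure_toJordanDecomposition, JordanDecomposition.toSignedMeasure,
    Measure.toSignedMeasure_congr hj, Measure.toSignedMeasure_add, add_sub_cancel_right]

/-- By the Feller property the Fourier transform of `Φ μ` at `k` is the integral against `μ` of a
bounded continuous function `c`. -/
lemma IsFeller.exists_signedCharFun {n : ℕ}
    {Φ : SignedMeasure (Fin n → ℝ) →ₗ[ℝ] SignedMeasure (Fin n → ℝ)} (hΦ : IsFeller Φ)
    (k : Fin n → ℝ) : ∃ c : (Fin n → ℝ) → ℂ, Continuous c ∧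
      ∀ μ : SignedMeasure (Fin n → ℝ), signedCharFun (Φ μ) k = ∫ᵛ x, c x ∂<•μ := by
  have hc : Continuous fun x : Fin n → ℝ => k ⬝ᵥ x := by unfold dotProduct; fun_prop
  obtain ⟨f, hf⟩ := hΦ (BoundedContinuousFunction.ofNormedAddCommGroup
    (fun x => Real.cos (k ⬝ᵥ x)) (Real.continuous_cos.comp hc) 1
    fun x => Real.abs_cos_le_one _)
  obtain ⟨g, hg⟩ := hΦ (BoundedContinuousFunction.ofNormedAddCommGroup
    (fun x => Real.sin (k ⬝ᵥ x)) (Real.continuous_sin.comp hc) 1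
    fun x => Real.abs_sin_le_one _)
  refine ⟨fun x => (f x : ℂ) + (g x : ℂ) * Complex.I, by fun_prop, fun μ => ?_⟩
  rw [integral_ofReal_add_ofReal_mul_I, ← hf, ← hg, ← integral_ofReal_add_ofReal_mul_I]
  simp only [signedCharFun, BoundedContinuousFunction.coe_ofNormedAddCommGroup,
    Complex.exp_mul_I, Complex.ofReal_cos, Complex.ofReal_sin]

/-! ### The heat flow on Gaussian averages of a bounded continuous function -/

section GaussianAverage

variable {ι : Type*} [Fintype ι] [DecidableEq ι]

lemma gaussMeasure_add (x : ι → ℝ) {σ : Matrix ι ι ℝ} (hσ : σ.PosSemidef) (u : ι → ℝ) :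
    gaussMeasure (x + u) σ = (gaussMeasure x σ).map (fun w => w + u) := by
  have : IsProbabilityMeasure ((gaussMeasure x σ).map (fun w => w + u)) :=
    Measure.isProbabilityMeasure_map (by fun_prop)
  refine ext_of_integral_exp_eq fun k => ?_
  rw [MeasureTheory.integral_map (by fun_prop) (continuous_exp_dotProduct k).aestronglyMeasurable,
    integral_exp_gaussMeasure _ hσ]
  simp only [dotProduct_add, Complex.ofReal_add, add_mul, Complex.exp_add]
  rw [integral_mul_const, integral_exp_gaussMeasure _ hσ, gaussFactor, gaussFactor,
    ← Complex.exp_add]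
  congr 1
  rw [dotProduct_add]
  push_cast
  ring

/-- Adding an independent Gaussian multiple of `u` adds a rank-one matrix to the covariance. -/
lemma gaussMeasure_add_vecMulVec (x : ι → ℝ) {σ : Matrix ι ι ℝ} (hσ : σ.PosSemidef) (u : ι → ℝ)
    (h : ℝ≥0) (ξ : ℝ) :
    gaussMeasure (x + ξ • u) (σ + (2 * h : ℝ) • Matrix.vecMulVec u u)
      = ((gaussMeasure x σ).prod (gaussianReal ξ h)).map (fun p => p.1 + p.2 • u) := by
  have hσ' : (σ + (2 * h : ℝ) • Matrix.vecMulVec u u).PosSemidef := by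
    refine hσ.add (.smul ?_ (by positivity))
    simpa using Matrix.posSemidef_vecMulVec_self_star u
  have hm : Continuous fun p : (ι → ℝ) × ℝ => p.1 + p.2 • u := by fun_prop
  have : IsProbabilityMeasure
      (((gaussMeasure x σ).prod (gaussianReal ξ h)).map (fun p => p.1 + p.2 • u)) :=
    Measure.isProbabilityMeasure_map hm.measurable.aemeasurable
  refine ext_of_integral_exp_eq fun k => ?_
  have hc := (continuous_exp_dotProduct k).comp hm
  rw [MeasureTheory.integral_map hm.measurable.aemeasurable
      (continuous_exp_dotProduct k).aestronglyMeasurable,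
    integral_exp_gaussMeasure _ hσ', ← integral_gaussFactor_line, integral_prod_symm]
  · refine integral_congr_ae (Eventually.of_forall fun z => ?_)
    simp only
    rw [← integral_exp_gaussMeasure _ hσ, gaussMeasure_add _ hσ,
      MeasureTheory.integral_map (by fun_prop) (continuous_exp_dotProduct k).aestronglyMeasurable]
  · exact .of_bound hc.aestronglyMeasurable 1
      (Eventually.of_forall fun _ => (Complex.norm_exp_ofReal_mul_I _).le)

lemma continuous_integral_gaussMeasure_line
    {c : (ι → ℝ) → ℂ} (hc : Continuous c) (hc1 : ∀ x, ‖c x‖ ≤ 1)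
    {σ : Matrix ι ι ℝ} (hσ : σ.PosSemidef) (x u : ι → ℝ) :
    Continuous fun ξ : ℝ => ∫ w, c w ∂(gaussMeasure (x + ξ • u) σ) := by
  have h : ∀ ξ : ℝ, ∫ w, c w ∂(gaussMeasure (x + ξ • u) σ)
      = ∫ w, c (w + ξ • u) ∂(gaussMeasure x σ) := fun ξ => by
    rw [gaussMeasure_add _ hσ, MeasureTheory.integral_map (by fun_prop) hc.aestronglyMeasurable]
  simp only [h]
  refine MeasureTheory.continuous_of_dominated (bound := fun _ => 1) (fun ξ => ?_)
    (fun ξ => Eventually.of_forall fun w => hc1 _) (integrable_const _)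
    (Eventually.of_forall fun w => ?_)
  · exact (hc.comp (by fun_prop)).aestronglyMeasurable
  · exact hc.comp (by fun_prop)

/-- The Gaussian averages of a function solve the heat equation along every line. -/
lemma integral_integral_gaussMeasure_line
    {c : (ι → ℝ) → ℂ} (hc : Continuous c) (hc1 : ∀ x, ‖c x‖ ≤ 1)
    {σ : Matrix ι ι ℝ} (hσ : σ.PosSemidef) (x u : ι → ℝ)
    (h : ℝ≥0) (ξ : ℝ) :
    ∫ z : ℝ, ∫ w, c w ∂(gaussMeasure (x + z • u) σ) ∂(gaussianReal ξ h)
      = ∫ w, c w ∂(gaussMeasure (x + ξ • u) (σ + (2 * h : ℝ) • Matrix.vecMulVec u u)) := by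
  have hm : Continuous fun p : (ι → ℝ) × ℝ => p.1 + p.2 • u := by fun_prop
  rw [gaussMeasure_add_vecMulVec x hσ, MeasureTheory.integral_map hm.measurable.aemeasurable
    hc.aestronglyMeasurable, integral_prod_symm]
  · refine integral_congr_ae (Eventually.of_forall fun z => ?_)
    simp only
    rw [gaussMeasure_add _ hσ, MeasureTheory.integral_map (by fun_prop) hc.aestronglyMeasurable]
  · exact .of_bound (hc.comp hm).aestronglyMeasurable 1 (Eventually.of_forall fun _ => hc1 _)

/-- The Gaussian averages are continuous as the added variance tends to zero. -/
lemma tendsto_integral_gaussMeasure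
    {c : (ι → ℝ) → ℂ} (hc : Continuous c) (hc1 : ∀ x, ‖c x‖ ≤ 1)
    {σ : Matrix ι ι ℝ} (hσ : σ.PosSemidef) (x u : ι → ℝ) :
    Tendsto (fun m : ℕ => ∫ w, c w ∂(gaussMeasure x
      (σ + (2 * (1 / ((m : ℝ) + 1))) • Matrix.vecMulVec u u))) atTop
      (𝓝 (∫ w, c w ∂(gaussMeasure x σ))) := by
  set g : ℝ → ℂ := fun ξ => ∫ w, c w ∂(gaussMeasure (x + ξ • u) σ) with hg
  have hgc : Continuous g := continuous_integral_gaussMeasure_line hc hc1 hσ x u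
  have hg1 : ∀ ξ, ‖g ξ‖ ≤ 1 := fun ξ => by
    simpa using MeasureTheory.norm_integral_le_of_norm_le_const
      (μ := gaussMeasure (x + ξ • u) σ) (Eventually.of_forall hc1)
  -- the average over `N(0, 1 / (m + 1))` is an average over a rescaled standard Gaussian
  have hs : ∀ m : ℕ, ∫ w, c w ∂(gaussMeasure x
      (σ + (2 * (1 / ((m : ℝ) + 1))) • Matrix.vecMulVec u u))
      = ∫ z, g (√(1 / ((m : ℝ) + 1)) * z) ∂(gaussianReal 0 1) := fun m => by
    have hp : (0 : ℝ) ≤ 1 / ((m : ℝ) + 1) := by positivity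
    have h := integral_integral_gaussMeasure_line hc hc1 hσ x u ⟨1 / ((m : ℝ) + 1), hp⟩ 0
    have hv : gaussianReal 0 ⟨1 / ((m : ℝ) + 1), hp⟩
        = (gaussianReal 0 1).map (√(1 / ((m : ℝ) + 1)) * ·) := by
      rw [gaussianReal_map_const_mul]
      congr 1
      · simp
      · refine NNReal.eq ?_
        simp only [NNReal.coe_mk, mul_one]
        exact (Real.sq_sqrt hp).symm
    rw [zero_smul, add_zero, hv,
      MeasureTheory.integral_map (by fun_prop) hgc.aestronglyMeasurable] at h
    exact h.symm
  simp only [hs]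
  have h0 : ∫ w, c w ∂(gaussMeasure x σ) = ∫ _ : ℝ, g 0 ∂(gaussianReal 0 1) := by
    simp [hg]
  rw [h0]
  refine MeasureTheory.tendsto_integral_of_dominated_convergence (fun _ => 1) (fun m => ?_)
    (integrable_const _) (fun m => Eventually.of_forall fun z => hg1 _)
    (Eventually.of_forall fun z => ?_)
  · exact (hgc.comp (by fun_prop)).aestronglyMeasurable
  · refine (hgc.tendsto 0).comp ?_
    have := ((Real.continuous_sqrt.tendsto 0).comp
      (tendsto_one_div_add_atTop_nhds_zero_nat (𝕜 := ℝ))).mul_const z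
    simpa using this

end GaussianAverage

/-! ### Gaussian-preserving Feller maps of signed measures -/

section Classical

variable {n : ℕ}

lemma gaussMeasure_zero_right (x : Fin n → ℝ) : gaussMeasure x 0 = Measure.dirac x := by
  refine ext_of_integral_exp_eq fun k => ?_
  rw [integral_exp_gaussMeasure x Matrix.PosSemidef.zero, MeasureTheory.integral_dirac, gaussFactor]
  simp

/-- The Fourier transform at `k` of the image of a point mass is, as a function of the point, the
bounded continuous function dual to the character `k`. Averaging it over Gaussian measures puts
`Φ` into the scope of the rigidity theorem, which makes that function a character times a
Gaussian factor. -/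
lemma exists_affine_of_isFeller
    {Φ : SignedMeasure (Fin n → ℝ) →ₗ[ℝ] SignedMeasure (Fin n → ℝ)} (hF : IsFeller Φ)
    (hG : ∀ (μ : Measure (Fin n → ℝ)) [IsGaussian μ],
      ∃ (ν : Measure (Fin n → ℝ)) (_ : IsGaussian ν), Φ μ.toSignedMeasure = ν.toSignedMeasure) :
    ∃ (K α : Matrix (Fin n) (Fin n) ℝ) (y₀ : Fin n → ℝ), α.PosSemidef ∧
      ∀ (μ : SignedMeasure (Fin n → ℝ)) (k : Fin n → ℝ),
        signedCharFun (Φ μ) k = signedCharFun μ (k ᵥ* K) * gaussFactor α y₀ k := by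
  choose c hcc hc using hF.exists_signedCharFun
  have hpos : ∀ (μ : Measure (Fin n → ℝ)) [IsFiniteMeasure μ] (k : Fin n → ℝ),
      signedCharFun (Φ μ.toSignedMeasure) k = ∫ x, c k x ∂μ := fun μ _ k => by
    rw [hc, integral_toSignedMeasure]
  have hgauss : ∀ (μ : Measure (Fin n → ℝ)) [IsGaussian μ],
      ∃ (S : Matrix (Fin n) (Fin n) ℝ) (y : Fin n → ℝ), S.PosSemidef ∧
        ∀ k, ∫ x, c k x ∂μ = gaussFactor S y k := fun μ _ => by
    obtain ⟨ν, hν, h⟩ := hG μ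
    obtain ⟨S, y, hS, hy⟩ := exists_gaussFactor_of_isGaussian ν
    exact ⟨S, y, hS, fun k => by
      rw [← hpos, h, ← hy, signedCharFun, integral_toSignedMeasure]⟩
  choose S Y hS hSY using fun (σ : Matrix (Fin n) (Fin n) ℝ) (x : Fin n → ℝ) =>
    hgauss (gaussMeasure x σ)
  have hdirac : ∀ k x, c k x = gaussFactor (S 0 x) (Y 0 x) k := fun k x => by
    rw [← hSY, gaussMeasure_zero_right, MeasureTheory.integral_dirac]
  have hc1 : ∀ k x, ‖c k x‖ ≤ 1 := fun k x => by
    rw [hdirac]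
    exact norm_gaussFactor_le_one (hS 0 x) _ _
  obtain ⟨K, α, y₀, -, hKα⟩ := exists_affine_of_gaussian_mixture
    (𝒮 := {σ : Matrix (Fin n) (Fin n) ℝ | σ.PosSemidef}) ⟨0, Matrix.PosSemidef.zero⟩
    (fun σ hσ => hσ)
    (fun σ hσ u => hσ.add (by simpa using Matrix.posSemidef_vecMulVec_self_star u))
    (S := S) (Y := Y) (fun σ _ x => hS σ x)
    (fun σ hσ x u k h ξ => by
      simp only [← hSY]
      exact integral_integral_gaussMeasure_line (hcc k) (hc1 k) hσ x u h ξ)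
    (fun σ hσ x u k => by
      simp only [← hSY]
      exact continuous_integral_gaussMeasure_line (hcc k) (hc1 k) hσ x u)
    (fun σ hσ x u k => by
      simp only [← hSY]
      exact tendsto_integral_gaussMeasure (hcc k) (hc1 k) hσ x u)
  have hα : S 0 0 = α := by
    rw [(hKα 0 Matrix.PosSemidef.zero 0).1]
    simp
  refine ⟨K, α, y₀, hα ▸ hS 0 0, fun μ k => ?_⟩
  -- the point mass at `x` is the Gaussian measure with covariance `0`
  have hck : ∀ x, c k x
      = Complex.exp ((((k ᵥ* K) ⬝ᵥ x : ℝ) : ℂ) * Complex.I) * gaussFactor α y₀ k := fun x => by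
    rw [hdirac, (hKα 0 Matrix.PosSemidef.zero x).1, (hKα 0 Matrix.PosSemidef.zero x).2,
      gaussFactor_affine]
    congr 1
    rw [gaussFactor]
    simp
  have hint : ∀ (ν : Measure (Fin n → ℝ)) [IsFiniteMeasure ν], MeasureTheory.Integrable (c k) ν :=
    fun ν _ => .of_bound (hcc k).aestronglyMeasurable 1 (Eventually.of_forall (hc1 k))
  rw [hc, integral_eq_posPart_sub_negPart μ (hint _) (hint _), signedCharFun_eq_sub]
  simp only [hck]
  rw [integral_mul_const, integral_mul_const, sub_mul]

/-- A linear map acting on Fourier transforms by `K`, `α ≥ 0`, `y₀` sends the law of a random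
vector `X` to the law of `K X + Z` with an independent Gaussian `Z` of characteristic function
`gaussFactor α y₀`. -/
lemma map_toSignedMeasure_eq_of_signedCharFun
    {Φ : SignedMeasure (Fin n → ℝ) →ₗ[ℝ] SignedMeasure (Fin n → ℝ)}
    {K α : Matrix (Fin n) (Fin n) ℝ} {y₀ : Fin n → ℝ} (hα : α.PosSemidef)
    (h : ∀ (μ : SignedMeasure (Fin n → ℝ)) (k : Fin n → ℝ),
      signedCharFun (Φ μ) k = signedCharFun μ (k ᵥ* K) * gaussFactor α y₀ k)
    (μ : Measure (Fin n → ℝ)) [IsFiniteMeasure μ] :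
    Φ μ.toSignedMeasure
      = ((μ.prod (gaussMeasure y₀ α)).map fun p => K *ᵥ p.1 + p.2).toSignedMeasure := by
  have hm : Continuous fun p : (Fin n → ℝ) × (Fin n → ℝ) => K *ᵥ p.1 + p.2 := by fun_prop
  refine eq_toSignedMeasure_of_signedCharFun_eq fun k => ?_
  rw [h, signedCharFun, integral_toSignedMeasure, ← integral_exp_gaussMeasure y₀ hα,
    ← integral_prod_mul, MeasureTheory.integral_map hm.measurable.aemeasurable
      (continuous_exp_dotProduct k).aestronglyMeasurable]
  refine integral_congr_ae (Eventually.of_forall fun p => ?_)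
  simp only
  rw [← Complex.exp_add, ← add_mul, ← Complex.ofReal_add, dotProduct_add, Matrix.dotProduct_mulVec]

/-- Positive measures go to laws of `K X + Z`, and the mass is the Fourier transform at zero. -/
lemma isMarkov_of_signedCharFun
    {Φ : SignedMeasure (Fin n → ℝ) →ₗ[ℝ] SignedMeasure (Fin n → ℝ)}
    {K α : Matrix (Fin n) (Fin n) ℝ} {y₀ : Fin n → ℝ} (hα : α.PosSemidef)
    (h : ∀ (μ : SignedMeasure (Fin n → ℝ)) (k : Fin n → ℝ),
      signedCharFun (Φ μ) k = signedCharFun μ (k ᵥ* K) * gaussFactor α y₀ k) : IsMarkov Φ := by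
  refine ⟨fun μ hμ => ?_, fun μ => ?_⟩
  · have hμ' : 0 ≤[Set.univ] μ := (le_restrict_univ_iff_le _ _).2 hμ
    rw [← SignedMeasure.toMeasureOfZeroLE_toSignedMeasure μ hμ',
      map_toSignedMeasure_eq_of_signedCharFun hα h]
    exact Measure.zero_le_toSignedMeasure _
  · have h0 := h μ 0
    rw [Matrix.zero_vecMul, signedCharFun_zero, signedCharFun_zero] at h0
    simpa [gaussFactor] using h0

lemma HasClassicalMoments.two_mul_covariance {μ : Measure (Fin n → ℝ)} {r : Fin n → ℝ}
    {σ : Matrix (Fin n) (Fin n) ℝ} (h : HasClassicalMoments μ r σ) (i j : Fin n) :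
    2 * cov[fun x => x i, fun x => x j; μ] = σ i j := by
  rw [covariance, h.2.1, h.2.1, h.2.2]

/-- The covariance of `gaussMeasure r σ` is `σ / 2` in the usual convention. -/
lemma hasClassicalMoments_gaussMeasure (r : Fin n → ℝ) {σ : Matrix (Fin n) (Fin n) ℝ}
    (hσ : σ.PosSemidef) : HasClassicalMoments (gaussMeasure r σ) r σ := by
  have hmean : ∀ i, ∫ x, x i ∂(gaussMeasure r σ) = r i := fun i => by
    rw [gaussMeasure, MeasureTheory.integral_map (f := fun x : Fin n → ℝ => x i) (by fun_prop)
      (measurable_pi_apply i).aestronglyMeasurable]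
    have h := (EuclideanSpace.proj (𝕜 := ℝ) i).integral_comp_comm
      (μ := multivariateGaussian (WithLp.toLp 2 r) ((1 / 2 : ℝ) • σ)) IsGaussian.integrable_fun_id
    rw [integral_id_multivariateGaussian] at h
    exact h
  refine ⟨fun i => ?_, hmean, fun i j => ?_⟩
  · exact (ContinuousLinearMap.proj (R := ℝ) (φ := fun _ : Fin n => ℝ) i).comp_memLp'
      (IsGaussian.memLp_two_id (μ := gaussMeasure r σ))
  · have h : cov[fun x => x i, fun x => x j; gaussMeasure r σ] = ((1 / 2 : ℝ) • σ) i j := by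
      rw [gaussMeasure, covariance_map_fun (measurable_pi_apply i).aestronglyMeasurable
        (measurable_pi_apply j).aestronglyMeasurable (by fun_prop)]
      exact covariance_eval_multivariateGaussian (hσ.smul (by norm_num)) i j
    rw [covariance, hmean, hmean] at h
    rw [h, Matrix.smul_apply, smul_eq_mul]
    ring

/-- Mean and covariance of `K X + Z` for independent `X` and `Z`. -/
lemma HasClassicalMoments.affine {μ γ : Measure (Fin n → ℝ)} [IsProbabilityMeasure μ]
    [IsProbabilityMeasure γ] {r y : Fin n → ℝ} {σ α : Matrix (Fin n) (Fin n) ℝ}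
    (hμ : HasClassicalMoments μ r σ) (hγ : HasClassicalMoments γ y α)
    (K : Matrix (Fin n) (Fin n) ℝ) :
    HasClassicalMoments ((μ.prod γ).map fun p => K *ᵥ p.1 + p.2) (K *ᵥ r + y)
      (K * σ * Kᵀ + α) := by
  have hm : Continuous fun p : (Fin n → ℝ) × (Fin n → ℝ) => K *ᵥ p.1 + p.2 := by fun_prop
  have hL : ∀ i, MemLp (fun x : Fin n → ℝ => (K *ᵥ x) i) 2 μ := fun i => by
    simp only [Matrix.mulVec, dotProduct]
    exact memLp_finsetSum _ fun j _ => (hμ.1 j).const_mul _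
  have hX : ∀ i, MemLp (fun p : (Fin n → ℝ) × (Fin n → ℝ) => (K *ᵥ p.1) i) 2 (μ.prod γ) :=
    fun i => (hL i).comp_fst γ
  have hZ : ∀ i, MemLp (fun p : (Fin n → ℝ) × (Fin n → ℝ) => p.2 i) 2 (μ.prod γ) :=
    fun i => (hγ.1 i).comp_snd μ
  have hmean : ∀ i, ∫ x, x i ∂((μ.prod γ).map fun p => K *ᵥ p.1 + p.2) = (K *ᵥ r + y) i :=
    fun i => by
      rw [MeasureTheory.integral_map hm.measurable.aemeasurable
        (measurable_pi_apply i).aestronglyMeasurable]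
      simp only [Pi.add_apply]
      rw [MeasureTheory.integral_add ((hX i).integrable one_le_two)
        ((hZ i).integrable one_le_two), integral_fun_fst (fun x => (K *ᵥ x) i),
        integral_fun_snd (fun z : Fin n → ℝ => z i)]
      simp only [probReal_univ, one_smul, hγ.2.1, Matrix.mulVec, dotProduct]
      rw [integral_finsetSum _ fun j _ => ((hμ.1 j).integrable one_le_two).const_mul _]
      simp only [integral_const_mul, hμ.2.1]
  refine ⟨fun i => ?_, hmean, fun i j => ?_⟩
  · rw [memLp_map_measure_iff (measurable_pi_apply i).aestronglyMeasurable
      hm.measurable.aemeasurable]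
    exact (hX i).add (hZ i)
  · have hXX : 2 * cov[fun x => (K *ᵥ x) i, fun x => (K *ᵥ x) j; μ] = (K * σ * Kᵀ) i j := by
      simp only [Matrix.mulVec, dotProduct]
      rw [covariance_fun_sum_fun_sum (fun a => (hμ.1 a).const_mul _)
        (fun a => (hμ.1 a).const_mul _)]
      simp only [covariance_const_mul_left, covariance_const_mul_right, Matrix.mul_apply,
        Matrix.transpose_apply, ← hμ.two_mul_covariance, Finset.mul_sum, Finset.sum_mul]
      rw [Finset.sum_comm]
      exact Finset.sum_congr rfl fun a _ => Finset.sum_congr rfl fun b _ => by ring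
    have hfst : cov[fun p : (Fin n → ℝ) × (Fin n → ℝ) => (K *ᵥ p.1) i,
        fun p => (K *ᵥ p.1) j; μ.prod γ] = cov[fun x => (K *ᵥ x) i, fun x => (K *ᵥ x) j; μ] := by
      have hfst := measurePreserving_fst (μ := μ) (ν := γ)
      conv_rhs => rw [← hfst.map_eq]
      rw [covariance_map_fun (by fun_prop) (by fun_prop) (by fun_prop)]
    have hsnd : cov[fun p : (Fin n → ℝ) × (Fin n → ℝ) => p.2 i,
        fun p => p.2 j; μ.prod γ] = cov[fun x => x i, fun x => x j; γ] := by
      have hsnd := measurePreserving_snd (μ := μ) (ν := γ)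
      conv_rhs => rw [← hsnd.map_eq]
      rw [covariance_map_fun (measurable_pi_apply i).aestronglyMeasurable
        (measurable_pi_apply j).aestronglyMeasurable measurable_snd.aemeasurable]
    have hcross : cov[fun p : (Fin n → ℝ) × (Fin n → ℝ) => p.2 i,
        fun p => (K *ᵥ p.1) j; μ.prod γ] = 0 := by
      rw [covariance_comm]
      exact covariance_fst_snd_prod (hL j) (hγ.1 i)
    have h : 2 * cov[fun x => x i, fun x => x j; (μ.prod γ).map fun p => K *ᵥ p.1 + p.2]
        = (K * σ * Kᵀ + α) i j := by
      have e : cov[fun x => x i, fun x => x j; (μ.prod γ).map fun p => K *ᵥ p.1 + p.2]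
          = cov[(fun p : (Fin n → ℝ) × (Fin n → ℝ) => (K *ᵥ p.1) i) + fun p => p.2 i,
            (fun p : (Fin n → ℝ) × (Fin n → ℝ) => (K *ᵥ p.1) j) + fun p => p.2 j; μ.prod γ] := by
        rw [covariance_map (measurable_pi_apply i).aestronglyMeasurable
          (measurable_pi_apply j).aestronglyMeasurable hm.measurable.aemeasurable]
        rfl
      rw [e, covariance_add_left (hX i) (hZ i) ((hX j).add (hZ j)),
        covariance_add_right (hX i) (hX j) (hZ j), covariance_add_right (hZ i) (hX j) (hZ j),
        covariance_fst_snd_prod (hL i) (hγ.1 j), hcross,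
        hfst, hsnd, Matrix.add_apply, ← hXX,
        ← hγ.two_mul_covariance]
      ring
    rw [covariance, hmean, hmean] at h
    exact h

/-- A Gaussian-preserving Feller map acts on laws of random vectors by `X ↦ K X + Z` with an
independent Gaussian `Z`. -/
theorem classical_gaussian_maps (n : ℕ)
    (Φ : SignedMeasure (Fin n → ℝ) →ₗ[ℝ] SignedMeasure (Fin n → ℝ)) (hF : IsFeller Φ)
    (hG : ∀ (μ : Measure (Fin n → ℝ)) [IsGaussian μ],
      ∃ (ν : Measure (Fin n → ℝ)) (_ : IsGaussian ν), Φ μ.toSignedMeasure = ν.toSignedMeasure) :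
    IsMarkov Φ ∧
      ∃ (K α : Matrix (Fin n) (Fin n) ℝ) (y₀ : Fin n → ℝ),
        α.PosSemidef ∧
        (∀ (μ : SignedMeasure (Fin n → ℝ)) (k : Fin n → ℝ),
          signedCharFun (Φ μ) k =
            signedCharFun μ (k ᵥ* K) * gaussFactor α y₀ k) ∧
        (∀ (μ ν : Measure (Fin n → ℝ)) [IsProbabilityMeasure μ] [IsProbabilityMeasure ν]
          (r : Fin n → ℝ) (σ : Matrix (Fin n) (Fin n) ℝ),
          Φ μ.toSignedMeasure = ν.toSignedMeasure →
          HasClassicalMoments μ r σ →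
            HasClassicalMoments ν (K *ᵥ r + y₀) (K * σ * Kᵀ + α)) := by
  obtain ⟨K, α, y₀, hα, h⟩ := exists_affine_of_isFeller hF hG
  refine ⟨isMarkov_of_signedCharFun hα h, K, α, y₀, hα, h, fun μ ν _ _ r σ hμν hμ => ?_⟩
  rw [map_toSignedMeasure_eq_of_signedCharFun hα h,
    Measure.toSignedMeasure_eq_toSignedMeasure_iff] at hμν
  rw [← hμν]
  exact hμ.affine (hasClassicalMoments_gaussMeasure y₀ hα) K

end Classical

end GaussianMaps

end

theorem mainTheorem8 (n : ℕ) :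
    (∀ Φ : HS n →ₗ[ℂ] HS n,
      (∃ C : ℝ, ∀ X, hsNorm (Φ X) ≤ C * hsNorm X) →
      (∀ ρ : HS n, IsGaussianState (ρ : Op n) →
        IsGaussianState (Φ ρ : Op n)) →
      ∃ (K α : Matrix (Quad n) (Quad n) ℝ)
        (y₀ : Quad n → ℝ),
        α.IsSymm ∧ K.det ≠ 0 ∧
        (∀ X : HS n,
          (∃ f, HasCharFun X f) ∧
          ∀ f, HasCharFun X f →
            HasCharFun (Φ X)
              (fun k => f (k ᵥ* K) * gaussFactor α y₀ k)) ∧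
        (∀ (ρ : HS n) (σ : Matrix (Quad n) (Quad n) ℝ)
          (r : Quad n → ℝ),
          IsGaussianStateWith (ρ : Op n) σ r →
            IsGaussianStateWith (Φ ρ : Op n)
              (K * σ * Kᵀ + α) (K *ᵥ r + y₀)) ∧
        (∀ (ρ : HS n) (r : Quad n → ℝ) (σ : Matrix (Quad n) (Quad n) ℝ),
          IsDensity (ρ : Op n) → HasMoments (stateChar (ρ : Op n)) r σ →
            (∃ χ, Continuous χ ∧ HasCharFun (Φ ρ) χ ∧
              HasMoments χ (K *ᵥ r + y₀) (K * σ * Kᵀ + α)) ∧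
            (IsDensity (Φ ρ : Op n) →
              HasMoments (stateChar (Φ ρ : Op n)) (K *ᵥ r + y₀) (K * σ * Kᵀ + α))) ∧
        (∀ σ : Matrix (Quad n) (Quad n) ℝ,
          IsQuantumCov σ → IsQuantumCov (K * σ * Kᵀ + α))) ∧
    (∀ Φ : SignedMeasure (Fin n → ℝ) →ₗ[ℝ] SignedMeasure (Fin n → ℝ),
      IsTVBounded Φ →
      IsFeller Φ →
      (∀ (μ : Measure (Fin n → ℝ)) [IsGaussian μ],
        ∃ (ν : Measure (Fin n → ℝ)) (_ : IsGaussian ν),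
          Φ μ.toSignedMeasure = ν.toSignedMeasure) →
      IsMarkov Φ ∧
      ∃ (K α : Matrix (Fin n) (Fin n) ℝ) (y₀ : Fin n → ℝ),
        α.PosSemidef ∧
        (∀ (μ : SignedMeasure (Fin n → ℝ)) (k : Fin n → ℝ),
          signedCharFun (Φ μ) k =
            signedCharFun μ (k ᵥ* K) * gaussFactor α y₀ k) ∧
        (∀ (μ ν : Measure (Fin n → ℝ)) [IsProbabilityMeasure μ] [IsProbabilityMeasure ν]
          (r : Fin n → ℝ) (σ : Matrix (Fin n) (Fin n) ℝ),
          Φ μ.toSignedMeasure = ν.toSignedMeasure →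
          HasClassicalMoments μ r σ →
            HasClassicalMoments ν (K *ᵥ r + y₀) (K * σ * Kᵀ + α))) := by
  exact ⟨fun Φ hb hΦ => quantum_gaussian_maps n Φ hb hΦ,
    fun Φ _ hF hG => classical_gaussian_maps n Φ hF hG⟩
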